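/- Let $f\colon[0,1]\to[0,1]$ be a $C^2$ unimodal map ($f\in\mathcal U^2$): there is $c\in(0,1)$ such that $f$ is strictly increasing on $[0,c]$ and strictly decreasing on $[c,1]$, $f$ is $C^2$ with $f'\neq 0$ on $[0,1]\setminus\{c\}$, and there are real numbers $\ell_-,\ell_+\ge 1$, a neighbourhood $U$ of $c$ and $C^2$ diffeomorphisms $\phi_\pm,\varphi_\pm$ of $\mathbb R$ with $\phi_\pm(c)=\varphi_\pm(f(c))=0$ such that $|\varphi_-(f(x))|=|\phi_-(x)|^{\ell_-}$ for $x\in U$, $x\le c$, and $|\varphi_+(f(x))|=|\phi_+(x)|^{\ell_+}$ for $x\in U$, $x\ge c$. Put $c_1=f(c)$. A wandering interval of $f$ is a nondegenerate interval $J\subset[0,1]$ such that $J,f(J),f^2(J),\dots$ are pairwise disjoint and for no $x\in J$ is $\omega(x)$ a periodic orbit. Let $Q$ be a maximal wandering interval of $f$ (one not strictly contained in another wandering interval), and let $Q_n=f^n(Q)$. An integer $n\ge1$ is a closest return moment if $\operatorname{dist}(Q_n,c_1)<\operatorname{dist}(Q_j,c_1)$ for all $0\le j<n$. Let $s(0)=0$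 and let $s(1)<s(2)<\cdots$ be all the closest return moments. Let $a_k$ and $b_k$ be the left and the right endpoint of $Q_{s(k)}$, and $$\eta_k=\frac{|b_k-c_1|}{|a_k-c_1|}.$$ **Lemma C.** There are infinitely many closest return moments, and there is a constant $C>0$ such that for all sufficiently large $k$ $$\eta_k\le C\,\eta_{k-1}^{\max(\ell_+,\ell_-)}.$$ -/

import Mathlib

open Set Filter Topology
open scoped Manifold ContDiff

/-- `IsUnimodal r f c ℓm ℓp`: the map `f : [0,1] → [0,1]` (given as a function on `ℝ`, of which only
the values on `[0,1]` matter) is a `C^r` unimodal map with turning point `c`, left critical order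
`ℓm` and right critical order `ℓp`. -/
structure IsUnimodal (r : ℕ) (f : ℝ → ℝ) (c ℓm ℓp : ℝ) : Prop where
  mapsTo : MapsTo f (Icc 0 1) (Icc 0 1)
  mem : c ∈ Ioo (0 : ℝ) 1
  /-- the map turns at `c`, where it has its maximum -/
  strictMonoOn : StrictMonoOn f (Icc 0 c)
  strictAntiOn : StrictAntiOn f (Icc c 1)
  contDiffOn : ContDiffOn ℝ r f (Icc 0 1 \ {c})
  /-- one-sided derivatives at `0` and `1` -/
  deriv_ne_zero : ∀ x ∈ Icc (0 : ℝ) 1 \ {c}, derivWithin f (Icc 0 1) x ≠ 0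
  one_le_left : 1 ≤ ℓm
  one_le_right : 1 ≤ ℓp
  /-- non-flatness to the left of `c`, up to `C^r` diffeomorphisms of `ℝ` -/
  left : ∃ φ ψ : Diffeomorph 𝓘(ℝ, ℝ) 𝓘(ℝ, ℝ) ℝ ℝ r, φ c = 0 ∧ ψ (f c) = 0 ∧
    ∀ᶠ x in 𝓝 c, x ≤ c → |ψ (f x)| = |φ x| ^ ℓm
  /-- non-flatness to the right of `c`, up to `C^r` diffeomorphisms of `ℝ` -/
  right : ∃ φ ψ : Diffeomorph 𝓘(ℝ, ℝ) 𝓘(ℝ, ℝ) ℝ ℝ r, φ c = 0 ∧ ψ (f c) = 0 ∧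
    ∀ᶠ x in 𝓝 c, c ≤ x → |ψ (f x)| = |φ x| ^ ℓp

/-- The `ω`-limit set of the point `x` under iteration of `f`. -/
def omegaSet (f : ℝ → ℝ) (x : ℝ) : Set ℝ :=
  omegaLimit atTop (fun (n : ℕ) (y : ℝ) => f^[n] y) {x}

/-- `S` is the (finite) orbit of a periodic point of `f`. -/
def IsPeriodicOrbit (f : ℝ → ℝ) (S : Set ℝ) : Prop :=
  ∃ p ∈ Function.periodicPts f, S = range fun i : ℕ => f^[i] p

/-- A wandering interval of `f : [0,1] → [0,1]`: a nondegenerate interval (open, closed or half-open)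
whose forward images are pairwise disjoint and none of whose points has a periodic orbit as
`ω`-limit set. -/
structure IsWanderingInterval (f : ℝ → ℝ) (J : Set ℝ) : Prop where
  subset : J ⊆ Icc 0 1
  ordConnected : J.OrdConnected
  nontrivial : J.Nontrivial
  disjoint : Pairwise fun m n : ℕ => Disjoint (f^[m] '' J) (f^[n] '' J)
  omega : ∀ x ∈ J, ¬ IsPeriodicOrbit f (omegaSet f x)

/-- `n ≥ 1` is a closest return moment of `Q` to the critical value `f c`. -/
def IsClosestReturn (f : ℝ → ℝ) (c : ℝ) (Q : Set ℝ) (n : ℕ) : Prop :=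
  1 ≤ n ∧ ∀ k < n, Metric.infDist (f c) (f^[n] '' Q) < Metric.infDist (f c) (f^[k] '' Q)

/-- `s(0) = 0`, and `s(1) < s(2) < ⋯` are the closest return moments in increasing order. -/
noncomputable def returnTime (f : ℝ → ℝ) (c : ℝ) (Q : Set ℝ) : ℕ → ℕ
  | 0 => 0
  | k + 1 => Nat.nth (IsClosestReturn f c Q) k

/-- The left endpoint `a_k` of the `k`-th closest return `f^{s(k)}(Q)`. -/
noncomputable def leftEnd (f : ℝ → ℝ) (c : ℝ) (Q : Set ℝ) (k : ℕ) : ℝ :=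
  sInf (f^[returnTime f c Q k] '' Q)

/-- The right endpoint `b_k` of the `k`-th closest return `f^{s(k)}(Q)`. -/
noncomputable def rightEnd (f : ℝ → ℝ) (c : ℝ) (Q : Set ℝ) (k : ℕ) : ℝ :=
  sSup (f^[returnTime f c Q k] '' Q)

/-- `η_k = |b_k - c₁| / |a_k - c₁|`, where `c₁ = f c` is the critical value. -/
noncomputable def eta (f : ℝ → ℝ) (c : ℝ) (Q : Set ℝ) (k : ℕ) : ℝ :=
  |rightEnd f c Q k - f c| / |leftEnd f c Q k - f c|

theorem mem_omegaSet_iff {f : ℝ → ℝ} {x z : ℝ} :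
    z ∈ omegaSet f x ↔ ∀ ε > 0, ∃ᶠ n in atTop, |f^[n] x - z| < ε := by
  unfold omegaSet
  rw [mem_omegaLimit_singleton_iff_mapClusterPt, mapClusterPt_iff_frequently]
  constructor
  · intro h ε hε
    have := h _ (Metric.ball_mem_nhds z hε)
    simpa [Real.dist_eq] using this
  · intro h s hs
    obtain ⟨ε, hε, hs⟩ := Metric.mem_nhds_iff.1 hs
    exact (h ε hε).mono fun n hn => hs (by simpa [Real.dist_eq] using hn)

theorem omegaSet_subset_of_tendsto_sub {f : ℝ → ℝ} {x y : ℝ}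
    (h : Tendsto (fun n => f^[n] x - f^[n] y) atTop (𝓝 0)) : omegaSet f x ⊆ omegaSet f y := by
  intro z hz
  rw [mem_omegaSet_iff] at *
  intro ε hε
  have h1 : ∀ᶠ n in atTop, |f^[n] x - f^[n] y| < ε / 2 := by
    have := (Metric.tendsto_nhds.1 h) (ε / 2) (by positivity)
    simpa [Real.dist_eq] using this
  refine ((hz (ε / 2) (by positivity)).and_eventually h1).mono ?_
  rintro n ⟨h2, h3⟩
  rw [abs_lt] at *
  constructor <;> linarith

theorem omegaSet_eq_of_tendsto_sub {f : ℝ → ℝ} {x y : ℝ}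
    (h : Tendsto (fun n => f^[n] x - f^[n] y) atTop (𝓝 0)) : omegaSet f x = omegaSet f y := by
  refine (omegaSet_subset_of_tendsto_sub h).antisymm (omegaSet_subset_of_tendsto_sub ?_)
  simpa using h.neg

theorem omegaSet_iterate (f : ℝ → ℝ) (N : ℕ) (x : ℝ) : omegaSet f (f^[N] x) = omegaSet f x := by
  ext z
  rw [mem_omegaSet_iff, mem_omegaSet_iff]
  refine forall₂_congr fun ε _ => ?_
  simp only [← Function.iterate_add_apply]
  have := Filter.map_add_atTop_eq_nat N
  conv_rhs => rw [← this]
  rw [Filter.frequently_map]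

theorem isPeriodicOrbit_omegaSet_of_periodic {f : ℝ → ℝ} {p : ℕ} (hp : 0 < p) {z : ℝ}
    (hz : f^[p] z = z) : IsPeriodicOrbit f (omegaSet f z) := by
  have hper : Function.IsPeriodicPt f p z := hz
  refine ⟨z, Function.mk_mem_periodicPts hp hz, ?_⟩
  have hfin : (range fun i : ℕ => f^[i] z) = (fun i => f^[i] z) '' (Iio p) := by
    ext w
    constructor
    · rintro ⟨i, rfl⟩
      exact ⟨i % p, Nat.mod_lt _ hp, hper.iterate_mod_apply i⟩
    · rintro ⟨i, _, rfl⟩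
      exact ⟨i, rfl⟩
  ext w
  rw [mem_omegaSet_iff]
  constructor
  · intro h
    have hcl : IsClosed (range fun i : ℕ => f^[i] z) := by
      rw [hfin]
      exact ((finite_Iio p).image _).isClosed
    rw [← hcl.closure_eq, Metric.mem_closure_iff]
    intro ε hε
    obtain ⟨n, hn⟩ := (h ε hε).exists
    exact ⟨_, ⟨n, rfl⟩, by rwa [Real.dist_eq, abs_sub_comm]⟩
  · rintro ⟨i, rfl⟩ ε hε
    rw [frequently_atTop]
    intro N
    refine ⟨i + p * N, by nlinarith, ?_⟩
    have : f^[i + p * N] z = f^[i] z := by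
      rw [Function.iterate_add_apply, Function.iterate_mul]
      congr 1
      exact (Function.IsFixedPt.iterate hz N)
    simp [this, hε]

theorem isPeriodicOrbit_omegaSet_of_tendsto {f : ℝ → ℝ} (hc : Continuous f) {p : ℕ} (hp : 0 < p)
    {x z : ℝ} (h : Tendsto (fun n => f^[p * n] x) atTop (𝓝 z)) :
    IsPeriodicOrbit f (omegaSet f x) := by
  have hz : f^[p] z = z := by
    have h1 : Tendsto (fun n => f^[p] (f^[p * n] x)) atTop (𝓝 (f^[p] z)) :=
      ((hc.iterate p).tendsto z).comp h
    have h2 : Tendsto (fun n => f^[p * (n + 1)] x) atTop (𝓝 z) :=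
      h.comp (tendsto_add_atTop_nat 1)
    refine tendsto_nhds_unique h1 (h2.congr fun n => ?_)
    rw [← Function.iterate_add_apply]
    congr 2
    ring
  have hper : Function.IsPeriodicPt f p z := hz
  have key : omegaSet f x = omegaSet f z := by
    apply omegaSet_eq_of_tendsto_sub
    rw [Metric.tendsto_nhds]
    intro ε hε
    have h1 : ∀ j ∈ Finset.range p, ∀ᶠ n in atTop, |f^[j + p * n] x - f^[j] z| < ε := by
      intro j _
      have h1 : Tendsto (fun n => f^[j] (f^[p * n] x)) atTop (𝓝 (f^[j] z)) :=
        ((hc.iterate j).tendsto z).comp h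
      have := (Metric.tendsto_nhds.1 h1) ε hε
      simpa [Real.dist_eq, Function.iterate_add_apply] using this
    have h2 := (Filter.eventually_all_finset _).2 h1
    obtain ⟨N, hN⟩ := eventually_atTop.1 h2
    filter_upwards [eventually_ge_atTop (p * N)] with n hn
    have h3 := hN (n / p) ((Nat.le_div_iff_mul_le hp).2 (by linarith [mul_comm p N])) (n % p)
      (Finset.mem_range.2 (Nat.mod_lt _ hp))
    rw [Nat.mod_add_div, hper.iterate_mod_apply] at h3
    simpa [Real.dist_eq] using h3
  rw [key]
  exact isPeriodicOrbit_omegaSet_of_periodic hp hz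

theorem iterate_congr (f : ℝ → ℝ) {m n : ℕ} (h : m = n) (x : ℝ) : f^[m] x = f^[n] x := by
  rw [h]

theorem iterate_mul_succ (f : ℝ → ℝ) (p n : ℕ) (x : ℝ) :
    f^[p * (n + 1)] x = f^[p] (f^[p * n] x) := by
  rw [← Function.iterate_add_apply]
  congr 2
  ring

theorem isPeriodicOrbit_omegaSet_of_monotone {f : ℝ → ℝ} (hc : Continuous f)
    (hf : ∀ x, f x ∈ Icc (0 : ℝ) 1) {p : ℕ} (hp : 0 < p) {x : ℝ} (hx : x ∈ Icc (0 : ℝ) 1)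
    (h : Monotone (fun n => f^[p * n] x) ∨ Antitone (fun n => f^[p * n] x)) :
    IsPeriodicOrbit f (omegaSet f x) := by
  have hI : ∀ n, f^[n] x ∈ Icc (0 : ℝ) 1 := by
    intro n
    cases n with
    | zero => exact hx
    | succ n => rw [Function.iterate_succ_apply']; exact hf _
  rcases h with h | h
  · refine isPeriodicOrbit_omegaSet_of_tendsto hc hp (tendsto_atTop_ciSup h ⟨1, ?_⟩)
    rintro _ ⟨n, rfl⟩
    exact (hI _).2
  · refine isPeriodicOrbit_omegaSet_of_tendsto hc hp (tendsto_atTop_ciInf h ⟨0, ?_⟩)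
    rintro _ ⟨n, rfl⟩
    exact (hI _).1

theorem isPeriodicOrbit_omegaSet_of_monotoneOn {f : ℝ → ℝ} (hc : Continuous f)
    (hf : ∀ x, f x ∈ Icc (0 : ℝ) 1) {p : ℕ} (hp : 0 < p) {A : Set ℝ}
    (hA : MapsTo f^[p] A A) (hm : MonotoneOn f^[p] A) {x : ℝ} (hxA : x ∈ A)
    (hx : x ∈ Icc (0 : ℝ) 1) : IsPeriodicOrbit f (omegaSet f x) := by
  have hmem : ∀ n, f^[p * n] x ∈ A := by
    intro n
    induction n with
    | zero => simpa using hxA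
    | succ n ih => rw [iterate_mul_succ]; exact hA ih
  apply isPeriodicOrbit_omegaSet_of_monotone hc hf hp hx
  rcases le_total x (f^[p] x) with h | h
  · left
    refine monotone_nat_of_le_succ fun n => ?_
    induction n with
    | zero => simpa using h
    | succ n ih =>
      rw [iterate_mul_succ, iterate_mul_succ f p (n + 1)]
      exact hm (hmem _) (hmem _) ih
  · right
    refine antitone_nat_of_succ_le fun n => ?_
    induction n with
    | zero => simpa using h
    | succ n ih =>
      rw [iterate_mul_succ f p (n + 1)]
      conv_rhs => rw [iterate_mul_succ f p n]
      exact hm (hmem _) (hmem _) ih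

theorem isPeriodicOrbit_omegaSet_of_antitoneOn {f : ℝ → ℝ} (hc : Continuous f)
    (hf : ∀ x, f x ∈ Icc (0 : ℝ) 1) {p : ℕ} (hp : 0 < p) {A : Set ℝ}
    (hA : MapsTo f^[p] A A) (hm : AntitoneOn f^[p] A) {x : ℝ} (hxA : x ∈ A)
    (hx : x ∈ Icc (0 : ℝ) 1) : IsPeriodicOrbit f (omegaSet f x) := by
  have h2 : f^[p + p] = f^[p] ∘ f^[p] := Function.iterate_add f p p
  refine isPeriodicOrbit_omegaSet_of_monotoneOn hc hf (p := p + p) (by omega) (A := A) ?_ ?_ hxA hx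
  · rw [h2]; exact hA.comp hA
  · rw [h2]
    intro u hu v hv huv
    exact hm (hA hv) (hA hu) (hm hu hv huv)

theorem IsWanderingInterval.of_mapsTo {f : ℝ → ℝ} {E E' : Set ℝ} (hE' : IsWanderingInterval f E')
    (hE : E ⊆ Icc 0 1) (ho : E.OrdConnected) (hn : E.Nontrivial) {N : ℕ}
    (hN : MapsTo f^[N] E E') : IsWanderingInterval f E where
  subset := hE
  ordConnected := ho
  nontrivial := hn
  disjoint := by
    intro m n hmn
    rw [Set.disjoint_left]
    rintro _ ⟨x, hx, rfl⟩ ⟨y, hy, hxy⟩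
    have h1 : f^[m] (f^[N] x) = f^[n] (f^[N] y) := by
      rw [← Function.iterate_add_apply, add_comm, Function.iterate_add_apply,
        ← Function.iterate_add_apply f n, add_comm n, Function.iterate_add_apply f N n]
      rw [hxy]
    refine (Set.disjoint_left.1 (hE'.disjoint hmn)) ⟨_, hN hx, h1⟩ ⟨_, hN hy, rfl⟩
  omega := by
    intro x hx
    rw [← omegaSet_iterate f N x]
    exact hE'.omega _ (hN hx)

/-- Intervals in the unit interval that overlap at most `M` times have total length at most `M`. -/
theorem sum_abs_sub_le_of_card_le {s : Finset ℕ} {x y : ℕ → ℝ} {M : ℕ}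
    (hI : ∀ i ∈ s, uIcc (x i) (y i) ⊆ Icc 0 1)
    (hM : ∀ z, ∀ t ⊆ s, (∀ i ∈ t, z ∈ uIcc (x i) (y i)) → t.card ≤ M) :
    ∑ i ∈ s, |x i - y i| ≤ M := by
  classical
  open MeasureTheory in
  have h1 : ∀ i ∈ s, ENNReal.ofReal |x i - y i|
      = ∫⁻ z in Icc (0 : ℝ) 1, (uIcc (x i) (y i)).indicator 1 z := by
    intro i hi
    rw [lintegral_indicator_one measurableSet_uIcc, Measure.restrict_apply measurableSet_uIcc,
      inter_eq_left.2 (hI i hi), Real.volume_interval, abs_sub_comm]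
  have h2 : ∑ i ∈ s, ENNReal.ofReal |x i - y i| ≤ M := by
    rw [Finset.sum_congr rfl h1, ← MeasureTheory.lintegral_finsetSum]
    · calc _ ≤ ∫⁻ z in Icc (0 : ℝ) 1, (M : ENNReal) := by
            apply MeasureTheory.lintegral_mono
            intro z
            have : ∑ i ∈ s, (uIcc (x i) (y i)).indicator (1 : ℝ → ENNReal) z
                = ((s.filter fun i => z ∈ uIcc (x i) (y i)).card : ENNReal) := by
              rw [Finset.card_filter]
              push_cast
              refine Finset.sum_congr rfl fun i _ => ?_
              simp [Set.indicator_apply]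
            simp only [this]
            exact_mod_cast hM z _ (Finset.filter_subset _ _) fun i hi => (Finset.mem_filter.1 hi).2
        _ = M := by simp
    · intro i _
      exact measurable_one.indicator measurableSet_uIcc
  rw [← ENNReal.ofReal_sum_of_nonneg (fun i _ => abs_nonneg _)] at h2
  have h3 : ENNReal.ofReal (∑ i ∈ s, |x i - y i|) ≤ ENNReal.ofReal (M : ℝ) := by
    simpa using h2
  exact (ENNReal.ofReal_le_ofReal_iff (Nat.cast_nonneg M)).1 h3

theorem lt_of_disjoint_ordConnected {α : Type*} [LinearOrder α] {A B : Set α} (hA : A.OrdConnected)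
    (hB : B.OrdConnected) (hd : Disjoint A B) {a b : α} (ha : a ∈ A) (hb : b ∈ B) (hab : a < b)
    {a' b' : α} (ha' : a' ∈ A) (hb' : b' ∈ B) : a' < b' := by
  rw [Set.disjoint_left] at hd
  by_contra! h
  have h1 : a' < b := by
    by_contra! h1
    exact hd (hA.out ha ha' ⟨hab.le, h1⟩) hb
  have h2 : a < b' := by
    by_contra! h2
    exact hd ha (hB.out hb' hb ⟨h2, hab.le⟩)
  exact hd (hA.out ha ha' ⟨h2.le, h⟩) hb'

theorem lt_of_adjacent {α : Type*} [LinearOrder α] [TopologicalSpace α] [OrderTopology α]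
    {I J K : Set α} (hI : I.OrdConnected) (hJ : J.OrdConnected) (hK : K.OrdConnected)
    (hIn : I.Nontrivial) (hKn : K.Nontrivial) (hIJ : Disjoint I J) (hJK : Disjoint J K)
    (hIK : Disjoint I K) {w w' : α} (hw : w ∈ closure I) (hwJ : w ∈ closure J)
    (hw' : w' ∈ closure J) (hwK : w' ∈ closure K) {x y z : α} (hx : x ∈ I) (hy : y ∈ J)
    (hz : z ∈ K) (hxy : x < y) : y < z := by
  by_contra! hzy
  have hzy' : z < y := lt_of_le_of_ne hzy fun h => (Set.disjoint_left.1 hJK) hy (h ▸ hz)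
  have h1 : ∀ i ∈ I, ∀ j ∈ J, i < j := fun i hi j hj =>
    lt_of_disjoint_ordConnected hI hJ hIJ hx hy hxy hi hj
  have h2 : ∀ i ∈ K, ∀ j ∈ J, i < j := fun i hi j hj =>
    lt_of_disjoint_ordConnected hK hJ hJK.symm hz hy hzy' hi hj
  have h3 : ∀ j ∈ J, w ≤ j := fun j hj =>
    closure_minimal (fun i hi => (h1 i hi j hj).le) isClosed_Iic hw
  have h4 : ∀ j ∈ J, w' ≤ j := fun j hj =>
    closure_minimal (fun i hi => (h2 i hi j hj).le) isClosed_Iic hwK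
  have h5 : w = w' := le_antisymm (closure_minimal h3 isClosed_Ici hw')
    (closure_minimal h4 isClosed_Ici hwJ)
  subst h5
  have h6 : ∀ i ∈ I, i ≤ w := fun i hi =>
    closure_minimal (fun j hj => (h1 i hi j hj).le) isClosed_Ici hwJ
  have h7 : ∀ i ∈ K, i ≤ w := fun i hi =>
    closure_minimal (fun j hj => (h2 i hi j hj).le) isClosed_Ici hw'
  obtain ⟨s, hs, t, ht, hst⟩ := hIn.exists_lt
  obtain ⟨s', hs', t', ht', hst'⟩ := hKn.exists_lt
  have h8 : max s s' < w := max_lt (hst.trans_le (h6 t ht)) (hst'.trans_le (h7 t' ht'))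
  obtain ⟨r, hr, hrI⟩ := mem_closure_iff.1 hw _ isOpen_Ioi h8
  obtain ⟨r', hr', hrK⟩ := mem_closure_iff.1 hwK _ isOpen_Ioi h8
  exact Set.disjoint_left.1 hIK (hI.out hs hrI ⟨le_max_left _ _, le_of_lt hr⟩)
    (hK.out hs' hrK ⟨le_max_right _ _, le_of_lt hr'⟩)

theorem ordConnected_image {f : ℝ → ℝ} (hc : Continuous f) {A : Set ℝ} (hA : A.OrdConnected)
    (n : ℕ) : (f^[n] '' A).OrdConnected :=
  (hA.isPreconnected.image _ (hc.iterate n).continuousOn).ordConnected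

theorem iterate_mem_Icc {f : ℝ → ℝ} (hr : ∀ x, f x ∈ Icc (0 : ℝ) 1) {x : ℝ}
    (hx : x ∈ Icc (0 : ℝ) 1) (n : ℕ) : f^[n] x ∈ Icc (0 : ℝ) 1 := by
  cases n with
  | zero => exact hx
  | succ n => rw [Function.iterate_succ_apply']; exact hr _

theorem image_iterate_subset_Icc {f : ℝ → ℝ} (hr : ∀ x, f x ∈ Icc (0 : ℝ) 1) {A : Set ℝ}
    (hA : A ⊆ Icc 0 1) (n : ℕ) : f^[n] '' A ⊆ Icc 0 1 := by
  rintro _ ⟨x, hx, rfl⟩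
  exact iterate_mem_Icc hr (hA hx) n

theorem sum_abs_iterate_sub_le_one {f : ℝ → ℝ} (hc : Continuous f)
    (hr : ∀ x, f x ∈ Icc (0 : ℝ) 1) {E : Set ℝ} (hE : E ⊆ Icc 0 1) (ho : E.OrdConnected)
    (hd : Pairwise fun m n : ℕ => Disjoint (f^[m] '' E) (f^[n] '' E)) {x y : ℝ} (hx : x ∈ E)
    (hy : y ∈ E) (s : Finset ℕ) : ∑ n ∈ s, |f^[n] x - f^[n] y| ≤ 1 := by
  have hsub : ∀ n, uIcc (f^[n] x) (f^[n] y) ⊆ f^[n] '' E := fun n =>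
    (ordConnected_image hc ho n).uIcc_subset (mem_image_of_mem _ hx) (mem_image_of_mem _ hy)
  have := sum_abs_sub_le_of_card_le (s := s) (x := fun n => f^[n] x) (y := fun n => f^[n] y)
    (M := 1) (fun n _ => (hsub n).trans (image_iterate_subset_Icc hr hE n)) ?_
  · simpa using this
  · intro z t _ hz
    rw [Finset.card_le_one]
    intro a ha b hb
    by_contra hab
    exact Set.disjoint_left.1 (hd hab) (hsub a (hz a ha)) (hsub b (hz b hb))

theorem tendsto_iterate_sub {f : ℝ → ℝ} (hc : Continuous f)
    (hr : ∀ x, f x ∈ Icc (0 : ℝ) 1) {E : Set ℝ} (hE : E ⊆ Icc 0 1) (ho : E.OrdConnected)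
    (hd : Pairwise fun m n : ℕ => Disjoint (f^[m] '' E) (f^[n] '' E)) {x y : ℝ} (hx : x ∈ E)
    (hy : y ∈ E) : Tendsto (fun n => f^[n] x - f^[n] y) atTop (𝓝 0) := by
  have h1 : Summable fun n => |f^[n] x - f^[n] y| :=
    summable_of_sum_le (fun _ => abs_nonneg _)
      (fun s => sum_abs_iterate_sub_le_one hc hr hE ho hd hx hy s)
  exact (tendsto_zero_iff_abs_tendsto_zero _).2 h1.tendsto_atTop_zero

section Unimodal

variable {f : ℝ → ℝ} {c ℓm ℓp : ℝ}

theorem IsUnimodal.image_nontrivial (hf : IsUnimodal 2 f c ℓm ℓp) {A : Set ℝ} (hA : A ⊆ Icc 0 1)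
    (ho : A.OrdConnected) (hn : A.Nontrivial) : (f '' A).Nontrivial := by
  obtain ⟨x, hx, y, hy, hxy⟩ := hn.exists_lt
  have hx1 := hA hx
  have hy1 := hA hy
  have hcm := hf.mem
  rcases lt_or_ge x c with h | h
  · have hz : min y c ∈ A := ho.out hx hy ⟨le_min hxy.le h.le, min_le_left _ _⟩
    refine ⟨_, mem_image_of_mem f hx, _, mem_image_of_mem f hz, ?_⟩
    refine (hf.strictMonoOn ⟨hx1.1, h.le⟩ ⟨(hA hz).1, min_le_right _ _⟩ (lt_min hxy h)).ne
  · refine ⟨_, mem_image_of_mem f hx, _, mem_image_of_mem f hy, ?_⟩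
    exact (hf.strictAntiOn ⟨h, hx1.2⟩ ⟨h.trans hxy.le, hy1.2⟩ hxy).ne'

theorem IsUnimodal.image_iterate_nontrivial (hf : IsUnimodal 2 f c ℓm ℓp) (hc : Continuous f)
    (hr : ∀ x, f x ∈ Icc (0 : ℝ) 1) {A : Set ℝ} (hA : A ⊆ Icc 0 1)
    (ho : A.OrdConnected) (hn : A.Nontrivial) (n : ℕ) : (f^[n] '' A).Nontrivial := by
  induction n with
  | zero => simpa using hn
  | succ n ih =>
    rw [Function.iterate_succ', image_comp]
    exact hf.image_nontrivial (image_iterate_subset_Icc hr hA n) (ordConnected_image hc ho n) ih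

theorem IsUnimodal.le_turning (hf : IsUnimodal 2 f c ℓm ℓp) {x : ℝ} (hx : x ∈ Icc (0 : ℝ) 1) :
    f x ≤ f c := by
  have hcm := hf.mem
  rcases le_total x c with h | h
  · exact hf.strictMonoOn.monotoneOn ⟨hx.1, h⟩ ⟨hcm.1.le, le_rfl⟩ h
  · exact hf.strictAntiOn.antitoneOn ⟨le_rfl, hcm.2.le⟩ ⟨h, hx.2⟩ h

theorem subset_side {A : Set ℝ} (hA : A ⊆ Icc 0 1) (ho : A.OrdConnected) (hcA : c ∉ A) :
    A ⊆ Ico 0 c ∨ A ⊆ Ioc c 1 := by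
  by_contra! h
  obtain ⟨h1, h2⟩ := h
  rw [Set.not_subset] at h1 h2
  obtain ⟨x, hx, hx'⟩ := h1
  obtain ⟨y, hy, hy'⟩ := h2
  have h3 : c ≤ x := by
    by_contra! h3
    exact hx' ⟨(hA hx).1, h3⟩
  have h4 : y ≤ c := by
    by_contra! h4
    exact hy' ⟨h4, (hA hy).2⟩
  exact hcA (ho.out hy hx ⟨h4, h3⟩)

theorem IsUnimodal.strictMonoOn_or_strictAntiOn_iterate (hf : IsUnimodal 2 f c ℓm ℓp)
    (hc : Continuous f) (hr : ∀ x, f x ∈ Icc (0 : ℝ) 1) {A : Set ℝ} (hA : A ⊆ Icc 0 1)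
    (ho : A.OrdConnected) (n : ℕ) (hcA : ∀ i < n, c ∉ f^[i] '' A) :
    StrictMonoOn f^[n] A ∨ StrictAntiOn f^[n] A := by
  induction n with
  | zero => exact Or.inl fun x _ y _ h => h
  | succ n ih =>
    rw [Function.iterate_succ']
    have h1 := subset_side (image_iterate_subset_Icc hr hA n) (ordConnected_image hc ho n)
      (hcA n (Nat.lt_succ_self n))
    have h2 := ih fun i hi => hcA i (hi.trans (Nat.lt_succ_self n))
    have hm : MapsTo f^[n] A (f^[n] '' A) := mapsTo_image _ _
    rcases h1 with h1 | h1
    · have h3 : StrictMonoOn f (f^[n] '' A) :=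
        hf.strictMonoOn.mono (h1.trans Ico_subset_Icc_self)
      rcases h2 with h2 | h2
      · exact Or.inl (h3.comp h2 hm)
      · exact Or.inr (h3.comp_strictAntiOn h2 hm)
    · have h3 : StrictAntiOn f (f^[n] '' A) :=
        hf.strictAntiOn.mono (h1.trans Ioc_subset_Icc_self)
      rcases h2 with h2 | h2
      · exact Or.inr (h3.comp_strictMonoOn h2 hm)
      · exact Or.inl (h3.comp h2 hm)

theorem IsUnimodal.isWanderingInterval_of_notMem (hf : IsUnimodal 2 f c ℓm ℓp)
    (hc : Continuous f) (hr : ∀ x, f x ∈ Icc (0 : ℝ) 1) {E : Set ℝ} (hE : E ⊆ Icc 0 1)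
    (ho : E.OrdConnected) (hn : E.Nontrivial) (hcE : ∀ n, c ∉ f^[n] '' E) {x : ℝ} (hx : x ∈ E)
    (hω : ¬ IsPeriodicOrbit f (omegaSet f x)) : IsWanderingInterval f E := by
  have key : ∀ i p, 0 < p → Disjoint (f^[i] '' E) (f^[i + p] '' E) := by
    intro i p hp
    rw [Set.disjoint_left]
    rintro _ ⟨u, hu, rfl⟩ ⟨v, hv, huv⟩
    apply hω
    set A : Set ℝ := ⋃ l : ℕ, f^[i + l * p] '' E with hAdef
    have hAo : A.OrdConnected := by
      refine (IsPreconnected.iUnion_of_chain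
        (fun l => (ordConnected_image hc ho _).isPreconnected) fun l => ?_).ordConnected
      refine ⟨f^[i + l * p] u, ⟨u, hu, rfl⟩, v, hv, ?_⟩
      rw [Nat.succ_eq_succ, add_comm i (l * p), Function.iterate_add_apply f (l * p) i u, ← huv,
        ← Function.iterate_add_apply]
      exact iterate_congr _ (by rw [Nat.succ_eq_add_one]; ring) _
    have hA1 : A ⊆ Icc 0 1 := iUnion_subset fun l => image_iterate_subset_Icc hr hE _
    have hAc : ∀ n, c ∉ f^[n] '' A := by
      rintro n ⟨w, hw, hwc⟩
      obtain ⟨l, y, hy, rfl⟩ := mem_iUnion.1 hw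
      refine hcE (n + (i + l * p)) ⟨y, hy, ?_⟩
      rw [Function.iterate_add_apply, hwc]
    have hAm : MapsTo f^[p] A A := by
      intro w hw
      obtain ⟨l, y, hy, rfl⟩ := mem_iUnion.1 hw
      refine mem_iUnion.2 ⟨l + 1, y, hy, ?_⟩
      rw [← Function.iterate_add_apply]
      exact iterate_congr _ (by ring) _
    have hxA : f^[i] x ∈ A := mem_iUnion.2 ⟨0, x, hx, by simp⟩
    rw [← omegaSet_iterate f i x]
    rcases hf.strictMonoOn_or_strictAntiOn_iterate hc hr hA1 hAo p (fun i _ => hAc i) with h | h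
    · exact isPeriodicOrbit_omegaSet_of_monotoneOn hc hr hp hAm h.monotoneOn hxA (hA1 hxA)
    · exact isPeriodicOrbit_omegaSet_of_antitoneOn hc hr hp hAm h.antitoneOn hxA (hA1 hxA)
  have hd : Pairwise fun m n : ℕ => Disjoint (f^[m] '' E) (f^[n] '' E) := by
    intro m n hmn
    rcases lt_or_gt_of_ne hmn with h | h
    · have := key m (n - m) (by omega)
      rwa [Nat.add_sub_cancel' h.le] at this
    · have := key n (m - n) (by omega)
      rw [Nat.add_sub_cancel' h.le] at this
      exact this.symm
  refine ⟨hE, ho, hn, hd, fun y hy => ?_⟩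
  rwa [omegaSet_eq_of_tendsto_sub (tendsto_iterate_sub hc hr hE ho hd hy hx)]

theorem IsUnimodal.isWanderingInterval_closure (hf : IsUnimodal 2 f c ℓm ℓp)
    (hc : Continuous f) (hr : ∀ x, f x ∈ Icc (0 : ℝ) 1) {J : Set ℝ}
    (hJ : IsWanderingInterval f J) : IsWanderingInterval f (closure J) := by
  have hsub : closure J ⊆ Icc 0 1 := closure_minimal hJ.subset isClosed_Icc
  have ho : (closure J).OrdConnected := hJ.ordConnected.isPreconnected.closure.ordConnected
  obtain ⟨x, hx⟩ := hJ.nontrivial.nonempty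
  have key : ∀ i p, 0 < p → Disjoint (f^[i] '' closure J) (f^[i + p] '' closure J) := by
    intro i p hp
    rw [Set.disjoint_left]
    rintro _ ⟨u, hu, rfl⟩ ⟨v, hv, huv⟩
    apply hJ.omega x hx
    have hI : ∀ l, (f^[i + l * p] '' J).OrdConnected := fun l =>
      ordConnected_image hc hJ.ordConnected _
    have hIn : ∀ l, (f^[i + l * p] '' J).Nontrivial := fun l =>
      hf.image_iterate_nontrivial hc hr hJ.subset hJ.ordConnected hJ.nontrivial _
    have hd : ∀ l l', l ≠ l' → Disjoint (f^[i + l * p] '' J) (f^[i + l' * p] '' J) := by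
      intro l l' hl
      refine hJ.disjoint fun h => hl ?_
      exact Nat.eq_of_mul_eq_mul_right hp (by omega)
    have hw : ∀ l, ∃ w, w ∈ closure (f^[i + l * p] '' J) ∧
        w ∈ closure (f^[i + (l + 1) * p] '' J) := by
      intro l
      refine ⟨f^[i + l * p] u, ?_, ?_⟩
      · exact image_closure_subset_closure_image (hc.iterate _) ⟨u, hu, rfl⟩
      · refine image_closure_subset_closure_image (hc.iterate _) ⟨v, hv, ?_⟩
        rw [add_comm i (l * p), Function.iterate_add_apply f (l * p) i u, ← huv,
          ← Function.iterate_add_apply]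
        exact iterate_congr _ (by ring) _
    have hmem : ∀ l, f^[p * l] (f^[i] x) ∈ f^[i + l * p] '' J := fun l =>
      ⟨x, hx, by rw [← Function.iterate_add_apply]; exact iterate_congr _ (by ring) _⟩
    have hx1 := iterate_mem_Icc hr (hJ.subset hx) i
    rw [← omegaSet_iterate f i x]
    apply isPeriodicOrbit_omegaSet_of_monotone hc hr hp hx1
    have hne : f^[p * 0] (f^[i] x) ≠ f^[p * 1] (f^[i] x) := fun h =>
      Set.disjoint_left.1 (hd 0 1 (by norm_num)) (hmem 0) (h ▸ hmem 1)
    rcases lt_or_gt_of_ne hne with h | h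
    · left
      have : ∀ l, f^[p * l] (f^[i] x) < f^[p * (l + 1)] (f^[i] x) := by
        intro l
        induction l with
        | zero => exact h
        | succ l ih =>
          obtain ⟨w, hw1, hw2⟩ := hw l
          obtain ⟨w', hw1', hw2'⟩ := hw (l + 1)
          exact lt_of_adjacent (hI l) (hI (l + 1)) (hI (l + 1 + 1)) (hIn _) (hIn _)
            (hd _ _ (by omega)) (hd _ _ (by omega)) (hd _ _ (by omega)) hw1 hw2 hw1' hw2'
            (hmem l) (hmem _) (hmem _) ih
      exact monotone_nat_of_le_succ fun l => (this l).le
    · right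
      have : ∀ l, f^[p * (l + 1)] (f^[i] x) < f^[p * l] (f^[i] x) := by
        intro l
        induction l with
        | zero => exact h
        | succ l ih =>
          obtain ⟨w, hw1, hw2⟩ := hw l
          obtain ⟨w', hw1', hw2'⟩ := hw (l + 1)
          exact lt_of_adjacent (α := ℝᵒᵈ) (hI l).dual (hI (l + 1)).dual (hI (l + 1 + 1)).dual
            (hIn _) (hIn _)
            (hd _ _ (by omega)) (hd _ _ (by omega)) (hd _ _ (by omega)) hw1 hw2 hw1' hw2'
            (hmem l) (hmem _) (hmem _) ih
      exact antitone_nat_of_succ_le fun l => (this l).le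
  have hd : Pairwise fun m n : ℕ => Disjoint (f^[m] '' closure J) (f^[n] '' closure J) := by
    intro m n hmn
    rcases lt_or_gt_of_ne hmn with h | h
    · have := key m (n - m) (by omega)
      rwa [Nat.add_sub_cancel' h.le] at this
    · have := key n (m - n) (by omega)
      rw [Nat.add_sub_cancel' h.le] at this
      exact this.symm
  refine ⟨hsub, ho, hJ.nontrivial.mono subset_closure, hd, fun y hy => ?_⟩
  rw [omegaSet_eq_of_tendsto_sub
    (tendsto_iterate_sub hc hr hsub ho hd hy (subset_closure hx))]
  exact hJ.omega x hx

end Unimodal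

/-- The average slopes of `g` on any two subintervals of an interval of length `L` contained in `S`
differ by a factor of at most `exp (C * L)`. -/
def BddDistortion (g : ℝ → ℝ) (S : Set ℝ) (C : ℝ) : Prop :=
  ∀ p ∈ S, ∀ p' ∈ S, ∀ x ∈ uIcc p p', ∀ y ∈ uIcc p p', ∀ x' ∈ uIcc p p', ∀ y' ∈ uIcc p p',
    |g y - g x| * |y' - x'| ≤ Real.exp (C * |p' - p|) * (|g y' - g x'| * |y - x|)

theorem exists_bddDistortion {g : ℝ → ℝ} {u v : ℝ} (huv : u < v)
    (hg : ContDiffOn ℝ 2 g (Icc u v)) (hd : ∀ x ∈ Icc u v, derivWithin g (Icc u v) x ≠ 0) :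
    ∃ C, 0 ≤ C ∧ BddDistortion g (Icc u v) C := by
  have hu := uniqueDiffOn_Icc huv
  set d := derivWithin g (Icc u v) with hddef
  have hd1 : ContDiffOn ℝ 1 d (Icc u v) := hg.derivWithin hu (by norm_num)
  have hdc : ContinuousOn d (Icc u v) := hd1.continuousOn
  have hne : (Icc u v).Nonempty := nonempty_Icc.2 huv.le
  obtain ⟨x₀, hx₀, hmin⟩ := isCompact_Icc.exists_isMinOn hne hdc.abs
  set m := |d x₀| with hm
  have hm0 : 0 < m := abs_pos.2 (hd x₀ hx₀)
  have hmle : ∀ x ∈ Icc u v, m ≤ |d x| := fun x hx => hmin hx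
  have hdd : ContinuousOn (derivWithin d (Icc u v)) (Icc u v) :=
    hd1.continuousOn_derivWithin hu (by norm_num)
  obtain ⟨L, hL⟩ := isCompact_Icc.exists_bound_of_continuousOn hdd
  have hL0 : 0 ≤ L := (norm_nonneg _).trans (hL u ⟨le_rfl, huv.le⟩)
  have hLip : ∀ x ∈ Icc u v, ∀ y ∈ Icc u v, |d y - d x| ≤ L * |y - x| := by
    intro x hx y hy
    have := (convex_Icc u v).norm_image_sub_le_of_norm_derivWithin_le
      (hd1.differentiableOn (by norm_num)) hL hx hy
    simpa [Real.norm_eq_abs] using this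
  have hder : ∀ x ∈ Ioo u v, HasDerivAt g (d x) x := fun x hx =>
    ((hg.differentiableOn (by norm_num) x (Ioo_subset_Icc_self hx)).hasDerivWithinAt).hasDerivAt
      (Icc_mem_nhds hx.1 hx.2)
  have hmvt' : ∀ x ∈ Icc u v, ∀ y ∈ Icc u v, x < y → ∃ ξ ∈ Icc x y,
      |g y - g x| = |d ξ| * |y - x| := by
    intro x hx y hy hxy
    obtain ⟨ξ, hξ, h⟩ := exists_hasDerivAt_eq_slope g d hxy
      (hg.continuousOn.mono (Icc_subset_Icc hx.1 hy.2))
      (fun z hz => hder z ⟨hx.1.trans_lt hz.1, hz.2.trans_le hy.2⟩)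
    refine ⟨ξ, Ioo_subset_Icc_self hξ, ?_⟩
    rw [h, abs_div, div_mul_cancel₀]
    exact abs_ne_zero.2 (sub_ne_zero.2 hxy.ne')
  have hmvt : ∀ x ∈ Icc u v, ∀ y ∈ Icc u v, ∃ ξ ∈ uIcc x y,
      |g y - g x| = |d ξ| * |y - x| := by
    intro x hx y hy
    rcases lt_trichotomy x y with h | h | h
    · obtain ⟨ξ, hξ, h'⟩ := hmvt' x hx y hy h
      exact ⟨ξ, by rwa [uIcc_of_le h.le], h'⟩
    · subst h
      exact ⟨x, left_mem_uIcc, by simp⟩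
    · obtain ⟨ξ, hξ, h'⟩ := hmvt' y hy x hx h
      exact ⟨ξ, by rwa [uIcc_of_ge h.le], by rw [abs_sub_comm, h', abs_sub_comm x y]⟩
  refine ⟨L / m, by positivity, ?_⟩
  intro p hp p' hp' x hx y hy x' hx' y' hy'
  have hsub : uIcc p p' ⊆ Icc u v := (ordConnected_Icc).uIcc_subset hp hp'
  obtain ⟨ξ, hξ, h1⟩ := hmvt x (hsub hx) y (hsub hy)
  obtain ⟨ξ', hξ', h2⟩ := hmvt x' (hsub hx') y' (hsub hy')
  have hξp : ξ ∈ uIcc p p' := uIcc_subset_uIcc hx hy hξ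
  have hξp' : ξ' ∈ uIcc p p' := uIcc_subset_uIcc hx' hy' hξ'
  have h3 : |ξ - ξ'| ≤ |p' - p| := abs_sub_le_of_uIcc_subset_uIcc (uIcc_subset_uIcc hξp' hξp)
  have h4 : |d ξ| ≤ |d ξ'| + L * |p' - p| := by
    have := hLip ξ' (hsub hξp') ξ (hsub hξp)
    have h5 := abs_sub_abs_le_abs_sub (d ξ) (d ξ')
    nlinarith
  have h6 : |d ξ| ≤ Real.exp (L / m * |p' - p|) * |d ξ'| := by
    have h7 := Real.add_one_le_exp (L / m * |p' - p|)
    have h8 := hmle ξ' (hsub hξp')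
    have h9 : L * |p' - p| ≤ L / m * |p' - p| * |d ξ'| := by
      have : L * |p' - p| = L / m * |p' - p| * m := by field_simp
      rw [this]
      exact mul_le_mul_of_nonneg_left h8 (by positivity)
    nlinarith [abs_nonneg (d ξ')]
  rw [h1, h2]
  calc |d ξ| * |y - x| * |y' - x'| ≤ Real.exp (L / m * |p' - p|) * |d ξ'| * |y - x| * |y' - x'| := by
        gcongr
    _ = _ := by ring

/-- The cross ratio of the four points `x₁, x₂, x₃, x₄`. -/
noncomputable def crossRatio (x₁ x₂ x₃ x₄ : ℝ) : ℝ :=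
  |x₂ - x₁| * |x₄ - x₃| / (|x₃ - x₂| * |x₄ - x₁|)

/-- The four points are strictly monotone in one of the two directions. -/
def Ordered₄ (x₁ x₂ x₃ x₄ : ℝ) : Prop :=
  (x₁ < x₂ ∧ x₂ < x₃ ∧ x₃ < x₄) ∨ (x₄ < x₃ ∧ x₃ < x₂ ∧ x₂ < x₁)

theorem crossRatio_nonneg (x₁ x₂ x₃ x₄ : ℝ) : 0 ≤ crossRatio x₁ x₂ x₃ x₄ := by
  unfold crossRatio; positivity

theorem crossRatio_symm (x₁ x₂ x₃ x₄ : ℝ) : crossRatio x₄ x₃ x₂ x₁ = crossRatio x₁ x₂ x₃ x₄ := by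
  unfold crossRatio
  rw [abs_sub_comm x₃ x₄, abs_sub_comm x₁ x₂, abs_sub_comm x₂ x₃, abs_sub_comm x₁ x₄]
  ring

theorem Ordered₄.mem {x₁ x₂ x₃ x₄ : ℝ} (h : Ordered₄ x₁ x₂ x₃ x₄) :
    x₂ ∈ uIcc x₁ x₄ ∧ x₃ ∈ uIcc x₁ x₄ := by
  rcases h with ⟨h1, h2, h3⟩ | ⟨h1, h2, h3⟩
  · rw [uIcc_of_le (by linarith)]
    constructor <;> constructor <;> linarith
  · rw [uIcc_of_ge (by linarith)]
    constructor <;> constructor <;> linarith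

theorem Ordered₄.abs_pos {x₁ x₂ x₃ x₄ : ℝ} (h : Ordered₄ x₁ x₂ x₃ x₄) :
    0 < |x₂ - x₁| ∧ 0 < |x₃ - x₂| ∧ 0 < |x₄ - x₃| ∧ 0 < |x₄ - x₁| := by
  simp only [_root_.abs_pos, sub_ne_zero]
  rcases h with ⟨h1, h2, h3⟩ | ⟨h1, h2, h3⟩
  · exact ⟨h1.ne', h2.ne', h3.ne', (h1.trans (h2.trans h3)).ne'⟩
  · exact ⟨h3.ne, h2.ne, h1.ne, (h1.trans (h2.trans h3)).ne⟩

theorem BddDistortion.crossRatio_le {g : ℝ → ℝ} {S : Set ℝ} {C : ℝ} (hg : BddDistortion g S C)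
    {x₁ x₂ x₃ x₄ : ℝ} (h : Ordered₄ x₁ x₂ x₃ x₄) (h1 : x₁ ∈ S) (h4 : x₄ ∈ S) :
    crossRatio (g x₁) (g x₂) (g x₃) (g x₄)
      ≤ Real.exp (2 * C * |x₄ - x₁|) * crossRatio x₁ x₂ x₃ x₄ := by
  obtain ⟨m2, m3⟩ := h.mem
  obtain ⟨p1, p2, p3, p4⟩ := h.abs_pos
  have e1 := hg x₁ h1 x₄ h4 x₁ left_mem_uIcc x₂ m2 x₁ left_mem_uIcc x₄ right_mem_uIcc
  have e2 := hg x₁ h1 x₄ h4 x₃ m3 x₄ right_mem_uIcc x₂ m2 x₃ m3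
  unfold crossRatio
  set E := Real.exp (C * |x₄ - x₁|) with hE
  have hE2 : Real.exp (2 * C * |x₄ - x₁|) = E * E := by rw [hE, ← Real.exp_add]; ring_nf
  rw [hE2]
  rcases (mul_nonneg (abs_nonneg (g x₃ - g x₂)) (abs_nonneg (g x₄ - g x₁))).eq_or_lt with h0 | h0
  · rw [← h0, div_zero]; positivity
  · rw [← mul_div_assoc, div_le_div_iff₀ h0 (by positivity)]
    calc _ = (|g x₂ - g x₁| * |x₄ - x₁|) * (|g x₄ - g x₃| * |x₃ - x₂|) := by ring
      _ ≤ (E * (|g x₄ - g x₁| * |x₂ - x₁|)) * (E * (|g x₃ - g x₂| * |x₄ - x₃|)) := by gcongr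
      _ = _ := by ring

theorem BddDistortion.le_crossRatio {g : ℝ → ℝ} {S : Set ℝ} {C : ℝ} (hg : BddDistortion g S C)
    {x₁ x₂ x₃ x₄ : ℝ} (h : Ordered₄ x₁ x₂ x₃ x₄) (h1 : x₁ ∈ S) (h4 : x₄ ∈ S)
    (hinj : Function.Injective g) :
    crossRatio x₁ x₂ x₃ x₄
      ≤ Real.exp (2 * C * |x₄ - x₁|) * crossRatio (g x₁) (g x₂) (g x₃) (g x₄) := by
  obtain ⟨m2, m3⟩ := h.mem
  obtain ⟨p1, p2, p3, p4⟩ := h.abs_pos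
  have e1 := hg x₁ h1 x₄ h4 x₁ left_mem_uIcc x₄ right_mem_uIcc x₁ left_mem_uIcc x₂ m2
  have e2 := hg x₁ h1 x₄ h4 x₂ m2 x₃ m3 x₃ m3 x₄ right_mem_uIcc
  unfold crossRatio
  set E := Real.exp (C * |x₄ - x₁|) with hE
  have hE2 : Real.exp (2 * C * |x₄ - x₁|) = E * E := by rw [hE, ← Real.exp_add]; ring_nf
  rw [hE2]
  have h0 : 0 < |g x₃ - g x₂| * |g x₄ - g x₁| := by
    apply mul_pos <;> rw [abs_pos, sub_ne_zero]
    · exact hinj.ne (sub_ne_zero.1 (abs_pos.1 p2))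
    · exact hinj.ne (sub_ne_zero.1 (abs_pos.1 p4))
  rw [← mul_div_assoc, div_le_div_iff₀ (by positivity) h0]
  calc _ = (|g x₄ - g x₁| * |x₂ - x₁|) * (|g x₃ - g x₂| * |x₄ - x₃|) := by ring
    _ ≤ (E * (|g x₂ - g x₁| * |x₄ - x₁|)) * (E * (|g x₄ - g x₃| * |x₃ - x₂|)) := by gcongr
    _ = _ := by ring

theorem mul_sinh_le_sinh_mul {l u : ℝ} (hl : 1 ≤ l) (hu : 0 ≤ u) :
    l * Real.sinh u ≤ Real.sinh (l * u) := by
  have hd : ∀ x, HasDerivAt (fun x => Real.sinh (l * x) - l * Real.sinh x)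
      (Real.cosh (l * x) * (l * 1) - l * Real.cosh x) x := fun x =>
    (((hasDerivAt_id x).const_mul l).sinh).sub ((Real.hasDerivAt_sinh x).const_mul l)
  have hmono : MonotoneOn (fun x => Real.sinh (l * x) - l * Real.sinh x) (Ici 0) := by
    apply monotoneOn_of_deriv_nonneg (convex_Ici 0)
    · exact fun x _ => (hd x).continuousAt.continuousWithinAt
    · exact fun x _ => (hd x).differentiableAt.differentiableWithinAt
    · intro x hx
      rw [interior_Ici] at hx
      have hx0 : 0 < x := hx
      rw [(hd x).deriv]
      have : Real.cosh x ≤ Real.cosh (l * x) := by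
        rw [Real.cosh_le_cosh, abs_of_pos hx0, abs_of_pos (by positivity)]
        nlinarith
      nlinarith
  have := hmono (show (0 : ℝ) ∈ Ici 0 by simp) (show u ∈ Ici 0 from hu) hu
  simp at this
  linarith

theorem exp_sub_exp (p q : ℝ) :
    Real.exp q - Real.exp p = 2 * Real.exp ((p + q) / 2) * Real.sinh ((q - p) / 2) := by
  have h1 : Real.exp q = Real.exp ((p + q) / 2) * Real.exp ((q - p) / 2) := by
    rw [← Real.exp_add]; ring_nf
  have h2 : Real.exp p = Real.exp ((p + q) / 2) * Real.exp (-((q - p) / 2)) := by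
    rw [← Real.exp_add]; ring_nf
  rw [Real.sinh_eq, h1, h2]; ring

theorem rpow_deriv_mul_le {l x y : ℝ} (hl : 1 ≤ l) (hx : 0 < x) (hxy : x < y) :
    (l * y ^ (l - 1)) * (l * x ^ (l - 1)) * (y - x) ^ 2 ≤ (y ^ l - x ^ l) ^ 2 := by
  have hy : 0 < y := hx.trans hxy
  obtain ⟨p, rfl⟩ : ∃ p, Real.exp p = x := ⟨_, Real.exp_log hx⟩
  obtain ⟨q, rfl⟩ : ∃ q, Real.exp q = y := ⟨_, Real.exp_log hy⟩
  have hpq : p < q := Real.exp_lt_exp.1 hxy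
  simp only [← Real.exp_mul]
  rw [exp_sub_exp p q, exp_sub_exp (p * l) (q * l)]
  have h1 := mul_sinh_le_sinh_mul hl (u := (q - p) / 2) (by linarith)
  have h2 : (q * l - p * l) / 2 = l * ((q - p) / 2) := by ring
  have h3 : Real.exp (q * (l - 1)) * Real.exp (p * (l - 1)) * Real.exp ((p + q) / 2) ^ 2
      = Real.exp ((p * l + q * l) / 2) ^ 2 := by
    rw [← Real.exp_add, ← Real.exp_nat_mul, ← Real.exp_nat_mul, ← Real.exp_add]
    congr 1; push_cast; ring
  have h0 : 0 ≤ l * Real.sinh ((q - p) / 2) :=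
    mul_nonneg (by linarith) (Real.sinh_nonneg_iff.2 (by linarith))
  rw [h2]
  calc _ = 4 * (Real.exp (q * (l - 1)) * Real.exp (p * (l - 1)) * Real.exp ((p + q) / 2) ^ 2)
        * (l * Real.sinh ((q - p) / 2)) ^ 2 := by ring
    _ ≤ 4 * Real.exp ((p * l + q * l) / 2) ^ 2 * Real.sinh (l * ((q - p) / 2)) ^ 2 := by
        rw [h3]; gcongr
    _ = _ := by ring

theorem rpow_sub_pos {l x y : ℝ} (hl : 1 ≤ l) (hx : 0 ≤ x) (hxy : x < y) : 0 < y ^ l - x ^ l :=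
  sub_pos.2 (Real.rpow_lt_rpow hx hxy (by linarith))

theorem rpow_slope_antitone {l : ℝ} (hl : 1 ≤ l) (y : ℝ) :
    AntitoneOn (fun x => (l * y ^ (l - 1)) / (y ^ l - x ^ l) - 1 / (y - x)) (Ico 0 y) := by
  have hd : ∀ x ∈ Ico 0 y, HasDerivAt
      (fun x => (l * y ^ (l - 1)) / (y ^ l - x ^ l) - 1 / (y - x))
      ((0 * (y ^ l - x ^ l) - (l * y ^ (l - 1)) * (0 - l * x ^ (l - 1))) / (y ^ l - x ^ l) ^ 2
        - (0 * (y - x) - 1 * (0 - 1)) / (y - x) ^ 2) x := by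
    intro x hx
    have h1 := (hasDerivAt_const x (y ^ l)).sub (Real.hasDerivAt_rpow_const (x := x) (Or.inr hl))
    have h2 := (hasDerivAt_const x y).sub (hasDerivAt_id x)
    exact ((hasDerivAt_const x (l * y ^ (l - 1))).div h1 (rpow_sub_pos hl hx.1 hx.2).ne').sub
      ((hasDerivAt_const x (1 : ℝ)).div h2 (sub_pos.2 hx.2).ne')
  apply antitoneOn_of_deriv_nonpos (convex_Ico 0 y)
  · exact fun x hx => (hd x hx).continuousAt.continuousWithinAt
  · exact fun x hx => (hd x (interior_subset hx)).differentiableAt.differentiableWithinAt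
  · intro x hx
    rw [interior_Ico] at hx
    rw [(hd x ⟨hx.1.le, hx.2⟩).deriv]
    have h1 := rpow_deriv_mul_le hl hx.1 hx.2
    have h2 := rpow_sub_pos hl hx.1.le hx.2
    have h3 : 0 < y - x := sub_pos.2 hx.2
    rw [sub_nonpos, div_le_div_iff₀ (by positivity) (by positivity)]
    nlinarith

theorem crossRatio_rpow_le_of_lt {l x₁ x₂ x₃ x₄ : ℝ} (hl : 1 ≤ l) (h0 : 0 ≤ x₁) (h1 : x₁ < x₂)
    (h2 : x₂ < x₃) (h3 : x₃ < x₄) :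
    crossRatio (x₁ ^ l) (x₂ ^ l) (x₃ ^ l) (x₄ ^ l) ≤ crossRatio x₁ x₂ x₃ x₄ := by
  have hl0 : 0 < l := by linarith
  have hd : ∀ y ∈ Ioi x₂, HasDerivAt (fun y => Real.log (y ^ l - x₂ ^ l) + Real.log (y - x₁)
      - Real.log (y ^ l - x₁ ^ l) - Real.log (y - x₂))
      ((l * y ^ (l - 1)) / (y ^ l - x₂ ^ l) + 1 / (y - x₁)
        - (l * y ^ (l - 1)) / (y ^ l - x₁ ^ l) - 1 / (y - x₂)) y := by
    intro y hy
    have hy : x₂ < y := hy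
    have hp := Real.hasDerivAt_rpow_const (x := y) (Or.inr hl)
    have a1 := (hp.sub_const (x₂ ^ l)).log (rpow_sub_pos hl (h0.trans h1.le) hy).ne'
    have a2 := ((hasDerivAt_id y).sub_const x₁).log (sub_pos.2 (h1.trans hy)).ne'
    have a3 := (hp.sub_const (x₁ ^ l)).log (rpow_sub_pos hl h0 (h1.trans hy)).ne'
    have a4 := ((hasDerivAt_id y).sub_const x₂).log (sub_pos.2 hy).ne'
    exact ((a1.add a2).sub a3).sub a4
  have hanti : AntitoneOn (fun y => Real.log (y ^ l - x₂ ^ l) + Real.log (y - x₁)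
      - Real.log (y ^ l - x₁ ^ l) - Real.log (y - x₂)) (Ioi x₂) := by
    apply antitoneOn_of_deriv_nonpos (convex_Ioi x₂)
    · exact fun x hx => (hd x hx).continuousAt.continuousWithinAt
    · exact fun x hx => (hd x (interior_subset hx)).differentiableAt.differentiableWithinAt
    · intro y hy
      rw [interior_Ioi] at hy
      have hy' : x₂ < y := hy
      rw [(hd y hy).deriv]
      have := rpow_slope_antitone hl y ⟨h0, h1.trans hy'⟩
        ⟨h0.trans h1.le, hy'⟩ h1.le
      simp only at this
      linarith
  have key := hanti (show x₃ ∈ Ioi x₂ from h2) (show x₄ ∈ Ioi x₂ from h2.trans h3) h3.le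
  simp only at key
  have p32 := rpow_sub_pos hl (h0.trans h1.le) h2
  have p42 := rpow_sub_pos hl (h0.trans h1.le) (h2.trans h3)
  have p31 := rpow_sub_pos hl h0 (h1.trans h2)
  have p41 := rpow_sub_pos hl h0 (h1.trans (h2.trans h3))
  have p21 := rpow_sub_pos hl h0 h1
  have p43 := rpow_sub_pos hl (h0.trans (h1.trans h2).le) h3
  have q32 : 0 < x₃ - x₂ := by linarith
  have q42 : 0 < x₄ - x₂ := by linarith
  have q31 : 0 < x₃ - x₁ := by linarith
  have q41 : 0 < x₄ - x₁ := by linarith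
  have q21 : 0 < x₂ - x₁ := by linarith
  have q43 : 0 < x₄ - x₃ := by linarith
  have key2 : (x₄ ^ l - x₂ ^ l) * (x₄ - x₁) * ((x₃ ^ l - x₁ ^ l) * (x₃ - x₂))
      ≤ (x₃ ^ l - x₂ ^ l) * (x₃ - x₁) * ((x₄ ^ l - x₁ ^ l) * (x₄ - x₂)) := by
    rw [← Real.log_le_log_iff (by positivity) (by positivity)]
    rw [Real.log_mul (by positivity) (by positivity), Real.log_mul (by positivity) (by positivity),
      Real.log_mul (by positivity) (by positivity), Real.log_mul (by positivity) (by positivity),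
      Real.log_mul (by positivity) (by positivity), Real.log_mul (by positivity) (by positivity)]
    linarith
  unfold crossRatio
  rw [abs_of_pos p21, abs_of_pos p43, abs_of_pos p32, abs_of_pos p41, abs_of_pos q21,
    abs_of_pos q43, abs_of_pos q32, abs_of_pos q41, div_le_div_iff₀ (by positivity) (by positivity)]
  nlinarith

theorem crossRatio_rpow_le {l x₁ x₂ x₃ x₄ : ℝ} (hl : 1 ≤ l) (h : Ordered₄ x₁ x₂ x₃ x₄)
    (h1 : 0 ≤ x₁) (h4 : 0 ≤ x₄) :
    crossRatio (x₁ ^ l) (x₂ ^ l) (x₃ ^ l) (x₄ ^ l) ≤ crossRatio x₁ x₂ x₃ x₄ := by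
  rcases h with ⟨a, b, d⟩ | ⟨a, b, d⟩
  · exact crossRatio_rpow_le_of_lt hl h1 a b d
  · rw [← crossRatio_symm (x₁ ^ l), ← crossRatio_symm x₁]
    exact crossRatio_rpow_le_of_lt hl h4 a b d

theorem Diffeomorph.exists_strictMono_abs_eq
    (φ : Diffeomorph 𝓘(ℝ, ℝ) 𝓘(ℝ, ℝ) ℝ ℝ (2 : ℕ)) {y : ℝ} (hy : φ y = 0) :
    ∃ g : ℝ → ℝ, ContDiff ℝ 2 g ∧ StrictMono g ∧ (∀ x, deriv g x ≠ 0) ∧ g y = 0 ∧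
      ∀ x, |φ x| = |g x| := by
  have h1 : ContDiff ℝ 2 φ := by
    have := φ.contMDiff_toFun
    rw [contMDiff_iff_contDiff] at this
    exact_mod_cast this
  have h2 : ContDiff ℝ 2 φ.symm := by
    have := φ.symm.contMDiff_toFun
    rw [contMDiff_iff_contDiff] at this
    exact_mod_cast this
  have hd : ∀ x, deriv φ x ≠ 0 := by
    intro x h0
    have d1 : HasDerivAt φ 0 x := by
      have := (h1.differentiable (by norm_num) x).hasDerivAt
      rwa [h0] at this
    have d2 := (h2.differentiable (by norm_num) (φ x)).hasDerivAt
    have d3 := d2.comp x d1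
    have : (φ.symm ∘ φ) = id := by
      ext z; simp
    rw [this, mul_zero] at d3
    exact zero_ne_one (d3.unique (hasDerivAt_id x))
  rcases h1.continuous.strictMono_of_inj φ.injective with h | h
  · exact ⟨φ, h1, h, hd, hy, fun _ => rfl⟩
  · refine ⟨fun x => -φ x, h1.neg, fun a b hab => neg_lt_neg (h hab), fun x => ?_, by simp [hy],
      fun x => (abs_neg _).symm⟩
    rw [deriv.fun_neg]
    exact neg_ne_zero.2 (hd x)

/-- The estimates on a one-sided neighbourhood of the turning point that the proof uses: `f` does
not increase cross ratios by more than a controlled factor, and `f c - f x` is comparable to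
`|x - c| ^ l`. -/
structure SideEstimates (f : ℝ → ℝ) (c : ℝ) (S : Set ℝ) (l C m M : ℝ) : Prop where
  C_nonneg : 0 ≤ C
  m_pos : 0 < m
  M_pos : 0 < M
  crossRatio_le : ∀ x₁ x₂ x₃ x₄, Ordered₄ x₁ x₂ x₃ x₄ → x₁ ∈ S → x₄ ∈ S →
    crossRatio (f x₁) (f x₂) (f x₃) (f x₄)
      ≤ Real.exp (C * (|x₄ - x₁| + |f x₄ - f x₁|)) * crossRatio x₁ x₂ x₃ x₄
  lower : ∀ x ∈ S, m * |x - c| ^ l ≤ f c - f x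
  upper : ∀ x ∈ S, f c - f x ≤ M * |x - c| ^ l

theorem SideEstimates.weaken {f : ℝ → ℝ} {c : ℝ} {S : Set ℝ} {l C m M C' m' M' : ℝ}
    (h : SideEstimates f c S l C m M) (hC : C ≤ C') (hm : m' ≤ m) (hm' : 0 < m') (hM : M ≤ M') :
    SideEstimates f c S l C' m' M' where
  C_nonneg := h.C_nonneg.trans hC
  m_pos := hm'
  M_pos := h.M_pos.trans_le hM
  crossRatio_le x₁ x₂ x₃ x₄ ho h1 h4 := by
    refine (h.crossRatio_le x₁ x₂ x₃ x₄ ho h1 h4).trans ?_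
    have := crossRatio_nonneg x₁ x₂ x₃ x₄
    gcongr
  lower x hx := le_trans (by gcongr) (h.lower x hx)
  upper x hx := (h.upper x hx).trans (by gcongr)

theorem crossRatio_neg (x₁ x₂ x₃ x₄ : ℝ) :
    crossRatio (-x₁) (-x₂) (-x₃) (-x₄) = crossRatio x₁ x₂ x₃ x₄ := by
  unfold crossRatio
  have h : ∀ a b : ℝ, |-a - -b| = |a - b| := fun a b => by
    rw [← abs_neg]; congr 1; ring
  rw [h, h, h, h]

/-- A map with bounded distortion is bi-Lipschitz. -/
theorem BddDistortion.exists_bilipschitz {g : ℝ → ℝ} {u v C : ℝ} (huv : u < v)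
    (hg : BddDistortion g (Icc u v) C) (hne : g u ≠ g v) :
    ∃ a b : ℝ, 0 < a ∧ 0 < b ∧ ∀ x ∈ Icc u v, ∀ y ∈ Icc u v,
      a * |y - x| ≤ |g y - g x| ∧ |g y - g x| ≤ b * |y - x| := by
  have hu : u ∈ Icc u v := ⟨le_rfl, huv.le⟩
  have hv : v ∈ Icc u v := ⟨huv.le, le_rfl⟩
  have h1 : 0 < |v - u| := abs_pos.2 (sub_ne_zero.2 huv.ne')
  have h2 : 0 < |g v - g u| := abs_pos.2 (sub_ne_zero.2 hne.symm)
  set E := Real.exp (C * |v - u|) with hE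
  have hE0 : 0 < E := Real.exp_pos _
  refine ⟨|g v - g u| / (E * |v - u|), E * |g v - g u| / |v - u|, by positivity, by positivity,
    fun x hx y hy => ?_⟩
  have hI : uIcc u v = Icc u v := uIcc_of_le huv.le
  have e1 := hg u hu v hv x (hI ▸ hx) y (hI ▸ hy) u left_mem_uIcc v right_mem_uIcc
  have e2 := hg u hu v hv u left_mem_uIcc v right_mem_uIcc x (hI ▸ hx) y (hI ▸ hy)
  constructor
  · rw [div_mul_eq_mul_div, div_le_iff₀ (by positivity)]
    linarith
  · rw [div_mul_eq_mul_div, le_div_iff₀ h1]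
    linarith

theorem sideEstimates_of_power {f g Φ : ℝ → ℝ} {c l u v C₁ C₂ : ℝ} (huv : u < v)
    (hmem : c ∈ Icc u v) (hl : 1 ≤ l) (hfI : ∀ x, f x ∈ Icc (0 : ℝ) 1)
    (hg : BddDistortion g (Icc 0 1) C₁) (hC₁ : 0 ≤ C₁) (hgm : StrictMono g) (hgc : g (f c) = 0)
    (hΦ : BddDistortion Φ (Icc u v) C₂) (hC₂ : 0 ≤ C₂)
    (hΦm : StrictMonoOn Φ (Icc u v) ∨ StrictAntiOn Φ (Icc u v))
    (hΦc : Φ c = 0) (hΦ0 : ∀ x ∈ Icc u v, 0 ≤ Φ x)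
    (hfm : StrictMonoOn f (Icc u v) ∨ StrictAntiOn f (Icc u v))
    (hfΦ : ∀ x ∈ Icc u v, -g (f x) = Φ x ^ l) :
    ∃ C m M, SideEstimates f c (Icc u v) l C m M := by
  have hΦuv : Φ u ≠ Φ v := by
    rcases hΦm with h | h
    · exact (h ⟨le_rfl, huv.le⟩ ⟨huv.le, le_rfl⟩ huv).ne
    · exact (h ⟨le_rfl, huv.le⟩ ⟨huv.le, le_rfl⟩ huv).ne'
  obtain ⟨a, b, ha, hb, hab⟩ := hΦ.exists_bilipschitz huv hΦuv
  obtain ⟨a', b', ha', hb', hab'⟩ := hg.exists_bilipschitz zero_lt_one (hgm zero_lt_one).ne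
  have hord : ∀ {h : ℝ → ℝ} {x₁ x₂ x₃ x₄ : ℝ}, StrictMonoOn h (Icc u v) ∨ StrictAntiOn h (Icc u v) →
      Ordered₄ x₁ x₂ x₃ x₄ → x₁ ∈ Icc u v → x₄ ∈ Icc u v →
      Ordered₄ (h x₁) (h x₂) (h x₃) (h x₄) := by
    intro h x₁ x₂ x₃ x₄ hm ho h1 h4
    have h2 : x₂ ∈ Icc u v := ordConnected_Icc.uIcc_subset h1 h4 ho.mem.1
    have h3 : x₃ ∈ Icc u v := ordConnected_Icc.uIcc_subset h1 h4 ho.mem.2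
    rcases hm with hm | hm <;> rcases ho with ⟨o1, o2, o3⟩ | ⟨o1, o2, o3⟩
    · exact Or.inl ⟨hm h1 h2 o1, hm h2 h3 o2, hm h3 h4 o3⟩
    · exact Or.inr ⟨hm h4 h3 o1, hm h3 h2 o2, hm h2 h1 o3⟩
    · exact Or.inr ⟨hm h3 h4 o3, hm h2 h3 o2, hm h1 h2 o1⟩
    · exact Or.inl ⟨hm h2 h1 o3, hm h3 h2 o2, hm h4 h3 o1⟩
  have hcmp : ∀ x ∈ Icc u v, a' * (f c - f x) ≤ Φ x ^ l ∧ Φ x ^ l ≤ b' * (f c - f x) := by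
    intro x hx
    have h1 := hab' (f x) (hfI x) (f c) (hfI c)
    have h3 : 0 ≤ Φ x ^ l := Real.rpow_nonneg (hΦ0 x hx) l
    have h4 : f x ≤ f c := by
      rw [← hgm.le_iff_le, hgc]
      linarith [hfΦ x hx]
    rw [hgc, zero_sub, hfΦ x hx, abs_of_nonneg h3, abs_of_nonneg (sub_nonneg.2 h4)] at h1
    exact h1
  have hcmp2 : ∀ x ∈ Icc u v, a * |x - c| ≤ Φ x ∧ Φ x ≤ b * |x - c| := by
    intro x hx
    have h1 := hab c hmem x hx
    rwa [hΦc, sub_zero, abs_of_nonneg (hΦ0 x hx)] at h1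
  refine ⟨2 * (C₁ + C₂), a ^ l / b', b ^ l / a', by positivity, by positivity, by positivity,
    ?_, ?_, ?_⟩
  · intro x₁ x₂ x₃ x₄ ho h1 h4
    have h2 : x₂ ∈ Icc u v := ordConnected_Icc.uIcc_subset h1 h4 ho.mem.1
    have h3 : x₃ ∈ Icc u v := ordConnected_Icc.uIcc_subset h1 h4 ho.mem.2
    have e1 := hg.le_crossRatio (hord hfm ho h1 h4) (hfI _) (hfI _) hgm.injective
    have e2 : crossRatio (g (f x₁)) (g (f x₂)) (g (f x₃)) (g (f x₄))
        = crossRatio (Φ x₁ ^ l) (Φ x₂ ^ l) (Φ x₃ ^ l) (Φ x₄ ^ l) := by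
      rw [← crossRatio_neg, hfΦ _ h1, hfΦ _ h2, hfΦ _ h3, hfΦ _ h4]
    have e3 := crossRatio_rpow_le hl (hord hΦm ho h1 h4) (hΦ0 _ h1) (hΦ0 _ h4)
    have e4 := hΦ.crossRatio_le ho h1 h4
    have h0 := crossRatio_nonneg x₁ x₂ x₃ x₄
    calc _ ≤ Real.exp (2 * C₁ * |f x₄ - f x₁|)
          * (Real.exp (2 * C₂ * |x₄ - x₁|) * crossRatio x₁ x₂ x₃ x₄) := by
          refine e1.trans ?_
          gcongr
          rw [e2]
          exact e3.trans e4
      _ = Real.exp (2 * C₁ * |f x₄ - f x₁| + 2 * C₂ * |x₄ - x₁|) * crossRatio x₁ x₂ x₃ x₄ := by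
          rw [Real.exp_add]; ring
      _ ≤ _ := by
          gcongr
          have p1 := abs_nonneg (f x₄ - f x₁)
          have p2 := abs_nonneg (x₄ - x₁)
          nlinarith [mul_nonneg hC₁ p2, mul_nonneg hC₂ p1]
  · intro x hx
    have h1 := (hcmp x hx).2
    have h2 : (a * |x - c|) ^ l ≤ Φ x ^ l :=
      Real.rpow_le_rpow (by positivity) (hcmp2 x hx).1 (by linarith)
    rw [Real.mul_rpow ha.le (abs_nonneg _)] at h2
    rw [div_mul_eq_mul_div, div_le_iff₀ hb']
    linarith
  · intro x hx
    have h1 := (hcmp x hx).1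
    have h2 : Φ x ^ l ≤ (b * |x - c|) ^ l :=
      Real.rpow_le_rpow (hΦ0 x hx) (hcmp2 x hx).2 (by linarith)
    rw [Real.mul_rpow hb.le (abs_nonneg _)] at h2
    rw [div_mul_eq_mul_div, le_div_iff₀ ha']
    linarith

theorem exists_sideEstimates_of_eventuallyEq {f g h : ℝ → ℝ} {c l u v s : ℝ} (huv : u < v)
    (hmem : c ∈ Icc u v) (hl : 1 ≤ l) (hfI : ∀ x, f x ∈ Icc (0 : ℝ) 1)
    (hfm : StrictMonoOn f (Icc u v) ∨ StrictAntiOn f (Icc u v))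
    (hfc : ∀ x ∈ Icc u v, f x ≤ f c)
    (hf2 : ∀ x ∈ Icc u v, x ≠ c → ContDiffWithinAt ℝ 2 f (Icc u v) x)
    (hf' : ∀ x ∈ Icc u v, x ≠ c → derivWithin f (Icc u v) x ≠ 0)
    (hg : ContDiff ℝ 2 g) (hgm : StrictMono g) (hg' : ∀ x, deriv g x ≠ 0) (hgc : g (f c) = 0)
    (hh : ContDiff ℝ 2 h) (hh' : ∀ x, deriv h x ≠ 0) (hhc : h c = 0) (hs : s ≠ 0)
    (hsh : ∀ x ∈ Icc u v, 0 ≤ s * h x)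
    (hev : ∀ᶠ x in 𝓝[Icc u v] c, -g (f x) = (s * h x) ^ l) :
    ∃ C m M, SideEstimates f c (Icc u v) l C m M := by
  have hl0 : 0 < l := by linarith
  have hu := uniqueDiffOn_Icc huv
  obtain ⟨C₁, hC₁, hgb⟩ := exists_bddDistortion (g := g) zero_lt_one hg.contDiffOn (by
    intro x hx
    rw [(hg.differentiable (by norm_num) x).derivWithin (uniqueDiffOn_Icc zero_lt_one x hx)]
    exact hg' x)
  set Φ : ℝ → ℝ := fun x => (-g (f x)) ^ (1 / l) with hΦ
  have hpos : ∀ x ∈ Icc u v, 0 ≤ -g (f x) := by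
    intro x hx
    have := hgm.monotone (hfc x hx)
    rw [hgc] at this
    linarith
  have hne : ∀ x ∈ Icc u v, x ≠ c → 0 < -g (f x) := by
    intro x hx hxc
    refine lt_of_le_of_ne (hpos x hx) fun h0 => hxc ?_
    have h1 : g (f x) = g (f c) := by rw [hgc]; linarith
    have h2 := hgm.injective h1
    rcases hfm with h | h
    · exact h.injOn hx hmem h2
    · exact h.injOn hx hmem h2
  have hevΦ : Φ =ᶠ[𝓝[Icc u v] c] fun x => s * h x := by
    filter_upwards [hev, self_mem_nhdsWithin] with x hx hxI
    simp only [hΦ, hx]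
    rw [← Real.rpow_mul (hsh x hxI), mul_one_div_cancel hl0.ne', Real.rpow_one]
  have hΦc : Φ c = 0 := by
    simp only [hΦ, hgc, neg_zero]
    exact Real.zero_rpow (by positivity)
  have hΦc' : Φ c = s * h c := by rw [hΦc, hhc, mul_zero]
  have hΦ2 : ContDiffOn ℝ 2 Φ (Icc u v) := by
    intro x hx
    by_cases hxc : x = c
    · subst hxc
      exact (contDiffWithinAt_const.mul hh.contDiffAt.contDiffWithinAt).congr_of_eventuallyEq
        hevΦ hΦc'
    · exact ((hg.contDiffAt.comp_contDiffWithinAt x (hf2 x hx hxc)).neg).rpow_const_of_ne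
        (hne x hx hxc).ne'
  have hΦ' : ∀ x ∈ Icc u v, derivWithin Φ (Icc u v) x ≠ 0 := by
    intro x hx
    by_cases hxc : x = c
    · subst hxc
      rw [hevΦ.derivWithin_eq hΦc']
      have h1 : HasDerivWithinAt (fun y => s * h y) (s * deriv h x) (Icc u v) x :=
        ((hh.differentiable (by norm_num) x).hasDerivAt.const_mul s).hasDerivWithinAt
      rw [h1.derivWithin (hu x hx)]
      exact mul_ne_zero hs (hh' x)
    · have h1 : HasDerivWithinAt f (derivWithin f (Icc u v) x) (Icc u v) x :=
        ((hf2 x hx hxc).differentiableWithinAt (by norm_num)).hasDerivWithinAt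
      have h2 := (hg.differentiable (by norm_num) (f x)).hasDerivAt.comp_hasDerivWithinAt x h1
      have h3 := (h2.neg).rpow_const (p := 1 / l) (Or.inl (hne x hx hxc).ne')
      have h5 : HasDerivWithinAt Φ _ (Icc u v) x := h3
      rw [h5.derivWithin (hu x hx)]
      have h4 := (Real.rpow_pos_of_pos (hne x hx hxc) (1 / l - 1)).ne'
      exact mul_ne_zero (mul_ne_zero (neg_ne_zero.2 (mul_ne_zero (hg' _) (hf' x hx hxc)))
        (by positivity)) h4
  obtain ⟨C₂, hC₂, hΦb⟩ := exists_bddDistortion huv hΦ2 hΦ'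
  refine sideEstimates_of_power huv hmem hl hfI hgb hC₁ hgm hgc hΦb hC₂ ?_ hΦc
    (fun x hx => Real.rpow_nonneg (hpos x hx) _) hfm ?_
  · have hl1 : 0 < 1 / l := by positivity
    rcases hfm with hm | hm
    · right
      intro x hx y hy hxy
      exact Real.rpow_lt_rpow (hpos y hy) (neg_lt_neg (hgm (hm hx hy hxy))) hl1
    · left
      intro x hx y hy hxy
      exact Real.rpow_lt_rpow (hpos x hx) (neg_lt_neg (hgm (hm hx hy hxy))) hl1
  · intro x hx
    simp only [hΦ]
    rw [← Real.rpow_mul (hpos x hx), one_div_mul_cancel hl0.ne', Real.rpow_one]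

section Unimodal

variable {f : ℝ → ℝ} {c ℓm ℓp : ℝ}

theorem IsUnimodal.contDiffWithinAt_side (hf : IsUnimodal 2 f c ℓm ℓp) {S : Set ℝ}
    (hS : S ⊆ Icc 0 1) {x : ℝ} (hx : x ∈ S) (hxc : x ≠ c) : ContDiffWithinAt ℝ 2 f S x := by
  have h1 := hf.contDiffOn x ⟨hS hx, hxc⟩
  have h2 : ContDiffWithinAt ℝ 2 f (Icc 0 1) x := by
    have h3 : ContDiffWithinAt ℝ 2 f (Icc 0 1 \ {c}) x := by exact_mod_cast h1
    refine h3.mono_of_mem_nhdsWithin ?_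
    exact inter_mem self_mem_nhdsWithin
      (mem_nhdsWithin_of_mem_nhds (isOpen_compl_singleton.mem_nhds hxc))
  exact h2.mono hS

theorem IsUnimodal.derivWithin_side_ne_zero (hf : IsUnimodal 2 f c ℓm ℓp) {u v : ℝ} (huv : u < v)
    (hS : Icc u v ⊆ Icc 0 1) {x : ℝ} (hx : x ∈ Icc u v) (hxc : x ≠ c) :
    derivWithin f (Icc u v) x ≠ 0 := by
  have h1 : HasDerivWithinAt f (derivWithin f (Icc 0 1) x) (Icc 0 1) x :=
    ((hf.contDiffWithinAt_side le_rfl (hS hx) hxc).differentiableWithinAt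
      (by norm_num)).hasDerivWithinAt
  rw [(h1.mono hS).derivWithin (uniqueDiffOn_Icc huv x hx)]
  exact hf.deriv_ne_zero x ⟨hS hx, hxc⟩

theorem IsUnimodal.exists_sideEstimates_left (hf : IsUnimodal 2 f c ℓm ℓp)
    (hr : ∀ x, f x ∈ Icc (0 : ℝ) 1) : ∃ C m M, SideEstimates f c (Icc 0 c) ℓm C m M := by
  have hcm := hf.mem
  have hS : Icc 0 c ⊆ Icc (0 : ℝ) 1 := Icc_subset_Icc le_rfl hcm.2.le
  obtain ⟨φ, ψ, hφ, hψ, hev⟩ := hf.left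
  obtain ⟨h, h2, hm, hd, hc0, habs⟩ := φ.exists_strictMono_abs_eq hφ
  obtain ⟨g, g2, gm, gd, gc0, gabs⟩ := ψ.exists_strictMono_abs_eq hψ
  have hsh : ∀ x ∈ Icc 0 c, 0 ≤ -1 * h x := by
    intro x hx
    have := hm.monotone hx.2
    rw [hc0] at this
    linarith
  refine exists_sideEstimates_of_eventuallyEq (g := g) (h := h) (s := -1) hcm.1
    ⟨hcm.1.le, le_rfl⟩ hf.one_le_left hr (Or.inl hf.strictMonoOn)
    (fun x hx => hf.le_turning (hS hx))
    (fun x hx hxc => hf.contDiffWithinAt_side hS hx hxc)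
    (fun x hx hxc => hf.derivWithin_side_ne_zero hcm.1 hS hx hxc) g2 gm gd gc0 h2 hd hc0
    (by norm_num) hsh ?_
  filter_upwards [nhdsWithin_le_nhds hev, self_mem_nhdsWithin] with x hx hxI
  have h1 := hx hxI.2
  have h3 := gm.monotone (hf.le_turning (hS hxI))
  rw [gc0] at h3
  rw [gabs, habs, abs_of_nonpos h3, abs_of_nonpos (by linarith [hsh x hxI])] at h1
  rw [h1, neg_one_mul]

theorem IsUnimodal.exists_sideEstimates_right (hf : IsUnimodal 2 f c ℓm ℓp)
    (hr : ∀ x, f x ∈ Icc (0 : ℝ) 1) : ∃ C m M, SideEstimates f c (Icc c 1) ℓp C m M := by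
  have hcm := hf.mem
  have hS : Icc c 1 ⊆ Icc (0 : ℝ) 1 := Icc_subset_Icc hcm.1.le le_rfl
  obtain ⟨φ, ψ, hφ, hψ, hev⟩ := hf.right
  obtain ⟨h, h2, hm, hd, hc0, habs⟩ := φ.exists_strictMono_abs_eq hφ
  obtain ⟨g, g2, gm, gd, gc0, gabs⟩ := ψ.exists_strictMono_abs_eq hψ
  have hsh : ∀ x ∈ Icc c 1, 0 ≤ 1 * h x := by
    intro x hx
    have := hm.monotone hx.1
    rw [hc0] at this
    linarith
  refine exists_sideEstimates_of_eventuallyEq (g := g) (h := h) (s := 1) hcm.2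
    ⟨le_rfl, hcm.2.le⟩ hf.one_le_right hr (Or.inr hf.strictAntiOn)
    (fun x hx => hf.le_turning (hS hx))
    (fun x hx hxc => hf.contDiffWithinAt_side hS hx hxc)
    (fun x hx hxc => hf.derivWithin_side_ne_zero hcm.2 hS hx hxc) g2 gm gd gc0 h2 hd hc0
    (by norm_num) hsh ?_
  filter_upwards [nhdsWithin_le_nhds hev, self_mem_nhdsWithin] with x hx hxI
  have h1 := hx hxI.1
  have h3 := gm.monotone (hf.le_turning (hS hxI))
  rw [gc0] at h3
  rw [gabs, habs, abs_of_nonpos h3, abs_of_nonneg (by linarith [hsh x hxI])] at h1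
  rw [h1, one_mul]

theorem IsUnimodal.exists_sideEstimates (hf : IsUnimodal 2 f c ℓm ℓp)
    (hr : ∀ x, f x ∈ Icc (0 : ℝ) 1) : ∃ C m M, SideEstimates f c (Icc 0 c) ℓm C m M ∧
      SideEstimates f c (Icc c 1) ℓp C m M := by
  obtain ⟨C, m, M, h⟩ := hf.exists_sideEstimates_left hr
  obtain ⟨C', m', M', h'⟩ := hf.exists_sideEstimates_right hr
  have hm := h.m_pos
  have hm' := h'.m_pos
  exact ⟨max C C', min m m', max M M',
    h.weaken (le_max_left _ _) (min_le_left _ _) (lt_min hm hm') (le_max_left _ _),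
    h'.weaken (le_max_right _ _) (min_le_right _ _) (lt_min hm hm') (le_max_right _ _)⟩

theorem IsUnimodal.exists_bddDistortion_away (hf : IsUnimodal 2 f c ℓm ℓp) {u v : ℝ} (huv : u < v)
    (hS : Icc u v ⊆ Icc 0 1) (hcS : c ∉ Icc u v) :
    ∃ C, 0 ≤ C ∧ BddDistortion f (Icc u v) C :=
  exists_bddDistortion huv
    (fun _ hx => hf.contDiffWithinAt_side hS hx fun h => hcS (h ▸ hx))
    (fun _ hx => hf.derivWithin_side_ne_zero huv hS hx fun h => hcS (h ▸ hx))

end Unimodal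

/-- If a map has bounded distortion near the orbit of an interval with summable lengths, then a point
sufficiently close to an endpoint of the interval stays close to the orbit of the interval. -/
theorem abs_iterate_sub_le_of_bddDistortion {f : ℝ → ℝ} (hr : ∀ x, f x ∈ Icc (0 : ℝ) 1) {C : ℝ}
    (hC : 0 ≤ C) {u w x : ℝ} (hu : u ∈ Icc (0 : ℝ) 1) (hw : w ∈ Icc (0 : ℝ) 1)
    (hx : x ∈ Icc (0 : ℝ) 1)
    (hS : ∀ n, ∃ S, BddDistortion f S C ∧
      ∀ y ∈ Icc (0 : ℝ) 1, |y - f^[n] u| ≤ |f^[n] w - f^[n] u| → y ∈ S)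
    (hsum : ∀ n, ∑ i ∈ Finset.range n, |f^[i] w - f^[i] u| ≤ 1)
    (hxu : |x - u| ≤ Real.exp (-(2 * C)) * |w - u|) (n : ℕ) :
    |f^[n] x - f^[n] u| ≤ |f^[n] w - f^[n] u| := by
  have hle : ∀ n, Real.exp (2 * C * ∑ i ∈ Finset.range n, |f^[i] w - f^[i] u| - 2 * C) ≤ 1 := by
    intro n
    rw [Real.exp_le_one_iff]
    nlinarith [hsum n]
  have key : ∀ n, |f^[n] x - f^[n] u| ≤
      Real.exp (2 * C * ∑ i ∈ Finset.range n, |f^[i] w - f^[i] u| - 2 * C)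
        * |f^[n] w - f^[n] u| := by
    intro n
    induction n with
    | zero => simpa using hxu
    | succ n ih =>
      have h1 : |f^[n] x - f^[n] u| ≤ |f^[n] w - f^[n] u| :=
        ih.trans (mul_le_of_le_one_left (abs_nonneg _) (hle n))
      obtain ⟨S, hD, hS⟩ := hS n
      have hxS := hS _ (iterate_mem_Icc hr hx n) h1
      have hwS := hS _ (iterate_mem_Icc hr hw n) le_rfl
      have huS := hS _ (iterate_mem_Icc hr hu n) (by simp)
      rw [Finset.sum_range_succ, Function.iterate_succ_apply', Function.iterate_succ_apply',
        Function.iterate_succ_apply']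
      set X := f^[n] x
      set W := f^[n] w
      set V := f^[n] u
      set s := ∑ i ∈ Finset.range n, |f^[i] w - f^[i] u|
      rcases (abs_nonneg (W - V)).eq_or_lt with h0 | h0
      · rw [← h0] at h1
        have hX : X = V := by
          have := abs_nonpos_iff.1 h1
          linarith
        rw [hX, sub_self, abs_zero]
        positivity
      · set p := min (min X V) W with hp
        set p' := max (max X V) W with hp'
        have hpS : p ∈ S := min_rec' (· ∈ S) (min_rec' (· ∈ S) hxS huS) hwS
        have hp'S : p' ∈ S := max_rec' (· ∈ S) (max_rec' (· ∈ S) hxS huS) hwS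
        have hpX : p ≤ X := (min_le_left _ _).trans (min_le_left _ _)
        have hpV : p ≤ V := (min_le_left _ _).trans (min_le_right _ _)
        have hpW : p ≤ W := min_le_right _ _
        have hX : X ≤ p' := (le_max_left _ _).trans (le_max_left _ _)
        have hV : V ≤ p' := (le_max_right _ _).trans (le_max_left _ _)
        have hW : W ≤ p' := le_max_right _ _
        have hpp : p ≤ p' := hpX.trans hX
        have hd := hD p hpS p' hp'S V (by rw [uIcc_of_le hpp]; exact ⟨hpV, hV⟩) X
          (by rw [uIcc_of_le hpp]; exact ⟨hpX, hX⟩) V (by rw [uIcc_of_le hpp]; exact ⟨hpV, hV⟩) W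
          (by rw [uIcc_of_le hpp]; exact ⟨hpW, hW⟩)
        have hlen : |p' - p| ≤ 2 * |W - V| := by
          rw [abs_of_nonneg (by linarith)]
          have a1 := abs_le.1 h1
          have a2 := abs_le.1 (le_refl |W - V|)
          have b1 : p' ≤ V + |W - V| := max_le (max_le (by linarith) (by linarith)) (by linarith)
          have b2 : V - |W - V| ≤ p := le_min (le_min (by linarith) (by linarith)) (by linarith)
          linarith
        have h2 : Real.exp (C * |p' - p|) ≤ Real.exp (C * (2 * |W - V|)) := by gcongr
        have h3 : |f X - f V| * |W - V| ≤ Real.exp (C * (2 * |W - V|)) *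
            (|f W - f V| * (Real.exp (2 * C * s - 2 * C) * |W - V|)) := by
          refine hd.trans ?_
          gcongr
        have h4 : Real.exp (2 * C * (s + |W - V|) - 2 * C)
            = Real.exp (C * (2 * |W - V|)) * Real.exp (2 * C * s - 2 * C) := by
          rw [← Real.exp_add]
          congr 1
          ring
        rw [h4]
        refine le_of_mul_le_mul_right (h3.trans_eq ?_) h0
        ring
  exact (key n).trans (mul_le_of_le_one_left (abs_nonneg _) (hle n))

section Unimodal

variable {f : ℝ → ℝ} {c ℓm ℓp : ℝ}

theorem exists_Icc_of_maximal (hf : IsUnimodal 2 f c ℓm ℓp)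
    (hc : Continuous f) (hr : ∀ x, f x ∈ Icc (0 : ℝ) 1) {Q : Set ℝ}
    (hQ : Maximal (IsWanderingInterval f) Q) : ∃ u w, u < w ∧ Q = Icc u w := by
  have h1 : closure Q = Q :=
    (hQ.2 (hf.isWanderingInterval_closure hc hr hQ.1) subset_closure).antisymm subset_closure
  have h2 : IsClosed Q := closure_eq_iff_isClosed.1 h1
  have h3 : IsCompact Q := isCompact_Icc.of_isClosed_subset h2 hQ.1.subset
  obtain ⟨x, hx, y, hy, hxy⟩ := hQ.1.nontrivial.exists_lt
  have h4 : Q = Icc (sInf Q) (sSup Q) :=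
    eq_Icc_of_connected_compact ⟨⟨x, hx⟩, hQ.1.ordConnected.isPreconnected⟩ h3
  exact ⟨_, _, (csInf_le h3.bddBelow hx).trans_lt (hxy.trans_le (le_csSup h3.bddAbove hy)), h4⟩

/-- No neighbourhood of an image of a maximal wandering interval is disjoint from the backward orbit
of the turning point. -/
theorem IsUnimodal.not_notMem_of_maximal (hf : IsUnimodal 2 f c ℓm ℓp)
    (hc : Continuous f) (hr : ∀ x, f x ∈ Icc (0 : ℝ) 1) {Q : Set ℝ}
    (hQ : Maximal (IsWanderingInterval f) Q) {N : ℕ} {E : Set ℝ} (hE : E ⊆ Icc 0 1)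
    (ho : E.OrdConnected) (hQE : ∀ x ∈ Q, E ∈ 𝓝[Icc 0 1] (f^[N] x)) :
    ∃ n, c ∈ f^[n] '' E := by
  by_contra! hcE
  obtain ⟨u, w, huw, rfl⟩ := exists_Icc_of_maximal hf hc hr hQ
  have hQ1 := hQ.1
  have hsub := hQ1.subset
  have hu : u ∈ Icc u w := ⟨le_rfl, huw.le⟩
  have hw : w ∈ Icc u w := ⟨huw.le, le_rfl⟩
  have hmem : ∀ x ∈ Icc u w, f^[N] x ∈ E := fun x hx =>
    mem_of_mem_nhdsWithin (iterate_mem_Icc hr (hsub hx) N) (hQE x hx)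
  have hEn : E.Nontrivial :=
    (hf.image_iterate_nontrivial hc hr hsub hQ1.ordConnected hQ1.nontrivial N).mono
      (image_subset_iff.2 hmem)
  have hEW : IsWanderingInterval f E := by
    refine hf.isWanderingInterval_of_notMem hc hr hE ho hEn hcE (hmem u hu) ?_
    rw [omegaSet_iterate]
    exact hQ1.omega u hu
  have hnhds : ∀ x ∈ Icc u w, f^[N] ⁻¹' E ∈ 𝓝[Icc 0 1] x := by
    intro x hx
    have h1 : Tendsto f^[N] (𝓝[Icc 0 1] x) (𝓝[Icc 0 1] (f^[N] x)) :=
      tendsto_nhdsWithin_of_tendsto_nhds_of_eventually_within _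
        (((hc.iterate N).tendsto x).mono_left nhdsWithin_le_nhds)
        (eventually_mem_nhdsWithin.mono fun y hy => iterate_mem_Icc hr hy N)
    exact h1 (hQE x hx)
  have hwhole : ¬ (Icc (0 : ℝ) 1 ⊆ Icc u w) := by
    intro h
    have h1 : f u ∈ Icc u w := h (hr u)
    exact Set.disjoint_left.1 (hQ1.disjoint zero_ne_one) ⟨f u, h1, rfl⟩ ⟨u, hu, rfl⟩
  have hmax : ∀ A : Set ℝ, A ⊆ Icc 0 1 → A.OrdConnected → Icc u w ⊆ A → A ⊆ f^[N] ⁻¹' E →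
      A ⊆ Icc u w := fun A hA hAo hQA hAE =>
    hQ.2 (hEW.of_mapsTo hA hAo (hQ1.nontrivial.mono hQA) hAE) hQA
  rcases (hsub hu).1.eq_or_lt with h0 | h0
  · rcases (hsub hw).2.eq_or_lt with h1 | h1
    · exact hwhole (by rw [← h0, h1])
    · obtain ⟨ε, hε, hball⟩ := Metric.mem_nhdsWithin_iff.1 (hnhds w hw)
      set z := min 1 (w + ε / 2) with hz
      have hzw : w < z := lt_min h1 (by linarith)
      have := hmax (Icc u z) (Icc_subset_Icc (hsub hu).1 (min_le_left _ _)) ordConnected_Icc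
        (Icc_subset_Icc_right hzw.le) ?_
      · exact absurd (this ⟨huw.le.trans hzw.le, le_rfl⟩).2 (not_le.2 hzw)
      · intro y hy
        rcases le_total y w with hyw | hyw
        · exact hmem y ⟨hy.1, hyw⟩
        · refine hball ⟨?_, (hsub hu).1.trans hy.1, hy.2.trans (min_le_left _ _)⟩
          have h3 : y ≤ w + ε / 2 := hy.2.trans (min_le_right _ _)
          rw [Metric.mem_ball, Real.dist_eq, abs_of_nonneg (by linarith)]
          linarith
  · obtain ⟨ε, hε, hball⟩ := Metric.mem_nhdsWithin_iff.1 (hnhds u hu)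
    set z := max 0 (u - ε / 2) with hz
    have hzw : z < u := max_lt h0 (by linarith)
    have := hmax (Icc z w) (Icc_subset_Icc (le_max_left _ _) (hsub hw).2) ordConnected_Icc
      (Icc_subset_Icc_left hzw.le) ?_
    · exact absurd (this ⟨le_rfl, hzw.le.trans huw.le⟩).1 (not_le.2 hzw)
    · intro y hy
      rcases le_total u y with hyw | hyw
      · exact hmem y ⟨hyw, hy.2⟩
      · refine hball ⟨?_, (le_max_left _ _).trans hy.1, hy.2.trans (hsub hw).2⟩
        have h3 : u - ε / 2 ≤ y := (le_max_right _ _).trans hy.1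
        rw [Metric.mem_ball, Real.dist_eq, abs_of_nonpos (by linarith)]
        linarith

theorem uIcc_iterate_subset (hc : Continuous f) {A : Set ℝ} (hA : A.OrdConnected) {x y : ℝ}
    (hx : x ∈ A) (hy : y ∈ A) (n : ℕ) : uIcc (f^[n] x) (f^[n] y) ⊆ f^[n] '' A :=
  (ordConnected_image hc hA n).uIcc_subset (mem_image_of_mem _ hx) (mem_image_of_mem _ hy)

theorem BddDistortion.mono {g : ℝ → ℝ} {S : Set ℝ} {C C' : ℝ} (h : BddDistortion g S C)
    (hC : C ≤ C') : BddDistortion g S C' := by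
  intro p hp p' hp' x hx y hy x' hx' y' hy'
  refine (h p hp p' hp' x hx y hy x' hx' y' hy').trans ?_
  gcongr

theorem exists_Icc_iterate_of_maximal (hf : IsUnimodal 2 f c ℓm ℓp)
    (hc : Continuous f) (hr : ∀ x, f x ∈ Icc (0 : ℝ) 1) {Q : Set ℝ}
    (hQ : Maximal (IsWanderingInterval f) Q) (n : ℕ) :
    ∃ u ∈ Q, ∃ w ∈ Q, f^[n] u < f^[n] w ∧ f^[n] '' Q = Icc (f^[n] u) (f^[n] w) := by
  have hnt := hf.image_iterate_nontrivial hc hr hQ.1.subset hQ.1.ordConnected hQ.1.nontrivial n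
  have hcomp : IsCompact (f^[n] '' Q) := by
    obtain ⟨u₀, w₀, -, rfl⟩ := exists_Icc_of_maximal hf hc hr hQ
    exact isCompact_Icc.image (hc.iterate n)
  have hne : (f^[n] '' Q).Nonempty := hnt.nonempty
  obtain ⟨u, hu, hu'⟩ := hcomp.sInf_mem hne
  obtain ⟨w, hw, hw'⟩ := hcomp.sSup_mem hne
  have himg := eq_Icc_of_connected_compact
    ⟨hne, (ordConnected_image hc hQ.1.ordConnected n).isPreconnected⟩ hcomp
  rw [← hu', ← hw'] at himg
  refine ⟨u, hu, w, hw, ?_, himg⟩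
  by_contra! h
  rw [himg] at hnt
  exact not_subsingleton_iff.2 hnt (subsingleton_Icc_of_ge h)

/-- The images of a maximal wandering interval become uniformly short. -/
theorem eventually_abs_iterate_sub_lt (hf : IsUnimodal 2 f c ℓm ℓp)
    (hc : Continuous f) (hr : ∀ x, f x ∈ Icc (0 : ℝ) 1) {Q : Set ℝ}
    (hQ : Maximal (IsWanderingInterval f) Q) {δ : ℝ} (hδ : 0 < δ) :
    ∀ᶠ n in atTop, ∀ x ∈ f^[n] '' Q, ∀ y ∈ f^[n] '' Q, |x - y| < δ := by
  choose u hu w hw _ himg using exists_Icc_iterate_of_maximal hf hc hr hQ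
  have hsub : ∀ n, uIcc (f^[n] (u n)) (f^[n] (w n)) ⊆ f^[n] '' Q := fun n =>
    uIcc_iterate_subset hc hQ.1.ordConnected (hu n) (hw n) n
  have h1 : ∀ s : Finset ℕ, ∑ n ∈ s, |f^[n] (u n) - f^[n] (w n)| ≤ (1 : ℕ) := by
    intro s
    refine sum_abs_sub_le_of_card_le
      (fun n _ => (hsub n).trans (image_iterate_subset_Icc hr hQ.1.subset n)) ?_
    intro z t _ hz
    rw [Finset.card_le_one]
    intro a ha b hb
    by_contra hab
    exact Set.disjoint_left.1 (hQ.1.disjoint hab) (hsub a (hz a ha)) (hsub b (hz b hb))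
  have h2 := (summable_of_sum_le (fun n => abs_nonneg (f^[n] (u n) - f^[n] (w n)))
    h1).tendsto_atTop_zero
  filter_upwards [h2.eventually_lt_const hδ] with n hn x hx y hy
  rw [himg n] at hx hy
  rw [abs_sub_comm] at hn
  have h3 := le_abs_self (f^[n] (w n) - f^[n] (u n))
  rw [abs_lt]
  constructor <;> linarith [hx.1, hx.2, hy.1, hy.2]

/-- **Schwarz's theorem**: the images of a maximal wandering interval accumulate at the turning
point. -/
theorem IsUnimodal.exists_image_near_turning (hf : IsUnimodal 2 f c ℓm ℓp)
    (hc : Continuous f) (hr : ∀ x, f x ∈ Icc (0 : ℝ) 1) {Q : Set ℝ}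
    (hQ : Maximal (IsWanderingInterval f) Q) (M : ℕ) {δ : ℝ} (hδ : 0 < δ) :
    ∃ j, M ≤ j ∧ ∃ x ∈ f^[j] '' Q, |x - c| < δ := by
  by_contra! hno
  have hcm := hf.mem
  have hQ1 := hQ.1
  obtain ⟨δ₀, hδ₀, hδ₁, hδ₂, hδ₃⟩ : ∃ d, 0 < d ∧ d ≤ δ ∧ d ≤ c ∧ d ≤ 1 - c :=
    ⟨min δ (min c (1 - c)), lt_min hδ (lt_min hcm.1 (by linarith [hcm.2])), min_le_left _ _,
      (min_le_right _ _).trans (min_le_left _ _), (min_le_right _ _).trans (min_le_right _ _)⟩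
  obtain ⟨C₁, hC₁, hD₁⟩ := hf.exists_bddDistortion_away (u := 0) (v := c - δ₀ / 2) (by linarith)
    (Icc_subset_Icc le_rfl (by linarith [hcm.2])) (fun h => by linarith [h.2])
  obtain ⟨C₂, hC₂, hD₂⟩ := hf.exists_bddDistortion_away (u := c + δ₀ / 2) (v := 1)
    (by linarith) (Icc_subset_Icc (by linarith [hcm.1]) le_rfl) (fun h => by linarith [h.1])
  set C := max C₁ C₂ with hCdef
  have hC : 0 ≤ C := hC₁.trans (le_max_left _ _)
  have hD₁ := hD₁.mono (le_max_left C₁ C₂)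
  have hD₂ := hD₂.mono (le_max_right C₁ C₂)
  obtain ⟨n₀, hn₀⟩ := eventually_atTop.1
    (eventually_abs_iterate_sub_lt hf hc hr hQ (half_pos hδ₀))
  set N := max n₀ M with hN
  have hQN : ∀ n, f^[n] '' (f^[N] '' Q) = f^[n + N] '' Q := fun n => by
    rw [← image_comp, ← Function.iterate_add]
  obtain ⟨u, hu, w, hw, huw, himg⟩ := exists_Icc_iterate_of_maximal hf hc hr hQ N
  set a := f^[N] u with ha
  set b := f^[N] w with hb
  have haI : a ∈ Icc (0 : ℝ) 1 := iterate_mem_Icc hr (hQ1.subset hu) N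
  have hbI : b ∈ Icc (0 : ℝ) 1 := iterate_mem_Icc hr (hQ1.subset hw) N
  have haN : a ∈ f^[N] '' Q := ⟨u, hu, rfl⟩
  have hbN : b ∈ f^[N] '' Q := ⟨w, hw, rfl⟩
  have hfar : ∀ x ∈ f^[N] '' Q, ∀ n, δ₀ ≤ |f^[n] x - c| := by
    intro x hx n
    refine hδ₁.trans (hno (n + N) (by omega) _ ?_)
    rw [← hQN]
    exact mem_image_of_mem _ hx
  have hlen : ∀ x ∈ f^[N] '' Q, ∀ y ∈ f^[N] '' Q, ∀ n, |f^[n] x - f^[n] y| < δ₀ / 2 := by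
    intro x hx y hy n
    refine hn₀ (n + N) (by omega) _ ?_ _ ?_ <;> rw [← hQN] <;> exact mem_image_of_mem _ ‹_›
  have hS : ∀ x ∈ f^[N] '' Q, ∀ y ∈ f^[N] '' Q, ∀ n, ∃ S, BddDistortion f S C ∧
      ∀ z ∈ Icc (0 : ℝ) 1, |z - f^[n] x| ≤ |f^[n] y - f^[n] x| → z ∈ S := by
    intro x hx y hy n
    have h1 := hfar x hx n
    have h2 := hlen y hy x hx n
    rcases le_total (f^[n] x) c with h | h
    · rw [abs_of_nonpos (by linarith)] at h1
      refine ⟨_, hD₁, fun z hz hzx => ⟨hz.1, ?_⟩⟩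
      linarith [le_abs_self (z - f^[n] x)]
    · rw [abs_of_nonneg (by linarith)] at h1
      refine ⟨_, hD₂, fun z hz hzx => ⟨?_, hz.2⟩⟩
      linarith [neg_abs_le (z - f^[n] x)]
  have hsum : ∀ x ∈ f^[N] '' Q, ∀ y ∈ f^[N] '' Q, ∀ n,
      ∑ i ∈ Finset.range n, |f^[i] y - f^[i] x| ≤ 1 := by
    intro x hx y hy n
    refine sum_abs_iterate_sub_le_one hc hr (image_iterate_subset_Icc hr hQ1.subset N)
      (ordConnected_image hc hQ1.ordConnected N) ?_ hy hx _
    intro m n hmn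
    rw [hQN, hQN]
    exact hQ1.disjoint (by omega)
  have hnear : ∀ x ∈ f^[N] '' Q, ∀ y ∈ f^[N] '' Q, ∀ z ∈ Icc (0 : ℝ) 1,
      |z - x| ≤ Real.exp (-(2 * C)) * |y - x| → ∀ n, f^[n] z ≠ c := by
    intro x hx y hy z hz hzx n h
    have hxI := image_iterate_subset_Icc hr hQ1.subset N hx
    have hyI := image_iterate_subset_Icc hr hQ1.subset N hy
    have h1 := abs_iterate_sub_le_of_bddDistortion hr hC hxI hyI hz (hS x hx y hy)
      (hsum x hx y hy) hzx n
    rw [h, abs_sub_comm] at h1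
    linarith [hfar x hx n, hlen y hy x hx n]
  set κ := Real.exp (-(2 * C)) with hκ
  have hκ0 : 0 < κ := Real.exp_pos _
  have hε : 0 < κ * (b - a) := mul_pos hκ0 (by linarith)
  obtain ⟨n, x, hx, hxn⟩ := hf.not_notMem_of_maximal hc hr hQ (N := N)
    (E := Ioo (a - κ * (b - a)) (b + κ * (b - a)) ∩ Icc 0 1) inter_subset_right
    (ordConnected_Ioo.inter ordConnected_Icc) (fun x hx => by
      have h1 : f^[N] x ∈ Icc a b := himg ▸ mem_image_of_mem _ hx
      rw [inter_comm]
      exact inter_mem self_mem_nhdsWithin (mem_nhdsWithin_of_mem_nhds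
        (Ioo_mem_nhds (by linarith [h1.1]) (by linarith [h1.2]))))
  rcases le_total x a with hxa | hxa
  · refine hnear a haN b hbN x hx.2 ?_ n hxn
    rw [abs_of_nonpos (by linarith), abs_of_pos (by linarith)]
    linarith [hx.1.1]
  rcases le_total b x with hxb | hxb
  · refine hnear b hbN a haN x hx.2 ?_ n hxn
    rw [abs_of_nonneg (by linarith), abs_sub_comm, abs_of_pos (by linarith)]
    linarith [hx.1.2]
  · have h1 := hfar x (by rw [himg]; exact ⟨hxa, hxb⟩) n
    rw [hxn, sub_self, abs_zero] at h1
    linarith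

/-- Iterates of a unimodal map do not increase cross ratios by more than a controlled factor along
a branch. -/
theorem crossRatio_iterate_le (hf : IsUnimodal 2 f c ℓm ℓp) {C m M : ℝ}
    (hL : SideEstimates f c (Icc 0 c) ℓm C m M) (hR : SideEstimates f c (Icc c 1) ℓp C m M)
    {z₁ z₂ z₃ z₄ : ℝ} (h : Ordered₄ z₁ z₂ z₃ z₄) (N : ℕ)
    (hside : ∀ i < N, (f^[i] z₁ ∈ Icc 0 c ∧ f^[i] z₄ ∈ Icc 0 c) ∨
      (f^[i] z₁ ∈ Icc c 1 ∧ f^[i] z₄ ∈ Icc c 1)) :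
    Ordered₄ (f^[N] z₁) (f^[N] z₂) (f^[N] z₃) (f^[N] z₄) ∧
    crossRatio (f^[N] z₁) (f^[N] z₂) (f^[N] z₃) (f^[N] z₄) ≤
      Real.exp (C * ∑ i ∈ Finset.range N, (|f^[i] z₄ - f^[i] z₁| + |f^[i+1] z₄ - f^[i+1] z₁|))
        * crossRatio z₁ z₂ z₃ z₄ := by
  induction N with
  | zero => simpa using h
  | succ N ih =>
    obtain ⟨ho, hle⟩ := ih fun i hi => hside i (by omega)
    have hlast := hside N (by omega)
    rw [Finset.sum_range_succ, mul_add, Real.exp_add]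
    simp only [Function.iterate_succ_apply'] at hle ⊢
    have hm := ho.mem
    have hcr : crossRatio (f (f^[N] z₁)) (f (f^[N] z₂)) (f (f^[N] z₃)) (f (f^[N] z₄)) ≤
        Real.exp (C * (|f^[N] z₄ - f^[N] z₁| + |f (f^[N] z₄) - f (f^[N] z₁)|)) *
          crossRatio (f^[N] z₁) (f^[N] z₂) (f^[N] z₃) (f^[N] z₄) := by
      rcases hlast with ⟨h1, h4⟩ | ⟨h1, h4⟩
      · exact hL.crossRatio_le _ _ _ _ ho h1 h4
      · exact hR.crossRatio_le _ _ _ _ ho h1 h4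
    refine ⟨?_, hcr.trans ?_⟩
    · rcases hlast with ⟨h1, h4⟩ | ⟨h1, h4⟩
      · have h2 := ordConnected_Icc.uIcc_subset h1 h4 hm.1
        have h3 := ordConnected_Icc.uIcc_subset h1 h4 hm.2
        rcases ho with ⟨a, b, d⟩ | ⟨a, b, d⟩
        · exact Or.inl ⟨hf.strictMonoOn h1 h2 a, hf.strictMonoOn h2 h3 b, hf.strictMonoOn h3 h4 d⟩
        · exact Or.inr ⟨hf.strictMonoOn h4 h3 a, hf.strictMonoOn h3 h2 b, hf.strictMonoOn h2 h1 d⟩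
      · have h2 := ordConnected_Icc.uIcc_subset h1 h4 hm.1
        have h3 := ordConnected_Icc.uIcc_subset h1 h4 hm.2
        rcases ho with ⟨a, b, d⟩ | ⟨a, b, d⟩
        · exact Or.inr ⟨hf.strictAntiOn h3 h4 d, hf.strictAntiOn h2 h3 b, hf.strictAntiOn h1 h2 a⟩
        · exact Or.inl ⟨hf.strictAntiOn h2 h1 d, hf.strictAntiOn h3 h2 b, hf.strictAntiOn h4 h3 a⟩
    · rw [mul_comm (Real.exp (C * ∑ i ∈ _, _)), mul_assoc]
      gcongr

end Unimodal

/-- Disjoint intervals contained in intervals with a common point, none of which contains another of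
the small intervals, are at most three in number. -/
theorem card_le_three_of_not_subset {t : Finset ℕ} {I U : ℕ → Set ℝ} {z : ℝ}
    (hIo : ∀ i ∈ t, (I i).OrdConnected) (hIn : ∀ i ∈ t, (I i).Nonempty)
    (hId : ∀ i ∈ t, ∀ j ∈ t, i ≠ j → Disjoint (I i) (I j))
    (hU : ∀ i ∈ t, (U i).OrdConnected) (hIU : ∀ i ∈ t, I i ⊆ U i) (hz : ∀ i ∈ t, z ∈ U i)
    (hIU' : ∀ i ∈ t, ∀ j ∈ t, i ≠ j → ¬ I j ⊆ U i) : t.card ≤ 3 := by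
  classical
  have key : ∀ i ∈ t, ∀ j ∈ t, i ≠ j → z ∉ I i → z ∉ I j →
      ∀ x ∈ I i, ∀ y ∈ I j, x < z → y < z → False := by
    have aux : ∀ i ∈ t, ∀ j ∈ t, i ≠ j → z ∉ I j → ∀ x ∈ I i, ∀ y ∈ I j, x < y → y < z → False := by
      intro i hi j hj hij hzj x hx y hy hxy hyz
      refine hIU' i hi j hj hij fun w hw => ?_
      have h1 : x < w := lt_of_disjoint_ordConnected (hIo i hi) (hIo j hj) (hId i hi j hj hij)
        hx hy hxy hx hw
      have h2 : w < z := by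
        by_contra! h
        exact hzj ((hIo j hj).out hy hw ⟨hyz.le, h⟩)
      exact (hU i hi).out (hIU i hi hx) (hz i hi) ⟨h1.le, h2.le⟩
    intro i hi j hj hij hzi hzj x hx y hy hxz hyz
    rcases lt_trichotomy x y with h | h | h
    · exact aux i hi j hj hij hzj x hx y hy h hyz
    · exact Set.disjoint_left.1 (hId i hi j hj hij) hx (h ▸ hy)
    · exact aux j hj i hi hij.symm hzi y hy x hx h hxz
  have key' : ∀ i ∈ t, ∀ j ∈ t, i ≠ j → z ∉ I i → z ∉ I j →
      ∀ x ∈ I i, ∀ y ∈ I j, z < x → z < y → False := by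
    have aux : ∀ i ∈ t, ∀ j ∈ t, i ≠ j → z ∉ I j → ∀ x ∈ I i, ∀ y ∈ I j, y < x → z < y → False := by
      intro i hi j hj hij hzj x hx y hy hxy hyz
      refine hIU' i hi j hj hij fun w hw => ?_
      have h1 : w < x := lt_of_disjoint_ordConnected (hIo j hj) (hIo i hi)
        (hId i hi j hj hij).symm hy hx hxy hw hx
      have h2 : z < w := by
        by_contra! h
        exact hzj ((hIo j hj).out hw hy ⟨h, hyz.le⟩)
      exact (hU i hi).out (hz i hi) (hIU i hi hx) ⟨h2.le, h1.le⟩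
    intro i hi j hj hij hzi hzj x hx y hy hxz hyz
    rcases lt_trichotomy x y with h | h | h
    · exact aux j hj i hi hij.symm hzi y hy x hx h hxz
    · exact Set.disjoint_left.1 (hId i hi j hj hij) hx (h ▸ hy)
    · exact aux i hi j hj hij hzj x hx y hy h hyz
  have hcard := Finset.card_le_card_of_injOn (s := t) (t := (Finset.univ : Finset (Fin 3)))
    (fun i => if z ∈ I i then 0 else if ∃ x ∈ I i, x < z then 1 else 2)
    (fun _ _ => Finset.mem_coe.2 (Finset.mem_univ _)) ?_
  · simpa using hcard
  · intro i hi j hj hij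
    by_contra hne
    have hi' := Finset.mem_coe.1 hi
    have hj' := Finset.mem_coe.1 hj
    by_cases h1 : z ∈ I i <;> by_cases h2 : z ∈ I j
    · exact Set.disjoint_left.1 (hId i hi' j hj' hne) h1 h2
    · by_cases h3 : ∃ x ∈ I j, x < z <;> simp [h1, h2, h3] at hij
    · by_cases h3 : ∃ x ∈ I i, x < z <;> simp [h1, h2, h3] at hij
    · by_cases h3 : ∃ x ∈ I i, x < z <;> by_cases h4 : ∃ x ∈ I j, x < z
      · obtain ⟨x, hx, hxz⟩ := h3
        obtain ⟨y, hy, hyz⟩ := h4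
        exact key i hi' j hj' hne h1 h2 x hx y hy hxz hyz
      · simp [h1, h2, h3, h4] at hij
      · simp [h1, h2, h3, h4] at hij
      · push Not at h3 h4
        obtain ⟨x, hx⟩ := hIn i hi'
        obtain ⟨y, hy⟩ := hIn j hj'
        exact key' i hi' j hj' hne h1 h2 x hx y hy
          (lt_of_le_of_ne (h3 x hx) fun h => h1 (h ▸ hx))
          (lt_of_le_of_ne (h4 y hy) fun h => h2 (h ▸ hy))

/-- The wandering interval `[a, b]` to the left of the critical value returns after `q` steps to
`[a₁, b₁]`, which lies between `[a, b]` and the critical value, whereas the intermediate images lie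
to the left of `[a, b]`. -/
structure CloseReturn (f : ℝ → ℝ) (c a b a₁ b₁ : ℝ) (q : ℕ) : Prop where
  wandering : IsWanderingInterval f (Icc a b)
  pos : 0 < q
  image : f^[q] '' Icc a b = Icc a₁ b₁
  lt : a < b
  lt_return : b < a₁
  return_lt : a₁ < b₁
  lt_value : b₁ < f c
  between : ∀ i, 0 < i → i < q → ∀ x ∈ Icc a b, f^[i] x < a
  exists_left : ∃ e ∈ Icc (0 : ℝ) 1, e < a ∧ f^[q] e ≤ a

section Unimodal

variable {f : ℝ → ℝ} {c ℓm ℓp a b a₁ b₁ : ℝ} {q : ℕ}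

theorem CloseReturn.iterate_mem (h : CloseReturn f c a b a₁ b₁ q) {x : ℝ} (hx : x ∈ Icc a b) :
    f^[q] x ∈ Icc a₁ b₁ := h.image ▸ mem_image_of_mem _ hx

/-- A maximal interval around the returning interval on which the return stays to the right of
`a`. -/
theorem CloseReturn.exists_ends (hc : Continuous f) (h : CloseReturn f c a b a₁ b₁ q) :
    ∃ e g, 0 ≤ e ∧ e < a ∧ b < g ∧ g ≤ f c ∧ f^[q] e = a ∧
      (f^[q] g = a ∨ g = f c ∧ a < f^[q] g) ∧ ∀ z ∈ Icc e g, a ≤ f^[q] z := by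
  obtain ⟨e₀, he₀, he₀a, hFe₀⟩ := h.exists_left
  have h1 := h.lt
  have h2 := h.lt_return
  have h3 := h.return_lt
  have h4 := h.lt_value
  have hFc := hc.iterate q
  have hFa : b < f^[q] a := h2.trans_le (h.iterate_mem ⟨le_rfl, h1.le⟩).1
  have hFb : b < f^[q] b := h2.trans_le (h.iterate_mem ⟨h1.le, le_rfl⟩).1
  obtain ⟨e, he, heF⟩ : ∃ e, IsGreatest {z | z ∈ Icc e₀ a ∧ f^[q] z ≤ a} e := by
    refine ⟨_, (isCompact_Icc.inter_right (isClosed_le hFc continuous_const)).isGreatest_sSup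
      ⟨e₀, ⟨le_rfl, he₀a.le⟩, hFe₀⟩⟩
  obtain ⟨⟨hee, hea⟩, hFe⟩ := he
  have hea' : e < a := lt_of_le_of_ne hea fun h' => by subst h'; linarith
  have hright : ∀ z ∈ Ioc e a, a < f^[q] z := by
    intro z hz
    by_contra! h'
    exact absurd (heF ⟨⟨hee.trans hz.1.le, hz.2⟩, h'⟩) (not_le.2 hz.1)
  have hFea : f^[q] e = a := by
    refine le_antisymm hFe ?_
    have : e ∈ closure (Ioc e a) := by rw [closure_Ioc hea'.ne]; exact ⟨le_rfl, hea'.le⟩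
    exact closure_minimal (fun z hz => (hright z hz).le) (isClosed_le continuous_const hFc) this
  have hmid : ∀ z ∈ Icc e b, a ≤ f^[q] z := by
    intro z hz
    rcases hz.1.eq_or_lt with h' | h'
    · rw [← h', hFea]
    · rcases le_total z a with h'' | h''
      · exact (hright z ⟨h', h''⟩).le
      · linarith [(h.iterate_mem ⟨h'', hz.2⟩).1]
  by_cases hex : ∃ z ∈ Icc b (f c), f^[q] z ≤ a
  · obtain ⟨g, hg, hgF⟩ : ∃ g, IsLeast {z | z ∈ Icc b (f c) ∧ f^[q] z ≤ a} g := by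
      obtain ⟨z, hz, hza⟩ := hex
      exact ⟨_, (isCompact_Icc.inter_right (isClosed_le hFc continuous_const)).isLeast_sInf
        ⟨z, hz, hza⟩⟩
    obtain ⟨⟨hbg, hgc⟩, hFg⟩ := hg
    have hbg' : b < g := lt_of_le_of_ne hbg fun h' => by subst h'; linarith
    have hleft : ∀ z ∈ Ico b g, a < f^[q] z := by
      intro z hz
      by_contra! h'
      exact absurd (hgF ⟨⟨hz.1, hz.2.le.trans hgc⟩, h'⟩) (not_le.2 hz.2)
    have hFga : f^[q] g = a := by
      refine le_antisymm hFg ?_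
      have : g ∈ closure (Ico b g) := by rw [closure_Ico hbg'.ne]; exact ⟨hbg, le_rfl⟩
      exact closure_minimal (fun z hz => (hleft z hz).le) (isClosed_le continuous_const hFc) this
    refine ⟨e, g, he₀.1.trans hee, hea', hbg', hgc, hFea, Or.inl hFga, fun z hz => ?_⟩
    rcases le_total z b with h' | h'
    · exact hmid z ⟨hz.1, h'⟩
    · rcases hz.2.eq_or_lt with h'' | h''
      · rw [h'', hFga]
      · exact (hleft z ⟨h', h''⟩).le
  · push Not at hex
    refine ⟨e, f c, he₀.1.trans hee, hea', by linarith, le_rfl, hFea,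
      Or.inr ⟨rfl, hex _ ⟨by linarith, le_rfl⟩⟩, fun z hz => ?_⟩
    rcases le_total z b with h' | h'
    · exact hmid z ⟨hz.1, h'⟩
    · exact (hex z ⟨h', hz.2⟩).le

theorem CloseReturn.not_subset {e g : ℝ} (h : CloseReturn f c a b a₁ b₁ q)
    (hF : ∀ z ∈ Icc e g, a ≤ f^[q] z) {i j : ℕ} (hi : i < q) (hji : j < i) :
    ¬ f^[j] '' Icc a b ⊆ f^[i] '' Icc e g := by
  intro hsub
  have ha : a ∈ Icc a b := ⟨le_rfl, h.lt.le⟩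
  obtain ⟨z, hz, hzx⟩ := hsub (mem_image_of_mem _ ha)
  have h1 := h.between (q - i + j) (by omega) (by omega) a ha
  rw [Function.iterate_add_apply, ← hzx, ← Function.iterate_add_apply,
    Nat.sub_add_cancel hi.le] at h1
  exact absurd (hF z hz) (not_le.2 h1)

theorem CloseReturn.iterate_lt (hc : Continuous f) {e g : ℝ} (h : CloseReturn f c a b a₁ b₁ q)
    (hea : e < a) (hbg : b < g) (hF : ∀ z ∈ Icc e g, a ≤ f^[q] z) {i : ℕ} (hi0 : 0 < i)
    (hi : i < q) {z : ℝ} (hz : z ∈ Icc e g) : f^[i] z < b := by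
  by_contra! hb
  refine h.not_subset hF hi hi0 ?_
  have ha : a ∈ Icc a b := ⟨le_rfl, h.lt.le⟩
  have haT : a ∈ Icc e g := ⟨hea.le, h.lt.le.trans hbg.le⟩
  have h1 := h.between i hi0 hi a ha
  simp only [Function.iterate_zero, image_id]
  refine Subset.trans ?_ ((ordConnected_image hc ordConnected_Icc i).out
    (mem_image_of_mem _ haT) (mem_image_of_mem _ hz))
  exact Icc_subset_Icc h1.le hb

theorem CloseReturn.not_subset_of_ne (hc : Continuous f) {e g : ℝ}
    (h : CloseReturn f c a b a₁ b₁ q)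
    (hea : e < a) (hbg : b < g) (hF : ∀ z ∈ Icc e g, a ≤ f^[q] z) {i j : ℕ} (hi0 : 0 < i)
    (hi : i < q) (hj : j < q) (hij : i ≠ j) :
    ¬ f^[j] '' Icc a b ⊆ f^[i] '' Icc e g := by
  rcases lt_or_gt_of_ne hij with hlt | hlt
  · intro hsub
    have ha : a ∈ Icc a b := ⟨le_rfl, h.lt.le⟩
    obtain ⟨z, hz, hzx⟩ := hsub (mem_image_of_mem _ ha)
    have h1 := h.iterate_lt hc hea hbg hF (i := q - j + i) (by omega) (by omega) hz
    rw [Function.iterate_add_apply, hzx, ← Function.iterate_add_apply,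
      Nat.sub_add_cancel hj.le] at h1
    linarith [(h.iterate_mem ha).1, h.lt_return]
  · exact h.not_subset hF hi hlt

theorem CloseReturn.sum_le (hc : Continuous f) (hr : ∀ x, f x ∈ Icc (0 : ℝ) 1) {e g : ℝ}
    (h : CloseReturn f c a b a₁ b₁ q)
    (he : 0 ≤ e) (hg : g ≤ f c)
    (hea : e < a) (hbg : b < g) (hF : ∀ z ∈ Icc e g, a ≤ f^[q] z) {x y : ℝ}
    (hx : x ∈ Icc e g) (hy : y ∈ Icc e g) :
    ∑ i ∈ Finset.range (q - 1), (|f^[i] x - f^[i] y| + |f^[i + 1] x - f^[i + 1] y|) ≤ 8 := by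
  have hT : Icc e g ⊆ Icc 0 1 := Icc_subset_Icc he (hg.trans (hr c).2)
  have hsub : ∀ i, uIcc (f^[i] x) (f^[i] y) ⊆ f^[i] '' Icc e g :=
    fun i => uIcc_iterate_subset hc ordConnected_Icc hx hy i
  have hJT : Icc a b ⊆ Icc e g := Icc_subset_Icc hea.le hbg.le
  have h1 : ∑ i ∈ Finset.Ico 1 q, |f^[i] x - f^[i] y| ≤ (3 : ℕ) := by
    refine sum_abs_sub_le_of_card_le
      (fun i _ => (hsub i).trans (image_iterate_subset_Icc hr hT i)) ?_
    intro z t ht hz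
    have ht' : ∀ i ∈ t, 0 < i ∧ i < q := fun i hi => by
      have := Finset.mem_Ico.1 (ht hi)
      omega
    exact card_le_three_of_not_subset (I := fun i => f^[i] '' Icc a b)
      (U := fun i => f^[i] '' Icc e g) (z := z)
      (fun i _ => ordConnected_image hc ordConnected_Icc i)
      (fun i _ => ⟨_, mem_image_of_mem _ ⟨le_rfl, h.lt.le⟩⟩)
      (fun i _ j _ hij => h.wandering.disjoint hij)
      (fun i _ => ordConnected_image hc ordConnected_Icc i)
      (fun i _ => image_mono hJT) (fun i hi => hsub i (hz i hi))
      (fun i hi j hj hij => h.not_subset_of_ne hc hea hbg hF (ht' i hi).1 (ht' i hi).2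
        (ht' j hj).2 hij)
  have h0 : |x - y| ≤ 1 := by
    have hx1 := hT hx
    have hy1 := hT hy
    rw [abs_le]
    constructor <;> linarith [hx1.1, hx1.2, hy1.1, hy1.2]
  have hq := h.pos
  have h2 : ∑ i ∈ Finset.range q, |f^[i] x - f^[i] y| ≤ 4 := by
    rw [← Finset.sum_range_add_sum_Ico _ (Nat.succ_le_of_lt hq)]
    simp only [Finset.sum_range_one, Function.iterate_zero, id]
    push_cast at h1
    linarith
  have h3 : ∑ i ∈ Finset.range (q - 1), |f^[i] x - f^[i] y| ≤
      ∑ i ∈ Finset.range q, |f^[i] x - f^[i] y| :=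
    Finset.sum_le_sum_of_subset_of_nonneg (Finset.range_mono (by omega))
      fun _ _ _ => abs_nonneg _
  have h4 : ∑ i ∈ Finset.range (q - 1), |f^[i + 1] x - f^[i + 1] y| ≤
      ∑ i ∈ Finset.range q, |f^[i] x - f^[i] y| := by
    obtain ⟨p, rfl⟩ := Nat.exists_eq_succ_of_ne_zero hq.ne'
    rw [Finset.sum_range_succ']
    simp only [Nat.succ_eq_add_one, Nat.add_sub_cancel]
    linarith [abs_nonneg (f^[0] x - f^[0] y)]
  rw [Finset.sum_add_distrib]
  linarith

theorem CloseReturn.notMem_image (hc : Continuous f) {e g : ℝ}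
    (h : CloseReturn f c a b a₁ b₁ q)
    (hea : e < a) (hbg : b < g) (hF : ∀ z ∈ Icc e g, a ≤ f^[q] z) {i : ℕ} (hi : i < q - 1) :
    c ∉ f^[i] '' Icc e g := by
  rintro ⟨z, hz, hzc⟩
  have h1 := h.iterate_lt hc hea hbg hF (i := i + 1) (by omega) (by omega) hz
  rw [Function.iterate_succ_apply', hzc] at h1
  linarith [h.lt_return, h.return_lt, h.lt_value]

theorem CloseReturn.strictMonoOn_or_strictAntiOn (hf : IsUnimodal 2 f c ℓm ℓp)
    (hc : Continuous f) (hr : ∀ x, f x ∈ Icc (0 : ℝ) 1) {e g : ℝ}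
    (h : CloseReturn f c a b a₁ b₁ q) (he : 0 ≤ e) (hg : g ≤ f c)
    (hea : e < a) (hbg : b < g) (hF : ∀ z ∈ Icc e g, a ≤ f^[q] z) :
    StrictMonoOn f^[q - 1] (Icc e g) ∨ StrictAntiOn f^[q - 1] (Icc e g) :=
  hf.strictMonoOn_or_strictAntiOn_iterate hc hr (Icc_subset_Icc he (hg.trans (hr c).2))
    ordConnected_Icc _ fun _ hi => h.notMem_image hc hea hbg hF hi

end Unimodal

theorem le_of_crossRatio_le {P X Y N η K m M l A : ℝ} (hY : 0 ≤ Y) (hYX : Y < X) (hXP : X < P)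
    (hN : 0 ≤ N) (hη : 0 ≤ η) (hK : 0 < K) (hm : 0 < m) (hl : 1 ≤ l)
    (hcr : (P - X) * (Y + N) ≤ 2 * K * η * ((X - Y) * (P + N)))
    (hX : m * X ^ l ≤ η * A) (hP : A ≤ M * P ^ l) (hη1 : η * M * 2 ^ l ≤ m)
    (hη2 : 4 * K * η ≤ 1) : 2 * X ≤ P ∧ Y + N ≤ 8 * K * η * X := by
  have hX0 : 0 < X := hY.trans_lt hYX
  have hP0 : 0 < P := hX0.trans hXP
  have h1 : 2 * X ≤ P := by
    have h2 : (2 * X) ^ l ≤ P ^ l := by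
      rw [Real.mul_rpow (by norm_num) hX0.le]
      have hPl : 0 < P ^ l := Real.rpow_pos_of_pos hP0 l
      have h2l : (0 : ℝ) < 2 ^ l := Real.rpow_pos_of_pos (by norm_num) l
      have h3 : m * X ^ l ≤ η * (M * P ^ l) := hX.trans (by gcongr)
      have h4 : m * (2 ^ l * X ^ l) ≤ m * P ^ l := by
        calc m * (2 ^ l * X ^ l) = 2 ^ l * (m * X ^ l) := by ring
          _ ≤ 2 ^ l * (η * (M * P ^ l)) := by gcongr
          _ = η * M * 2 ^ l * P ^ l := by ring
          _ ≤ m * P ^ l := by gcongr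
      exact le_of_mul_le_mul_left h4 hm
    exact (Real.rpow_le_rpow_iff (by positivity) hP0.le (by linarith)).1 h2
  refine ⟨h1, ?_⟩
  have hL : X ≤ P - X := by linarith
  have h5 : (X - Y) * (P + N) ≤ (P - X) * (2 * X + N) := by nlinarith
  have h6 : (P - X) * (Y + N) ≤ (P - X) * (2 * K * η * (2 * X + N)) := by
    refine hcr.trans ?_
    have : 0 ≤ 2 * K * η := by positivity
    nlinarith [mul_le_mul_of_nonneg_left h5 this]
  have h7 : Y + N ≤ 2 * K * η * (2 * X + N) := le_of_mul_le_mul_left h6 (by linarith)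
  nlinarith

theorem lt_of_mul_rpow_le {X N A κ m M l l' : ℝ} (hX : 0 < X) (hX1 : X ≤ 1) (hN0 : 0 ≤ N)
    (hκ0 : 0 ≤ κ) (hM : 0 < M) (hl' : 1 ≤ l') (hA : m * X ^ l ≤ A) (hA' : A ≤ M * N ^ l')
    (hN : N ≤ κ * X) (hκ : κ ≤ 1) (hκ' : κ * M < m) : l' < l := by
  by_contra! h
  have h1 : N ^ l' ≤ κ * X ^ l :=
    calc N ^ l' ≤ (κ * X) ^ l' := by gcongr
      _ = κ ^ l' * X ^ l' := Real.mul_rpow hκ0 hX.le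
      _ ≤ κ * X ^ l' := by
        gcongr
        calc κ ^ l' ≤ κ ^ (1 : ℝ) := by
              rcases hκ0.eq_or_lt with h0 | h0
              · rw [← h0, Real.zero_rpow (by linarith), Real.zero_rpow (by norm_num)]
              · exact Real.rpow_le_rpow_of_exponent_ge h0 hκ hl'
          _ = κ := Real.rpow_one κ
      _ ≤ κ * X ^ l :=
        mul_le_mul_of_nonneg_left (Real.rpow_le_rpow_of_exponent_ge hX hX1 h) hκ0
  have h2 : m * X ^ l ≤ M * (κ * X ^ l) := hA.trans (hA'.trans (by gcongr))
  have h3 : 0 < X ^ l := Real.rpow_pos_of_pos hX l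
  nlinarith

theorem lt_of_crossRatio_le {P X N η K m M l l' A D : ℝ} (hX : 0 < X) (hX1 : X ≤ 1)
    (hXP : 2 * X ≤ P) (hN : 0 < N) (hNX : N ≤ X) (hη : 0 ≤ η) (hK : 0 < K) (hM : 0 < M)
    (hl' : 1 ≤ l') (hcr : (P - X) * N * A ≤ 2 * K * D * (X * (P + N)))
    (hA : m * X ^ l ≤ η * A) (hD : D ≤ M * N ^ l') (hη' : 6 * K * M * η < m) : l' < l := by
  by_contra! h
  have hL : X ≤ P - X := by linarith
  have hL0 : 0 < P - X := by linarith
  have h1 : N * A ≤ 6 * K * (M * N ^ l') * X := by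
    have h2 : (P - X) * (N * A) ≤ (P - X) * (6 * K * (M * N ^ l') * X) := by
      calc (P - X) * (N * A) = (P - X) * N * A := by ring
        _ ≤ 2 * K * D * (X * (P + N)) := hcr
        _ ≤ 2 * K * (M * N ^ l') * (X * (3 * (P - X))) := by
          have : 0 ≤ N ^ l' := Real.rpow_nonneg hN.le _
          have : 0 ≤ X * (P + N) := mul_nonneg hX.le (by linarith)
          gcongr
          linarith
        _ = (P - X) * (6 * K * (M * N ^ l') * X) := by ring
    exact le_of_mul_le_mul_left h2 hL0
  have h2 : N ^ l' ≤ N * X ^ (l - 1) :=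
    calc N ^ l' = N * N ^ (l' - 1) := by
          rw [Real.rpow_sub_one hN.ne']
          field_simp
      _ ≤ N * X ^ (l' - 1) := by gcongr
      _ ≤ N * X ^ (l - 1) := by
        gcongr N * ?_
        exact Real.rpow_le_rpow_of_exponent_ge hX hX1 (by linarith)
  have h3 : X ^ l = X * X ^ (l - 1) := by
    rw [Real.rpow_sub_one hX.ne']
    field_simp
  have h4 : 0 < X ^ (l - 1) := Real.rpow_pos_of_pos hX _
  have h5 : m * X ^ l * N ≤ 6 * K * M * η * (X ^ l * N) :=
    calc m * X ^ l * N ≤ η * A * N := by gcongr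
      _ = η * (N * A) := by ring
      _ ≤ η * (6 * K * (M * N ^ l') * X) := by gcongr
      _ ≤ η * (6 * K * (M * (N * X ^ (l - 1))) * X) := by gcongr
      _ = 6 * K * M * η * (X ^ l * N) := by rw [h3]; ring
  have h6 : 0 < X ^ l * N := by rw [h3]; positivity
  nlinarith

/-- The part of the unit interval to the right (`s = 1`) or to the left (`s = -1`) of `c`. -/
def side (c s : ℝ) : Set ℝ := {x | x ∈ Icc 0 1 ∧ 0 ≤ s * (x - c)}

/-- The critical order to the right (`s = 1`) or to the left (`s = -1`). -/
noncomputable def sideOrder (ℓm ℓp s : ℝ) : ℝ := if 0 < s then ℓp else ℓm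

/-- The estimates of `SideEstimates` hold on both sides. -/
def UnimodalEstimates (f : ℝ → ℝ) (c ℓm ℓp C m M : ℝ) : Prop :=
  SideEstimates f c (Icc 0 c) ℓm C m M ∧ SideEstimates f c (Icc c 1) ℓp C m M

section Unimodal

variable {f : ℝ → ℝ} {c ℓm ℓp a b a₁ b₁ : ℝ} {q : ℕ}

theorem UnimodalEstimates.side {C m M s : ℝ} (h : UnimodalEstimates f c ℓm ℓp C m M)
    (hcm : c ∈ Ioo (0 : ℝ) 1) (hs : s = 1 ∨ s = -1) :
    SideEstimates f c (side c s) (sideOrder ℓm ℓp s) C m M := by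
  rcases hs with rfl | rfl
  · have h1 : _root_.side c 1 = Icc c 1 := by
      ext x
      simp only [_root_.side, mem_ofPred_eq, mem_Icc]
      constructor
      · rintro ⟨h1, h2⟩
        exact ⟨by linarith, h1.2⟩
      · rintro ⟨h1, h2⟩
        exact ⟨⟨by linarith [hcm.1], h2⟩, by linarith⟩
    have h2 : sideOrder ℓm ℓp 1 = ℓp := by simp [sideOrder]
    rw [h1, h2]
    exact h.2
  · have h1 : _root_.side c (-1) = Icc 0 c := by
      ext x
      simp only [_root_.side, mem_ofPred_eq, mem_Icc]
      constructor
      · rintro ⟨h1, h2⟩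
        exact ⟨h1.1, by linarith⟩
      · rintro ⟨h1, h2⟩
        exact ⟨⟨h1, by linarith [hcm.2]⟩, by linarith⟩
    have h2 : sideOrder ℓm ℓp (-1) = ℓm := by
      simp only [sideOrder]
      norm_num
    rw [h1, h2]
    exact h.1

theorem IsUnimodal.one_le_sideOrder (hf : IsUnimodal 2 f c ℓm ℓp) (s : ℝ) :
    1 ≤ sideOrder ℓm ℓp s := by
  unfold sideOrder
  split_ifs
  exacts [hf.one_le_right, hf.one_le_left]

theorem sideOrder_le_max (s : ℝ) : sideOrder ℓm ℓp s ≤ max ℓp ℓm := by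
  unfold sideOrder
  split_ifs
  exacts [le_max_left _ _, le_max_right _ _]

theorem sideOrder_eq_max {s : ℝ} (hs : s = 1 ∨ s = -1)
    (h : sideOrder ℓm ℓp (-s) < sideOrder ℓm ℓp s) : sideOrder ℓm ℓp s = max ℓp ℓm := by
  rcases hs with rfl | rfl
  · simp only [sideOrder] at h ⊢
    norm_num at h ⊢
    exact h.le
  · simp only [sideOrder] at h ⊢
    norm_num at h ⊢
    exact h.le

theorem IsUnimodal.lt_of_side (hf : IsUnimodal 2 f c ℓm ℓp) {s : ℝ} (hs : s = 1 ∨ s = -1)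
    {p r : ℝ} (hp : p ∈ side c s) (hr : r ∈ side c s) (h : s * (r - c) < s * (p - c)) :
    f p < f r := by
  obtain ⟨hp1, hp2⟩ := hp
  obtain ⟨hr1, hr2⟩ := hr
  rcases hs with rfl | rfl
  · exact hf.strictAntiOn ⟨by linarith, hr1.2⟩ ⟨by linarith, hp1.2⟩ (by linarith)
  · exact hf.strictMonoOn ⟨hp1.1, by linarith⟩ ⟨hr1.1, by linarith⟩ (by linarith)

theorem abs_sub_eq_of_sign {s : ℝ} (hs : s = 1 ∨ s = -1) (x y c : ℝ) :
    |x - y| = |s * (x - c) - s * (y - c)| := by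
  rcases hs with rfl | rfl
  · congr 1; ring
  · rw [abs_sub_comm]; congr 1; ring

theorem iterate_pred (f : ℝ → ℝ) (hq : 0 < q) (z : ℝ) : f^[q] z = f (f^[q - 1] z) := by
  obtain ⟨p, rfl⟩ := Nat.exists_eq_succ_of_ne_zero hq.ne'
  rw [Function.iterate_succ_apply']
  rfl

/-- The two possible configurations of the last step of a return. -/
theorem CloseReturn.configuration (hf : IsUnimodal 2 f c ℓm ℓp)
    (hc : Continuous f) (hr : ∀ x, f x ∈ Icc (0 : ℝ) 1) {e g : ℝ}
    (h : CloseReturn f c a b a₁ b₁ q) (he : 0 ≤ e) (hg : g ≤ f c)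
    (hea : e < a) (hbg : b < g) (hF : ∀ z ∈ Icc e g, a ≤ f^[q] z) (hFe : f^[q] e = a)
    (hFg : f^[q] g = a ∨ g = f c ∧ a < f^[q] g) :
    ∃ s : ℝ, (s = 1 ∨ s = -1) ∧ (∀ x ∈ Icc a b, 0 < s * (f^[q - 1] x - c)) ∧
      ((StrictAntiOn (fun x => s * (f^[q - 1] x - c)) (Icc e g) ∧
          s * (f^[q - 1] g - c) < 0 ∧ f^[q] a = a₁ ∧ f^[q] b = b₁) ∨
        (StrictMonoOn (fun x => s * (f^[q - 1] x - c)) (Icc e g) ∧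
          s * (f^[q - 1] e - c) < 0 ∧ f^[q] a = b₁ ∧ f^[q] b = a₁ ∧ f^[q] g = a)) := by
  have hab := h.lt
  have ha : a ∈ Icc a b := ⟨le_rfl, hab.le⟩
  have hb : b ∈ Icc a b := ⟨hab.le, le_rfl⟩
  have hT : Icc e g ⊆ Icc 0 1 := Icc_subset_Icc he (hg.trans (hr c).2)
  have hJT : Icc a b ⊆ Icc e g := Icc_subset_Icc hea.le hbg.le
  have hJ0 : c ∉ f^[q - 1] '' Icc a b := by
    rintro ⟨x, hx, hxc⟩
    have h1 := h.iterate_mem hx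
    rw [iterate_pred f h.pos, hxc] at h1
    linarith [h1.2, h.lt_value]
  obtain ⟨s, hs, hpos⟩ : ∃ s : ℝ, (s = 1 ∨ s = -1) ∧
      ∀ x ∈ Icc a b, 0 < s * (f^[q - 1] x - c) := by
    rcases subset_side (image_iterate_subset_Icc hr h.wandering.subset (q - 1))
      (ordConnected_image hc ordConnected_Icc _) hJ0 with h1 | h1
    · refine ⟨-1, Or.inr rfl, fun x hx => ?_⟩
      have := (h1 (mem_image_of_mem _ hx)).2
      linarith
    · refine ⟨1, Or.inl rfl, fun x hx => ?_⟩
      have := (h1 (mem_image_of_mem _ hx)).1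
      linarith
  refine ⟨s, hs, hpos, ?_⟩
  set H : ℝ → ℝ := fun x => s * (f^[q - 1] x - c) with hH
  have hlt : ∀ x ∈ Icc e g, ∀ y ∈ Icc e g, 0 ≤ H y → H y < H x → f^[q] x < f^[q] y := by
    intro x hx y hy hy0 hyx
    rw [iterate_pred f h.pos, iterate_pred f h.pos]
    exact hf.lt_of_side hs ⟨iterate_mem_Icc hr (hT hx) _, hy0.trans hyx.le⟩
      ⟨iterate_mem_Icc hr (hT hy) _, hy0⟩ hyx
  have hle : ∀ z ∈ Icc a g, f^[q] z ∈ Icc a (f c) := by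
    intro z hz
    have hz' : z ∈ Icc e g := ⟨hea.le.trans hz.1, hz.2⟩
    refine ⟨hF z hz', ?_⟩
    rw [iterate_pred f h.pos]
    exact hf.le_turning (iterate_mem_Icc hr (hT hz') _)
  have haT := hJT ha
  have hbT := hJT hb
  have heT : e ∈ Icc e g := ⟨le_rfl, by linarith⟩
  have hgT : g ∈ Icc e g := ⟨by linarith, le_rfl⟩
  have hFab : a < f^[q] a := by linarith [(h.iterate_mem ha).1, h.lt_return]
  have hFbb : a < f^[q] b := by linarith [(h.iterate_mem hb).1, h.lt_return]
  obtain ⟨xa, hxa, hxa'⟩ : a₁ ∈ f^[q] '' Icc a b := by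
    rw [h.image]; exact ⟨le_rfl, h.return_lt.le⟩
  obtain ⟨xb, hxb, hxb'⟩ : b₁ ∈ f^[q] '' Icc a b := by
    rw [h.image]; exact ⟨h.return_lt.le, le_rfl⟩
  have hmono : StrictMonoOn H (Icc e g) ∨ StrictAntiOn H (Icc e g) := by
    rcases h.strictMonoOn_or_strictAntiOn hf hc hr he hg hea hbg hF with h1 | h1 <;>
      rcases hs with rfl | rfl
    · left
      intro x hx y hy hxy
      have := h1 hx hy hxy
      simp only [hH]
      linarith
    · right
      intro x hx y hy hxy
      have := h1 hx hy hxy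
      simp only [hH]
      linarith
    · right
      intro x hx y hy hxy
      have := h1 hx hy hxy
      simp only [hH]
      linarith
    · left
      intro x hx y hy hxy
      have := h1 hx hy hxy
      simp only [hH]
      linarith
  rcases hmono with hm | hm
  · right
    have hanti : ∀ x ∈ Icc a b, ∀ y ∈ Icc a b, x ≤ y → f^[q] y ≤ f^[q] x := by
      intro x hx y hy hxy
      rcases hxy.eq_or_lt with h1 | h1
      · rw [h1]
      · exact (hlt _ (hJT hy) _ (hJT hx) (hpos x hx).le (hm (hJT hx) (hJT hy) h1)).le
    refine ⟨hm, ?_, ?_, ?_, ?_⟩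
    · by_contra! h1
      have h2 := hlt _ haT _ heT h1 (hm heT haT hea)
      rw [hFe] at h2
      linarith
    · exact le_antisymm (h.iterate_mem ha).2 (hxb' ▸ hanti a ha xb hxb hxb.1)
    · exact le_antisymm (hxa' ▸ hanti xa hxa b hb hxa.2) (h.iterate_mem hb).1
    · rcases hFg with h1 | ⟨h1, h2⟩
      · exact h1
      · exfalso
        refine h.wandering.omega a ha (isPeriodicOrbit_omegaSet_of_antitoneOn hc hr h.pos
          (A := Icc a g) (fun z hz => ?_) ?_ ⟨le_rfl, haT.2⟩ (h.wandering.subset ha))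
        · rw [h1]; rw [h1] at hz; exact hle z (by rwa [h1])
        · intro x hx y hy hxy
          have hx' : x ∈ Icc e g := ⟨hea.le.trans hx.1, hx.2⟩
          have hy' : y ∈ Icc e g := ⟨hea.le.trans hy.1, hy.2⟩
          rcases hxy.eq_or_lt with h3 | h3
          · rw [h3]
          · refine (hlt _ hy' _ hx' ((hpos a ha).le.trans ?_) (hm hx' hy' h3)).le
            exact hm.monotoneOn haT hx' hx.1
  · left
    have hmono : ∀ x ∈ Icc e g, ∀ y ∈ Icc e g, 0 ≤ H y → x ≤ y → f^[q] x ≤ f^[q] y := by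
      intro x hx y hy hy0 hxy
      rcases hxy.eq_or_lt with h1 | h1
      · rw [h1]
      · exact (hlt _ hx _ hy hy0 (hm hx hy h1)).le
    refine ⟨hm, ?_, ?_, ?_⟩
    · by_contra! h1
      rcases hFg with h2 | ⟨h2, -⟩
      · have h3 := hmono b hbT g hgT h1 hbg.le
        linarith
      · refine h.wandering.omega a ha (isPeriodicOrbit_omegaSet_of_monotoneOn hc hr h.pos
          (A := Icc a g) (fun z hz => ?_) ?_ ⟨le_rfl, haT.2⟩ (h.wandering.subset ha))
        · rw [h2]; rw [h2] at hz; exact hle z (by rwa [h2])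
        · intro x hx y hy hxy
          have hx' : x ∈ Icc e g := ⟨hea.le.trans hx.1, hx.2⟩
          have hy' : y ∈ Icc e g := ⟨hea.le.trans hy.1, hy.2⟩
          exact hmono x hx' y hy' (h1.trans (hm.antitoneOn hy' hgT hy.2)) hxy
    · exact le_antisymm
        (hxa' ▸ hmono a haT xa (hJT hxa) (hpos xa hxa).le hxa.1) (h.iterate_mem ha).1
    · exact le_antisymm (h.iterate_mem hb).2
        (hxb' ▸ hmono xb (hJT hxb) b hbT (hpos b hb).le hxb.2)

end Unimodal

section Unimodal

variable {f : ℝ → ℝ} {c ℓm ℓp a b a₁ b₁ : ℝ} {q : ℕ}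

theorem mul_le_of_crossRatio_le {x₁ x₂ x₃ x₄ y₁ y₂ y₃ y₄ K : ℝ} (hx : Ordered₄ x₁ x₂ x₃ x₄)
    (hy : Ordered₄ y₁ y₂ y₃ y₄) (h : crossRatio y₁ y₂ y₃ y₄ ≤ K * crossRatio x₁ x₂ x₃ x₄) :
    |y₂ - y₁| * |y₄ - y₃| * (|x₃ - x₂| * |x₄ - x₁|) ≤
      K * (|x₂ - x₁| * |x₄ - x₃|) * (|y₃ - y₂| * |y₄ - y₁|) := by
  obtain ⟨h1, h2, h3, h4⟩ := hx.abs_pos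
  obtain ⟨k1, k2, k3, k4⟩ := hy.abs_pos
  unfold crossRatio at h
  rw [mul_div_assoc', div_le_div_iff₀ (by positivity) (by positivity)] at h
  exact h

theorem side_of_uIcc_notMem (hr : ∀ x, f x ∈ Icc (0 : ℝ) 1) (hc : Continuous f) {A : Set ℝ}
    (hA : A ⊆ Icc 0 1) (hAo : A.OrdConnected) {i : ℕ} (hcA : c ∉ f^[i] '' A) {x y : ℝ}
    (hx : x ∈ A) (hy : y ∈ A) : (f^[i] x ∈ Icc 0 c ∧ f^[i] y ∈ Icc 0 c) ∨
      (f^[i] x ∈ Icc c 1 ∧ f^[i] y ∈ Icc c 1) := by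
  rcases subset_side (image_iterate_subset_Icc hr hA i) (ordConnected_image hc hAo i) hcA with
    h1 | h1
  · exact Or.inl ⟨Ico_subset_Icc_self (h1 (mem_image_of_mem _ hx)),
      Ico_subset_Icc_self (h1 (mem_image_of_mem _ hy))⟩
  · exact Or.inr ⟨Ioc_subset_Icc_self (h1 (mem_image_of_mem _ hx)),
      Ioc_subset_Icc_self (h1 (mem_image_of_mem _ hy))⟩

theorem CloseReturn.crossRatio_le (hf : IsUnimodal 2 f c ℓm ℓp)
    (hc : Continuous f) (hr : ∀ x, f x ∈ Icc (0 : ℝ) 1) {C m M : ℝ}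
    (hE : UnimodalEstimates f c ℓm ℓp C m M) {e g : ℝ}
    (h : CloseReturn f c a b a₁ b₁ q) (he : 0 ≤ e) (hg : g ≤ f c)
    (hea : e < a) (hbg : b < g) (hF : ∀ z ∈ Icc e g, a ≤ f^[q] z) {p : ℝ} (hp : a < p)
    (hpg : p < g) :
    |f^[q - 1] a - f^[q - 1] e| * |f^[q - 1] g - f^[q - 1] p| * ((p - a) * (g - e)) ≤
      Real.exp (C * 8) * ((a - e) * (g - p)) *
        (|f^[q - 1] p - f^[q - 1] a| * |f^[q - 1] g - f^[q - 1] e|) := by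
  have hT : Icc e g ⊆ Icc 0 1 := Icc_subset_Icc he (hg.trans (hr c).2)
  have heT : e ∈ Icc e g := ⟨le_rfl, by linarith [h.lt]⟩
  have hgT : g ∈ Icc e g := ⟨by linarith [h.lt], le_rfl⟩
  have ho : Ordered₄ e a p g := Or.inl ⟨hea, hp, hpg⟩
  obtain ⟨ho', hcr⟩ := crossRatio_iterate_le hf hE.1 hE.2 ho (q - 1) fun i hi =>
    side_of_uIcc_notMem hr hc hT ordConnected_Icc (h.notMem_image hc hea hbg hF hi) heT hgT
  have hsum := h.sum_le hc hr he hg hea hbg hF hgT heT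
  have hC := hE.1.C_nonneg
  have hcr' := hcr.trans (mul_le_mul_of_nonneg_right
    (Real.exp_le_exp.2 (mul_le_mul_of_nonneg_left hsum hC)) (crossRatio_nonneg _ _ _ _))
  have := mul_le_of_crossRatio_le ho ho' hcr'
  rwa [abs_of_pos (sub_pos.2 hea), abs_of_pos (sub_pos.2 hp), abs_of_pos (sub_pos.2 hpg),
    abs_of_pos (sub_pos.2 (hea.trans (hp.trans hpg)))] at this

theorem isPeriodicOrbit_omegaSet_of_fold (hc : Continuous f)
    (hr : ∀ x, f x ∈ Icc (0 : ℝ) 1) (hq : 0 < q) {a c' g : ℝ}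
    (hm : MonotoneOn f^[q] (Icc a c')) (hanti : AntitoneOn f^[q] (Icc c' g)) (hac : a ≤ c')
    (hcg : c' ≤ g) (haI : a ∈ Icc (0 : ℝ) 1) (hg : g ≤ 1) (ha : a ≤ f^[q] a)
    (hge : c' ≤ f^[q] g) (hle : ∀ z ∈ Icc (0 : ℝ) 1, f^[q] z ≤ g) :
    IsPeriodicOrbit f (omegaSet f a) := by
  have hmaps : MapsTo f^[q] (Icc c' g) (Icc c' g) := by
    intro z hz
    exact ⟨hge.trans (hanti hz ⟨hcg, le_rfl⟩ hz.2),
      hle z ⟨haI.1.trans (hac.trans hz.1), hz.2.trans hg⟩⟩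
  by_cases hstay : ∀ n, f^[q * n] a ≤ c'
  · refine isPeriodicOrbit_omegaSet_of_monotone hc hr hq haI (Or.inl ?_)
    have hinc : ∀ n, a ≤ f^[q * n] a ∧ f^[q * n] a ≤ f^[q * (n + 1)] a := by
      intro n
      induction n with
      | zero => simpa using ha
      | succ n ih =>
        refine ⟨ih.1.trans ih.2, ?_⟩
        rw [iterate_mul_succ f q (n + 1)]
        conv_lhs => rw [iterate_mul_succ f q n]
        exact hm ⟨ih.1, hstay n⟩ ⟨ih.1.trans ih.2, hstay (n + 1)⟩ ih.2
    exact monotone_nat_of_le_succ fun n => (hinc n).2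
  · push Not at hstay
    obtain ⟨n, hn⟩ := hstay
    rw [← omegaSet_iterate f (q * n) a]
    refine isPeriodicOrbit_omegaSet_of_antitoneOn hc hr hq hmaps hanti
      ⟨hn.le, ?_⟩ (iterate_mem_Icc hr haI _)
    cases n with
    | zero =>
      simp only [mul_zero, Function.iterate_zero, id] at hn
      linarith
    | succ n =>
      rw [iterate_mul_succ]
      exact hle _ (iterate_mem_Icc hr haI _)

set_option maxHeartbeats 1000000 in
/-- The estimate for one close return. -/
theorem CloseReturn.step (hf : IsUnimodal 2 f c ℓm ℓp)
    (hc : Continuous f) (hr : ∀ x, f x ∈ Icc (0 : ℝ) 1) {C m M : ℝ}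
    (hE : UnimodalEstimates f c ℓm ℓp C m M) (h : CloseReturn f c a b a₁ b₁ q) {K η : ℝ}
    (hK : K = Real.exp (C * 8)) (hη : f c - b = η * (f c - a)) (hη1 : η ≤ 1 / 2)
    (hη2 : 8 * K * η ≤ 1) (hη3 : η * M * 2 ^ (max ℓp ℓm) ≤ m) (hη4 : 8 * K * η * M < m) :
    ∃ s : ℝ, (s = 1 ∨ s = -1) ∧ (∀ x ∈ Icc a b, 0 < s * (f^[q - 1] x - c)) ∧
      sideOrder ℓm ℓp (-s) < sideOrder ℓm ℓp s ∧
      ∃ X Y, 0 < X ∧ X ≤ 1 ∧ 0 ≤ Y ∧ Y ≤ 8 * K * η * X ∧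
        m * X ^ sideOrder ℓm ℓp s ≤ f c - a₁ ∧ f c - b₁ ≤ M * Y ^ sideOrder ℓm ℓp s ∧
        (f c - a ≤ M * (8 * K * η * X) ^ sideOrder ℓm ℓp (-s) ∨
          s * (f^[q - 1] (f c) - c) < 0 ∧ a < f^[q] (f c)) := by
  obtain ⟨e, g, he, hea, hbg, hg, hFe, hFg, hF⟩ := h.exists_ends hc
  obtain ⟨s, hs, hpos, hconf⟩ := h.configuration hf hc hr he hg hea hbg hF hFe hFg
  refine ⟨s, hs, hpos, ?_⟩
  have hs' : -s = 1 ∨ -s = -1 := by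
    rcases hs with rfl | rfl
    · exact Or.inr rfl
    · exact Or.inl (neg_neg 1)
  have hcm := hf.mem
  have hES := hE.side hcm hs
  have hES' := hE.side hcm hs'
  set l := sideOrder ℓm ℓp s
  set l' := sideOrder ℓm ℓp (-s)
  have hl : 1 ≤ l := hf.one_le_sideOrder s
  have hl' : 1 ≤ l' := hf.one_le_sideOrder (-s)
  have hm := hES.m_pos
  have hM := hES.M_pos
  have hab := h.lt
  have hlt := h.lt_return
  have hlt1 := h.return_lt
  have hlt2 := h.lt_value
  have ha : a ∈ Icc a b := ⟨le_rfl, hab.le⟩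
  have hb : b ∈ Icc a b := ⟨hab.le, le_rfl⟩
  have hT : Icc e g ⊆ Icc 0 1 := Icc_subset_Icc he (hg.trans (hr c).2)
  have hJT : Icc a b ⊆ Icc e g := Icc_subset_Icc hea.le hbg.le
  have haT := hJT ha
  have hbT := hJT hb
  have heT : e ∈ Icc e g := ⟨le_rfl, by linarith⟩
  have hgT : g ∈ Icc e g := ⟨by linarith, le_rfl⟩
  have hK0 : 0 < K := hK ▸ Real.exp_pos _
  have hA0 : 0 < f c - a := by linarith
  have hη0 : 0 ≤ η := by
    by_contra! h1
    nlinarith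
  set H : ℝ → ℝ := fun x => s * (f^[q - 1] x - c) with hH
  have habs : ∀ x y, |f^[q - 1] x - f^[q - 1] y| = |H x - H y| :=
    fun x y => abs_sub_eq_of_sign hs _ _ c
  have hHabs : ∀ x, |f^[q - 1] x - c| = |H x| := fun x => by
    simp only [hH, abs_mul]
    rcases hs with rfl | rfl <;> simp
  have hHle : ∀ x ∈ Icc e g, H x ≤ 1 := by
    intro x hx
    have h1 := iterate_mem_Icc hr (hT hx) (q - 1)
    simp only [hH]
    rcases hs with rfl | rfl
    · linarith [h1.2, hcm.1]
    · linarith [h1.1, hcm.2]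
  have hside : ∀ x ∈ Icc e g, 0 ≤ H x → f^[q - 1] x ∈ side c s := fun x hx h0 =>
    ⟨iterate_mem_Icc hr (hT hx) _, h0⟩
  have hside' : ∀ x ∈ Icc e g, H x ≤ 0 → f^[q - 1] x ∈ side c (-s) := fun x hx h0 => by
    refine ⟨iterate_mem_Icc hr (hT hx) _, ?_⟩
    simp only [hH] at h0
    linarith
  have hlow : ∀ x ∈ Icc e g, 0 ≤ H x → m * H x ^ l ≤ f c - f^[q] x := by
    intro x hx h0
    have := hES.lower _ (hside x hx h0)
    rwa [hHabs, abs_of_nonneg h0, ← iterate_pred f h.pos] at this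
  have hup : ∀ x ∈ Icc e g, 0 ≤ H x → f c - f^[q] x ≤ M * H x ^ l := by
    intro x hx h0
    have := hES.upper _ (hside x hx h0)
    rwa [hHabs, abs_of_nonneg h0, ← iterate_pred f h.pos] at this
  have hup' : ∀ x ∈ Icc e g, H x ≤ 0 → f c - f^[q] x ≤ M * (-H x) ^ l' := by
    intro x hx h0
    have := hES'.upper _ (hside' x hx h0)
    rwa [hHabs, abs_of_nonpos h0, ← iterate_pred f h.pos] at this
  have hη3' : η * M * 2 ^ l ≤ m := by
    refine le_trans ?_ hη3
    gcongr
    · norm_num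
    · exact sideOrder_le_max s
  -- the cross ratio of the whole configuration
  have hcr : |H a - H e| * |H g - H b| ≤ 2 * K * η * (|H b - H a| * |H g - H e|) := by
    have h1 := h.crossRatio_le hf hc hr hE he hg hea hbg hF hab hbg
    rw [← hK, habs, habs, habs, habs] at h1
    have h2 : 0 < (b - a) * (g - e) := mul_pos (by linarith) (by linarith)
    have h3 : (a - e) * (g - b) ≤ (g - e) * (2 * η * (b - a)) := by
      have : g - b ≤ 2 * η * (b - a) := by nlinarith
      exact mul_le_mul (by linarith) this (by linarith) (by linarith)
    have h4 : 0 ≤ |H b - H a| * |H g - H e| := by positivity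
    refine le_of_mul_le_mul_right (h1.trans ?_) h2
    calc K * ((a - e) * (g - b)) * (|H b - H a| * |H g - H e|)
        ≤ K * ((g - e) * (2 * η * (b - a))) * (|H b - H a| * |H g - H e|) := by gcongr
      _ = 2 * K * η * (|H b - H a| * |H g - H e|) * ((b - a) * (g - e)) := by ring
  have hred : 4 * K * η ≤ 1 := by nlinarith
  have hfar : f c - a₁ ≤ η * (f c - a) := by linarith
  have hpow : ∀ {N X : ℝ}, 0 ≤ N → N ≤ 8 * K * η * X →
      f c - a ≤ M * N ^ l' → f c - a ≤ M * (8 * K * η * X) ^ l' := by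
    intro N X hN hNX h1
    exact h1.trans (by gcongr)
  rcases hconf with ⟨hmono, hHg, hFa, hFb⟩ | ⟨hmono, hHe, hFa, hFb, hFg⟩
  · have h1 : H b < H a := hmono haT hbT hab
    have h2 : H a < H e := hmono heT haT hea
    have hHb := hpos b hb
    have hHa := hpos a ha
    have hHe0 : 0 ≤ H e := by linarith
    rw [abs_of_neg (by linarith), abs_of_neg (by linarith), abs_of_neg (by linarith),
      abs_of_neg (by linarith)] at hcr
    have hlowa := hlow a haT hHa.le
    rw [hFa] at hlowa
    have hupe := hup e heT hHe0
    rw [hFe] at hupe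
    obtain ⟨h3, h4⟩ := le_of_crossRatio_le (P := H e) (X := H a) (Y := H b) (N := -H g) hHb.le h1 h2
      (by linarith) hη0 hK0 hm hl (by linarith) (hlowa.trans hfar) hupe hη3' hred
    have hupb := hup b hbT hHb.le
    rw [hFb] at hupb
    have hupg := hup' g hgT hHg.le
    have hNX : -H g ≤ 8 * K * η * H a := by linarith
    have hXA : m * H a ^ l ≤ f c - a := by linarith
    have hmain : l' < l ∧ (f c - a ≤ M * (8 * K * η * H a) ^ l' ∨
        s * (f^[q - 1] (f c) - c) < 0 ∧ a < f^[q] (f c)) := by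
      rcases hFg with h5 | ⟨h5, h6⟩
      · rw [h5] at hupg
        exact ⟨lt_of_mul_rpow_le hHa (hHle a haT) (by linarith) (by positivity) hM hl' hXA hupg
          hNX hη2 hη4, Or.inl (hpow (by linarith) hNX hupg)⟩
      · refine ⟨?_, Or.inr ?_⟩
        · -- the preimage of the turning point
          obtain ⟨c', hc', hHc'⟩ : ∃ c' ∈ Icc b g, H c' = 0 := by
            have hcont : ContinuousOn H (Icc b g) :=
              (continuous_const.mul ((hc.iterate _).sub continuous_const)).continuousOn
            exact intermediate_value_Icc' hbg.le hcont ⟨hHg.le, hHb.le⟩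
          have hc'T : c' ∈ Icc e g := ⟨by linarith [hc'.1], hc'.2⟩
          have hbc' : b < c' := lt_of_le_of_ne hc'.1 fun h' => by
            rw [h'] at hHb
            exact hHb.ne' hHc'
          have hc'g : c' < g := lt_of_le_of_ne hc'.2 fun h' => by
            rw [h'] at hHc'
            exact hHg.ne hHc'
          have hgc' : f^[q] g < c' := by
            by_contra! hge
            -- the orbit of `a` under the return map is monotone or enters an invariant interval
            have hmono1 : ∀ x ∈ Icc e c', ∀ y ∈ Icc e c', x ≤ y → f^[q] x ≤ f^[q] y := by
              intro x hx y hy hxy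
              rcases hxy.eq_or_lt with h' | h'
              · rw [h']
              · have hxT : x ∈ Icc e g := ⟨hx.1, hx.2.trans hc'.2⟩
                have hyT : y ∈ Icc e g := ⟨hy.1, hy.2.trans hc'.2⟩
                have hy0 : 0 ≤ H y := by
                  rw [← hHc']
                  exact hmono.antitoneOn hyT hc'T hy.2
                rw [iterate_pred f h.pos, iterate_pred f h.pos]
                exact (hf.lt_of_side hs (hside x hxT (hy0.trans (hmono hxT hyT h').le))
                  (hside y hyT hy0) (hmono hxT hyT h')).le
            have hanti1 : AntitoneOn f^[q] (Icc c' g) := by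
              intro x hx y hy hxy
              rcases hxy.eq_or_lt with h' | h'
              · rw [h']
              · have hxT : x ∈ Icc e g := ⟨by linarith [hx.1], hx.2⟩
                have hyT : y ∈ Icc e g := ⟨by linarith [hy.1], hy.2⟩
                have hx0 : H x ≤ 0 := by
                  rw [← hHc']
                  exact hmono.antitoneOn hc'T hxT hx.1
                have hyx := hmono hxT hyT h'
                rw [iterate_pred f h.pos, iterate_pred f h.pos]
                refine (hf.lt_of_side hs' (hside' y hyT (by linarith)) (hside' x hxT hx0) ?_).le
                simp only [hH] at hyx
                linarith
            refine h.wandering.omega a ha (isPeriodicOrbit_omegaSet_of_fold hc hr h.pos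
              (fun x hx y hy hxy => hmono1 x ⟨by linarith [hx.1], hx.2⟩ y
                ⟨by linarith [hy.1], hy.2⟩ hxy) hanti1 (by linarith) hc'.2
              (h.wandering.subset ha) (hT hgT).2 (by linarith) hge fun z hz => ?_)
            rw [h5, iterate_pred f h.pos]
            exact hf.le_turning (iterate_mem_Icc hr hz _)
          have h7 := h.crossRatio_le hf hc hr hE he hg hea hbg hF (hab.trans hbc') hc'g
          rw [← hK, habs, habs, habs, habs, hHc', abs_of_neg (by linarith),
            abs_of_neg (by linarith), abs_of_neg (by linarith), abs_of_neg (by linarith)] at h7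
          have h8 : (H e - H a) * (-H g) * (f c - a) ≤
              2 * K * (f c - c') * (H a * (H e + -H g)) := by
            have hge0 : 0 < g - e := by linarith
            have hca : f c - a ≤ 2 * (c' - a) := by nlinarith
            have hx1 : 0 ≤ (H e - H a) * (-H g) := mul_nonneg (by linarith) (by linarith)
            have hx2 : 0 ≤ H a * (H e + -H g) := mul_nonneg hHa.le (by linarith)
            refine le_of_mul_le_mul_right ?_ hge0
            calc (H e - H a) * (-H g) * (f c - a) * (g - e)
                ≤ (H e - H a) * (-H g) * (2 * (c' - a)) * (g - e) := by gcongr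
              _ = 2 * (-(H a - H e) * -(H g - 0) * ((c' - a) * (g - e))) := by ring
              _ ≤ 2 * (K * ((a - e) * (g - c')) * (-(0 - H a) * -(H g - H e))) := by gcongr
              _ = 2 * K * ((a - e) * (g - c')) * (H a * (H e + -H g)) := by ring
              _ ≤ 2 * K * ((g - e) * (f c - c')) * (H a * (H e + -H g)) := by
                have : (a - e) * (g - c') ≤ (g - e) * (f c - c') :=
                  mul_le_mul (by linarith) (by linarith) (by linarith) (by linarith)
                gcongr
              _ = 2 * K * (f c - c') * (H a * (H e + -H g)) * (g - e) := by ring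
          refine lt_of_crossRatio_le (η := η) hHa (hHle a haT) h3 (by linarith) ?_ hη0 hK0 hM hl' h8
            (hlowa.trans hfar) (by linarith) (by nlinarith)
          have : 8 * K * η * H a ≤ 1 * H a := by gcongr
          linarith
        · rw [← h5]
          exact ⟨hHg, h6⟩
    exact ⟨hmain.1, H a, H b, hHa, hHle a haT, hHb.le, by linarith, hlowa, hupb, hmain.2⟩
  · have h1 : H a < H b := hmono haT hbT hab
    have h2 : H b < H g := hmono hbT hgT hbg
    have hHb := hpos b hb
    have hHa := hpos a ha
    rw [abs_of_pos (by linarith), abs_of_pos (by linarith), abs_of_pos (by linarith),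
      abs_of_pos (by linarith)] at hcr
    have hlowb := hlow b hbT hHb.le
    rw [hFb] at hlowb
    have hupg := hup g hgT (by linarith)
    rw [hFg] at hupg
    obtain ⟨h3, h4⟩ := le_of_crossRatio_le (P := H g) (X := H b) (Y := H a) (N := -H e) hHa.le h1 h2
      (by linarith) hη0 hK0 hm hl (by linarith) (hlowb.trans hfar) hupg hη3' hred
    have hupa := hup a haT hHa.le
    rw [hFa] at hupa
    have hupe := hup' e heT hHe.le
    rw [hFe] at hupe
    have hNX : -H e ≤ 8 * K * η * H b := by linarith
    have hXA : m * H b ^ l ≤ f c - a := by linarith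
    exact ⟨lt_of_mul_rpow_le hHb (hHle b hbT) (by linarith) (by positivity) hM hl' hXA hupe
      hNX hη2 hη4, H b, H a, hHb, hHle b hbT, hHa.le, by linarith, hlowb, hupa,
      Or.inl (hpow (by linarith) hNX hupe)⟩

end Unimodal

/-- The lower endpoint of the `n`-th image of `J`. -/
noncomputable def imgInf (f : ℝ → ℝ) (J : Set ℝ) (n : ℕ) : ℝ := sInf (f^[n] '' J)

/-- The upper endpoint of the `n`-th image of `J`. -/
noncomputable def imgSup (f : ℝ → ℝ) (J : Set ℝ) (n : ℕ) : ℝ := sSup (f^[n] '' J)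

/-- A compact wandering interval whose images avoid the critical value and accumulate at the turning
point. -/
structure WanderingChain (f : ℝ → ℝ) (c : ℝ) (J : Set ℝ) : Prop where
  wandering : IsWanderingInterval f J
  exists_Icc : ∀ n, ∃ u ∈ J, ∃ w ∈ J, f^[n] u < f^[n] w ∧ f^[n] '' J = Icc (f^[n] u) (f^[n] w)
  notMem : ∀ n, f c ∉ f^[n] '' J
  near : ∀ M δ, 0 < δ → ∃ j, M ≤ j ∧ ∃ x ∈ f^[j] '' J, |x - c| < δ

section Unimodal

variable {f : ℝ → ℝ} {c ℓm ℓp : ℝ} {J : Set ℝ}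

theorem infDist_Icc {x a b : ℝ} (hab : a ≤ b) (hb : b ≤ x) : Metric.infDist x (Icc a b) = x - b := by
  refine le_antisymm ?_ ?_
  · refine (Metric.infDist_le_dist_of_mem (right_mem_Icc.2 hab)).trans_eq ?_
    rw [Real.dist_eq, abs_of_nonneg (by linarith)]
  · rw [Metric.le_infDist ⟨a, left_mem_Icc.2 hab⟩]
    intro y hy
    rw [Real.dist_eq, abs_of_nonneg (by linarith [hy.2])]
    linarith [hy.2]

theorem WanderingChain.image_eq (h : WanderingChain f c J) (n : ℕ) :
    f^[n] '' J = Icc (imgInf f J n) (imgSup f J n) := by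
  obtain ⟨u, -, w, -, hlt, himg⟩ := h.exists_Icc n
  simp only [imgInf, imgSup]
  rw [himg, csInf_Icc hlt.le, csSup_Icc hlt.le]

theorem WanderingChain.inf_lt_sup (h : WanderingChain f c J) (n : ℕ) :
    imgInf f J n < imgSup f J n := by
  obtain ⟨u, -, w, -, hlt, himg⟩ := h.exists_Icc n
  simp only [imgInf, imgSup]
  rwa [himg, csInf_Icc hlt.le, csSup_Icc hlt.le]

theorem WanderingChain.inf_mem (h : WanderingChain f c J) (n : ℕ) :
    imgInf f J n ∈ f^[n] '' J := by
  rw [h.image_eq n]; exact left_mem_Icc.2 (h.inf_lt_sup n).le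

theorem WanderingChain.sup_mem (h : WanderingChain f c J) (n : ℕ) :
    imgSup f J n ∈ f^[n] '' J := by
  rw [h.image_eq n]; exact right_mem_Icc.2 (h.inf_lt_sup n).le

theorem WanderingChain.mem_iff (h : WanderingChain f c J) {n : ℕ} {x : ℝ} :
    x ∈ f^[n] '' J ↔ imgInf f J n ≤ x ∧ x ≤ imgSup f J n := by
  rw [h.image_eq n]; rfl

theorem WanderingChain.image_subset (h : WanderingChain f c J) (hr : ∀ x, f x ∈ Icc (0 : ℝ) 1)
    (n : ℕ) : f^[n] '' J ⊆ Icc 0 1 :=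
  image_iterate_subset_Icc hr h.wandering.subset n

theorem WanderingChain.sup_lt (hf : IsUnimodal 2 f c ℓm ℓp) (hr : ∀ x, f x ∈ Icc (0 : ℝ) 1)
    (h : WanderingChain f c J) {n : ℕ} (hn : 0 < n) : imgSup f J n < f c := by
  obtain ⟨x, hx, hxn⟩ := h.sup_mem n
  refine lt_of_le_of_ne ?_ fun h' => h.notMem n (h' ▸ h.sup_mem n)
  rw [← hxn, iterate_pred f hn]
  exact hf.le_turning (iterate_mem_Icc hr (h.wandering.subset hx) _)

theorem WanderingChain.infDist_eq (hf : IsUnimodal 2 f c ℓm ℓp) (hr : ∀ x, f x ∈ Icc (0 : ℝ) 1)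
    (h : WanderingChain f c J) {n : ℕ} (hn : 0 < n) :
    Metric.infDist (f c) (f^[n] '' J) = f c - imgSup f J n := by
  rw [h.image_eq, infDist_Icc (h.inf_lt_sup n).le (h.sup_lt hf hr hn).le]

theorem WanderingChain.infDist_pos (h : WanderingChain f c J) (n : ℕ) :
    0 < Metric.infDist (f c) (f^[n] '' J) := by
  have h1 : IsClosed (f^[n] '' J) := by rw [h.image_eq]; exact isClosed_Icc
  exact (h1.notMem_iff_infDist_pos ⟨_, h.inf_mem n⟩).1 (h.notMem n)

/-- Different images of the wandering interval are ordered. -/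
theorem WanderingChain.lt_of_lt (h : WanderingChain f c J)
    {i j : ℕ} (hij : i ≠ j) {x y x' y' : ℝ} (hx : x ∈ f^[i] '' J) (hy : y ∈ f^[j] '' J)
    (hxy : x < y) (hx' : x' ∈ f^[i] '' J) (hy' : y' ∈ f^[j] '' J) : x' < y' := by
  refine lt_of_disjoint_ordConnected ?_ ?_ (h.wandering.disjoint hij) hx hy hxy hx' hy'
  · rw [h.image_eq]; exact ordConnected_Icc
  · rw [h.image_eq]; exact ordConnected_Icc

theorem WanderingChain.infinite (hc : Continuous f) (h : WanderingChain f c J) :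
    {n : ℕ | IsClosestReturn f c J n}.Infinite := by
  rw [← Nat.frequently_atTop_iff_infinite, frequently_atTop]
  by_contra! hno
  obtain ⟨N, hN⟩ := hno
  obtain ⟨δ, hδ, hδN⟩ : ∃ δ > 0, ∀ j < N + 1, δ ≤ Metric.infDist (f c) (f^[j] '' J) := by
    have h1 : (Finset.range (N + 1)).Nonempty := ⟨0, by simp⟩
    obtain ⟨j, -, hj⟩ := Finset.exists_min_image _
      (fun j => Metric.infDist (f c) (f^[j] '' J)) h1
    exact ⟨_, h.infDist_pos j, fun i hi => hj i (Finset.mem_range.2 hi)⟩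
  have hall : ∀ n, δ ≤ Metric.infDist (f c) (f^[n] '' J) := by
    intro n
    induction n using Nat.strong_induction_on with
    | _ n ih =>
      rcases lt_or_ge n (N + 1) with hn | hn
      · exact hδN n hn
      · have h1 := hN n (by omega)
        simp only [IsClosestReturn, not_and, not_forall, not_lt] at h1
        obtain ⟨k, hk, hkn⟩ := h1 (by omega)
        exact (ih k hk).trans hkn
  obtain ⟨ε, hε, hball⟩ := Metric.continuousAt_iff.1 (hc.continuousAt (x := c)) δ hδ
  obtain ⟨j, -, x, ⟨y, hy, rfl⟩, hx⟩ := h.near 0 ε hε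
  have h1 := hball (x := f^[j] y) (by rwa [Real.dist_eq])
  have h2 := Metric.infDist_le_dist_of_mem (x := f c) (mem_image_of_mem f^[j + 1] hy)
  rw [Function.iterate_succ_apply', dist_comm] at h2
  linarith [hall (j + 1)]

/-- The closest return moments. -/
noncomputable def closestReturn (f : ℝ → ℝ) (c : ℝ) (J : Set ℝ) : ℕ → ℕ :=
  Nat.nth (IsClosestReturn f c J)

theorem WanderingChain.isClosestReturn (hc : Continuous f) (h : WanderingChain f c J) (k : ℕ) :
    IsClosestReturn f c J (closestReturn f c J k) :=
  Nat.nth_mem_of_infinite (h.infinite hc) k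

theorem WanderingChain.closestReturn_strictMono (hc : Continuous f) (h : WanderingChain f c J) :
    StrictMono (closestReturn f c J) :=
  Nat.nth_strictMono (h.infinite hc)

theorem WanderingChain.closestReturn_pos (hc : Continuous f) (h : WanderingChain f c J) (k : ℕ) :
    0 < closestReturn f c J k := (h.isClosestReturn hc k).1

theorem WanderingChain.infDist_le (hc : Continuous f) (h : WanderingChain f c J) (k : ℕ) {j : ℕ}
    (hj : j < closestReturn f c J (k + 1)) :
    Metric.infDist (f c) (f^[closestReturn f c J k] '' J) ≤ Metric.infDist (f c) (f^[j] '' J) := by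
  induction j using Nat.strong_induction_on with
  | _ j ih =>
    rcases lt_trichotomy j (closestReturn f c J k) with h1 | h1 | h1
    · exact ((h.isClosestReturn hc k).2 j h1).le
    · rw [h1]
    · have hn : ¬ IsClosestReturn f c J j := by
        intro hj'
        obtain ⟨i, -, hi⟩ := Nat.exists_lt_card_nth_eq hj'
        have hi' : closestReturn f c J i = j := hi
        rw [← hi'] at hj h1
        have h2 := (h.closestReturn_strictMono hc).lt_iff_lt.1 hj
        have h3 := (h.closestReturn_strictMono hc).lt_iff_lt.1 h1
        omega
      simp only [IsClosestReturn, not_and, not_forall, not_lt] at hn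
      obtain ⟨i, hij, hi⟩ := hn (by omega)
      exact (ih i hij (hij.trans hj)).trans hi

/-- An image before the next closest return that is not closer to the critical value lies to the left
of the present closest return. -/
theorem WanderingChain.lt_inf (hf : IsUnimodal 2 f c ℓm ℓp) (hc : Continuous f)
    (hr : ∀ x, f x ∈ Icc (0 : ℝ) 1) (h : WanderingChain f c J) (k : ℕ) {j : ℕ} (hj0 : 0 < j)
    (hj : j < closestReturn f c J (k + 1)) (hne : j ≠ closestReturn f c J k) {x : ℝ}
    (hx : x ∈ f^[j] '' J) : x < imgInf f J (closestReturn f c J k) := by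
  have h1 := h.infDist_le hc k hj
  rw [h.infDist_eq hf hr hj0, h.infDist_eq hf hr (h.closestReturn_pos hc k)] at h1
  have h2 : imgSup f J j < imgSup f J (closestReturn f c J k) := by
    refine lt_of_le_of_ne (by linarith) fun h' => ?_
    exact Set.disjoint_left.1 (h.wandering.disjoint hne) (h.sup_mem j) (h' ▸ h.sup_mem _)
  exact h.lt_of_lt hne (h.sup_mem _) (h.sup_mem _) h2 hx (h.inf_mem _)

theorem WanderingChain.sup_lt_inf (hf : IsUnimodal 2 f c ℓm ℓp) (hc : Continuous f)
    (hr : ∀ x, f x ∈ Icc (0 : ℝ) 1) (h : WanderingChain f c J) (k : ℕ) :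
    imgSup f J (closestReturn f c J k) < imgInf f J (closestReturn f c J (k + 1)) :=
  h.lt_inf hf hc hr (k + 1) (h.closestReturn_pos hc k)
    (h.closestReturn_strictMono hc (by omega)) (h.closestReturn_strictMono hc (by omega)).ne
    (h.sup_mem _)

theorem IsWanderingInterval.image (hf : IsUnimodal 2 f c ℓm ℓp) (hc : Continuous f)
    (hr : ∀ x, f x ∈ Icc (0 : ℝ) 1) (h : IsWanderingInterval f J) (n : ℕ) :
    IsWanderingInterval f (f^[n] '' J) where
  subset := image_iterate_subset_Icc hr h.subset n
  ordConnected := ordConnected_image hc h.ordConnected n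
  nontrivial := hf.image_iterate_nontrivial hc hr h.subset h.ordConnected h.nontrivial n
  disjoint := by
    intro i j hij
    rw [← image_comp, ← image_comp, ← Function.iterate_add, ← Function.iterate_add]
    exact h.disjoint (by omega)
  omega := by
    rintro _ ⟨x, hx, rfl⟩
    rw [omegaSet_iterate]
    exact h.omega x hx

/-- Consecutive closest returns form a close return. -/
theorem WanderingChain.closeReturn (hf : IsUnimodal 2 f c ℓm ℓp) (hc : Continuous f)
    (hr : ∀ x, f x ∈ Icc (0 : ℝ) 1) (h : WanderingChain f c J) (k : ℕ) :
    CloseReturn f c (imgInf f J (closestReturn f c J (k + 1)))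
      (imgSup f J (closestReturn f c J (k + 1))) (imgInf f J (closestReturn f c J (k + 2)))
      (imgSup f J (closestReturn f c J (k + 2)))
      (closestReturn f c J (k + 2) - closestReturn f c J (k + 1)) := by
  have hm := h.closestReturn_strictMono hc
  have hlt : closestReturn f c J (k + 1) < closestReturn f c J (k + 2) := hm (by omega)
  have hlt0 : closestReturn f c J k < closestReturn f c J (k + 1) := hm (by omega)
  have himg : ∀ i, f^[i] '' Icc (imgInf f J (closestReturn f c J (k + 1)))
      (imgSup f J (closestReturn f c J (k + 1))) = f^[i + closestReturn f c J (k + 1)] '' J := by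
    intro i
    rw [← h.image_eq, ← image_comp, ← Function.iterate_add]
  refine ⟨?_, by omega, ?_, h.inf_lt_sup _, h.sup_lt_inf hf hc hr _, h.inf_lt_sup _,
    h.sup_lt hf hr (h.closestReturn_pos hc _), ?_, ?_⟩
  · rw [← h.image_eq]
    exact h.wandering.image hf hc hr _
  · rw [himg, Nat.sub_add_cancel hlt.le, h.image_eq]
  · intro i hi0 hi x hx
    refine h.lt_inf hf hc hr (k + 1) (j := i + closestReturn f c J (k + 1)) (by omega)
      (show _ < closestReturn f c J (k + 2) by omega) (by omega) ?_
    rw [← himg]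
    exact mem_image_of_mem _ hx
  · obtain ⟨x, hx, hxe⟩ := h.exists_Icc (closestReturn f c J k)
    set q := closestReturn f c J (k + 2) - closestReturn f c J (k + 1)
    obtain ⟨y, hy, hya⟩ := h.inf_mem (q + closestReturn f c J k)
    refine ⟨f^[closestReturn f c J k] y, h.image_subset hr _ (mem_image_of_mem _ hy),
      h.lt_inf hf hc hr (k + 1) (h.closestReturn_pos hc k)
        (show _ < closestReturn f c J (k + 2) by omega) (by omega) (mem_image_of_mem _ hy), ?_⟩
    rw [← Function.iterate_add_apply, hya]
    by_cases hq : q + closestReturn f c J k = closestReturn f c J (k + 1)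
    · rw [hq]
    · exact (h.lt_inf hf hc hr (k + 1) (by omega)
        (show _ < closestReturn f c J (k + 2) by omega) hq (h.inf_mem _)).le

/-- The ratio of the distances of the two endpoints of the `n`-th image to the critical value. -/
noncomputable def imgRatio (f : ℝ → ℝ) (c : ℝ) (J : Set ℝ) (n : ℕ) : ℝ :=
  (f c - imgSup f J n) / (f c - imgInf f J n)

theorem exists_small_ratio {K m M L : ℝ} (hK : 0 < K) (hm : 0 < m) (hM : 0 < M) :
    ∃ η₀, 0 < η₀ ∧ ∀ η ≤ η₀, η ≤ 1 / 2 ∧ 8 * K * η ≤ 1 ∧ η * M * 2 ^ L ≤ m ∧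
      8 * K * η * M < m := by
  have h2 : (0 : ℝ) < 2 ^ L := Real.rpow_pos_of_pos (by norm_num) L
  refine ⟨min (1 / 2) (min (1 / (8 * K)) (min (m / (M * 2 ^ L)) (m / (2 * (8 * K * M))))), ?_, ?_⟩
  · positivity
  · intro η hη
    have h3 := hη.trans (min_le_right _ _)
    have h4 := h3.trans (min_le_right _ _)
    have e1 := h3.trans (min_le_left _ _)
    have e2 := h4.trans (min_le_left _ _)
    have e3 := h4.trans (min_le_right _ _)
    rw [le_div_iff₀ (by positivity)] at e1 e2 e3
    exact ⟨hη.trans (min_le_left _ _), by linarith, by linarith, by nlinarith⟩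

theorem WanderingChain.imgRatio_pos (hf : IsUnimodal 2 f c ℓm ℓp)
    (hr : ∀ x, f x ∈ Icc (0 : ℝ) 1) (h : WanderingChain f c J) {n : ℕ} (hn : 0 < n) :
    0 < imgRatio f c J n := by
  have h1 := h.sup_lt hf hr hn
  have h2 := h.inf_lt_sup n
  exact div_pos (by linarith) (by linarith)

theorem WanderingChain.imgRatio_lt_one (hf : IsUnimodal 2 f c ℓm ℓp)
    (hr : ∀ x, f x ∈ Icc (0 : ℝ) 1) (h : WanderingChain f c J) {n : ℕ} (hn : 0 < n) :
    imgRatio f c J n < 1 := by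
  have h1 := h.sup_lt hf hr hn
  have h2 := h.inf_lt_sup n
  rw [imgRatio, div_lt_one (by linarith)]
  linarith

theorem WanderingChain.sub_sup_eq (hf : IsUnimodal 2 f c ℓm ℓp)
    (hr : ∀ x, f x ∈ Icc (0 : ℝ) 1) (h : WanderingChain f c J) {n : ℕ} (hn : 0 < n) :
    f c - imgSup f J n = imgRatio f c J n * (f c - imgInf f J n) := by
  have h1 := h.sup_lt hf hr hn
  have h2 := h.inf_lt_sup n
  rw [imgRatio, div_mul_cancel₀]
  linarith

/-- If `X` and `Y` are the distances to the turning point, then the ratio of the distances of the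
images to the critical value is controlled by a power. -/
theorem ratio_le_of_bounds {u v X Y κ η m M l : ℝ} (hX : 0 < X) (hY : 0 ≤ Y) (hκ : 0 ≤ κ)
    (hη : 0 ≤ η) (hm : 0 < m) (hM : 0 < M) (hl : 0 ≤ l) (hYX : Y ≤ κ * η * X)
    (hu : m * X ^ l ≤ u) (hv : v ≤ M * Y ^ l) : v / u ≤ M / m * κ ^ l * η ^ l := by
  have hXl : 0 < X ^ l := Real.rpow_pos_of_pos hX l
  have hu0 : 0 < u := (mul_pos hm hXl).trans_le hu
  rw [div_le_iff₀ hu0]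
  calc v ≤ M * Y ^ l := hv
    _ ≤ M * (κ * η * X) ^ l := by gcongr
    _ = M / m * κ ^ l * η ^ l * (m * X ^ l) := by
      rw [Real.mul_rpow (by positivity) hX.le, Real.mul_rpow hκ hη]
      field_simp
    _ ≤ M / m * κ ^ l * η ^ l * u := by gcongr

theorem WanderingChain.exists_imgRatio_le (hf : IsUnimodal 2 f c ℓm ℓp) (hc : Continuous f)
    (hr : ∀ x, f x ∈ Icc (0 : ℝ) 1) (h : WanderingChain f c J) :
    ∃ C, 0 < C ∧ ∀ k, imgRatio f c J (closestReturn f c J (k + 2)) ≤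
      C * imgRatio f c J (closestReturn f c J (k + 1)) ^ max ℓp ℓm := by
  obtain ⟨C, m, M, hE⟩ := hf.exists_sideEstimates hr
  have hm := hE.1.m_pos
  have hM := hE.1.M_pos
  set L := max ℓp ℓm with hL
  have hL1 : 1 ≤ L := hf.one_le_right.trans (le_max_left _ _)
  set K := Real.exp (C * 8) with hK
  have hK0 : 0 < K := Real.exp_pos _
  obtain ⟨η₀, hη₀, hsmall⟩ := exists_small_ratio (L := L) hK0 hm hM
  refine ⟨max (M / m * (8 * K) ^ L) (1 / η₀ ^ L), lt_max_of_lt_right (by positivity), fun k => ?_⟩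
  have hpos1 := h.closestReturn_pos hc (k + 1)
  have hpos2 := h.closestReturn_pos hc (k + 2)
  have hη0 := h.imgRatio_pos hf hr hpos1
  set η := imgRatio f c J (closestReturn f c J (k + 1)) with hη
  rcases le_or_gt η η₀ with hle | hgt
  · obtain ⟨h1, h2, h3, h4⟩ := hsmall η hle
    obtain ⟨s, hs, -, hss, X, Y, hX, -, hY, hYX, hlow, hup, -⟩ :=
      (h.closeReturn hf hc hr k).step hf hc hr hE hK (h.sub_sup_eq hf hr hpos1) h1 h2 h3 h4
    rw [sideOrder_eq_max hs hss] at hlow hup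
    refine (ratio_le_of_bounds hX hY (by positivity) hη0.le hm hM (by linarith) hYX hlow
      hup).trans ?_
    gcongr
    exact le_max_left _ _
  · refine (h.imgRatio_lt_one hf hr hpos2).le.trans ?_
    calc (1 : ℝ) = 1 / η₀ ^ L * η₀ ^ L := by field_simp
      _ ≤ max (M / m * (8 * K) ^ L) (1 / η₀ ^ L) * η ^ L := by
        gcongr
        exact le_max_right _ _

end Unimodal

section Unimodal

variable {f : ℝ → ℝ} {c ℓm ℓp : ℝ} {Q : Set ℝ}

/-- If an image of a maximal wandering interval contains the critical value, then it is the interval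
itself, and the critical value is its left endpoint. -/
theorem IsUnimodal.eq_Icc_of_mem_image (hf : IsUnimodal 2 f c ℓm ℓp) (hc : Continuous f)
    (hr : ∀ x, f x ∈ Icc (0 : ℝ) 1) (hQ : Maximal (IsWanderingInterval f) Q) {i : ℕ}
    (hi : f c ∈ f^[i] '' Q) : i = 0 ∧ ∃ d, f c < d ∧ Q = Icc (f c) d := by
  have key : ∀ u w, f^[i] '' Q = Icc u w → f c ≤ u := by
    intro u w himg
    by_contra! hu
    obtain ⟨ε, hε, hball⟩ := Metric.continuousAt_iff.1 (hc.continuousAt (x := c)) (f c - u)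
      (by linarith)
    obtain ⟨j, hj, x, ⟨y, hy, rfl⟩, hx⟩ := hf.exists_image_near_turning hc hr hQ i hε
    have h1 := hball (x := f^[j] y) (by rwa [Real.dist_eq])
    rw [Real.dist_eq, abs_lt] at h1
    have h2 := hf.le_turning (iterate_mem_Icc hr (hQ.1.subset hy) j)
    have h3 : f (f^[j] y) ∈ f^[i] '' Q := by
      rw [himg] at hi ⊢
      exact ⟨by linarith [h1.1], h2.trans hi.2⟩
    refine Set.disjoint_left.1 (hQ.1.disjoint (show i ≠ j + 1 by omega)) h3 ⟨y, hy, ?_⟩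
    rw [Function.iterate_succ_apply']
  obtain ⟨u, hu, w, hw, hlt, himg⟩ := exists_Icc_iterate_of_maximal hf hc hr hQ i
  have h1 := key _ _ himg
  rcases Nat.eq_zero_or_pos i with rfl | hpos
  · refine ⟨rfl, f^[0] w, h1.trans_lt hlt, ?_⟩
    have h2 : f c ∈ Icc (f^[0] u) (f^[0] w) := by rwa [← himg]
    rw [Function.iterate_zero, image_id] at himg
    rw [himg, le_antisymm h1 h2.1]
    rfl
  · exfalso
    have h2 := hf.le_turning (iterate_mem_Icc hr (hQ.1.subset hw) (i - 1))
    rw [← iterate_pred f hpos] at h2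
    linarith

theorem IsUnimodal.wanderingChain (hf : IsUnimodal 2 f c ℓm ℓp) (hc : Continuous f)
    (hr : ∀ x, f x ∈ Icc (0 : ℝ) 1) (hQ : Maximal (IsWanderingInterval f) Q) (N : ℕ)
    (hN : ∀ n, f c ∉ f^[n + N] '' Q) : WanderingChain f c (f^[N] '' Q) := by
  have himg : ∀ n, f^[n] '' (f^[N] '' Q) = f^[n + N] '' Q := fun n => by
    rw [← image_comp, ← Function.iterate_add]
  refine ⟨hQ.1.image hf hc hr N, fun n => ?_, fun n => ?_, fun M δ hδ => ?_⟩
  · obtain ⟨u, hu, w, hw, hlt, h⟩ := exists_Icc_iterate_of_maximal hf hc hr hQ (n + N)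
    rw [Function.iterate_add_apply, Function.iterate_add_apply] at hlt
    rw [Function.iterate_add_apply, Function.iterate_add_apply] at h
    exact ⟨_, mem_image_of_mem _ hu, _, mem_image_of_mem _ hw, hlt, by rw [himg, h]⟩
  · rw [himg]; exact hN n
  · obtain ⟨j, hj, x, hx, hxc⟩ := hf.exists_image_near_turning hc hr hQ (M + N) hδ
    refine ⟨j - N, by omega, x, ?_, hxc⟩
    rw [himg, Nat.sub_add_cancel (by omega)]
    exact hx

theorem iterate_image_image (f : ℝ → ℝ) (A : Set ℝ) (n k : ℕ) :
    f^[n] '' (f^[k] '' A) = f^[n + k] '' A := by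
  rw [← image_comp, ← Function.iterate_add]

/-- The situation in which the critical value is the left endpoint of a maximal wandering
interval. -/
structure BoundaryCase (f : ℝ → ℝ) (c ℓm ℓp d : ℝ) : Prop where
  unimodal : IsUnimodal 2 f c ℓm ℓp
  continuous : Continuous f
  range : ∀ x, f x ∈ Icc (0 : ℝ) 1
  lt : f c < d
  maximal : Maximal (IsWanderingInterval f) (Icc (f c) d)

namespace BoundaryCase

variable {d : ℝ}

theorem notMem (h : BoundaryCase f c ℓm ℓp d) {n : ℕ} (hn : n ≠ 0) :
    f c ∉ f^[n] '' Icc (f c) d := fun h' =>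
  hn (h.unimodal.eq_Icc_of_mem_image h.continuous h.range h.maximal h').1

theorem turning_notMem (h : BoundaryCase f c ℓm ℓp d) (n : ℕ) :
    c ∉ f^[n] '' Icc (f c) d := by
  rintro ⟨x, hx, hxc⟩
  refine h.notMem n.succ_ne_zero ⟨x, hx, ?_⟩
  rw [Function.iterate_succ_apply', hxc]

theorem chain (h : BoundaryCase f c ℓm ℓp d) : WanderingChain f c (f^[2] '' Icc (f c) d) :=
  h.unimodal.wanderingChain h.continuous h.range h.maximal 2 fun n => h.notMem (by omega)

theorem value_mem (h : BoundaryCase f c ℓm ℓp d) : f c ∈ Icc (f c) d := ⟨le_rfl, h.lt.le⟩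

theorem turning_lt (h : BoundaryCase f c ℓm ℓp d) : c < f c := by
  by_contra! hle
  have hcm := h.unimodal.mem
  refine h.maximal.1.omega _ h.value_mem ?_
  refine isPeriodicOrbit_omegaSet_of_monotoneOn h.continuous h.range (p := 1) one_pos
    (A := Icc 0 c) (fun x hx => ?_) ?_ ⟨(h.range c).1, hle⟩ (h.range c)
  · exact ⟨(h.range x).1, (h.unimodal.le_turning ⟨hx.1, hx.2.trans hcm.2.le⟩).trans hle⟩
  · exact h.unimodal.strictMonoOn.monotoneOn

theorem image_value_lt (h : BoundaryCase f c ℓm ℓp d) : f (f c) < c := by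
  by_contra! hle
  have hlt := h.turning_lt
  have hanti : AntitoneOn f (Icc c (f c)) :=
    h.unimodal.strictAntiOn.antitoneOn.mono (Icc_subset_Icc_right (h.range c).2)
  refine h.maximal.1.omega _ h.value_mem ?_
  refine isPeriodicOrbit_omegaSet_of_antitoneOn h.continuous h.range (p := 1) one_pos
    (A := Icc c (f c)) (fun x hx => ?_) hanti ⟨hlt.le, le_rfl⟩ (h.range c)
  exact ⟨hle.trans (hanti hx ⟨hlt.le, le_rfl⟩ hx.2), hanti ⟨le_rfl, hlt.le⟩ hx hx.1⟩

theorem image_value_lt_image (h : BoundaryCase f c ℓm ℓp d) : f (f c) < f (f (f c)) := by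
  by_contra! hle
  have hmono : MonotoneOn f (Icc 0 (f (f c))) :=
    h.unimodal.strictMonoOn.monotoneOn.mono (Icc_subset_Icc_right h.image_value_lt.le)
  refine h.maximal.1.omega _ h.value_mem ?_
  rw [← omegaSet_iterate f 1]
  refine isPeriodicOrbit_omegaSet_of_monotoneOn h.continuous h.range (p := 1) one_pos
    (A := Icc 0 (f (f c))) (fun x hx => ?_) hmono ⟨(h.range _).1, le_rfl⟩ (h.range _)
  exact ⟨(h.range x).1, (hmono hx ⟨(h.range _).1, le_rfl⟩ hx.2).trans hle⟩

theorem mapsTo_core (h : BoundaryCase f c ℓm ℓp d) :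
    MapsTo f (Icc (f (f c)) (f c)) (Icc (f (f c)) (f c)) := by
  intro x hx
  have hcm := h.unimodal.mem
  have hx0 : 0 ≤ x := (h.range _).1.trans hx.1
  have hx1 : x ≤ 1 := hx.2.trans (h.range _).2
  refine ⟨?_, h.unimodal.le_turning ⟨hx0, hx1⟩⟩
  rcases le_total x c with hxc | hxc
  · exact h.image_value_lt_image.le.trans (h.unimodal.strictMonoOn.monotoneOn
      ⟨(h.range _).1, h.image_value_lt.le⟩ ⟨hx0, hxc⟩ hx.1)
  · exact h.unimodal.strictAntiOn.antitoneOn ⟨hxc, hx1⟩ ⟨h.turning_lt.le, (h.range _).2⟩ hx.2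

theorem iterate_value_mem (h : BoundaryCase f c ℓm ℓp d) (n : ℕ) :
    f^[n] (f c) ∈ f^[n] '' Icc (f c) d := mem_image_of_mem _ h.value_mem

theorem mem_core (h : BoundaryCase f c ℓm ℓp d) {n : ℕ} (hn : 2 ≤ n) {x : ℝ}
    (hx : x ∈ f^[n] '' Icc (f c) d) : f (f c) < x ∧ x < f c := by
  have hdisj := h.maximal.1.disjoint
  have hle : ∀ n, 2 ≤ n → ∀ x ∈ f^[n] '' Icc (f c) d,
      x ∈ Icc (f (f c)) (f c) := by
    intro n hn
    induction n, hn using Nat.le_induction with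
    | base =>
      intro x hx
      constructor
      · refine (lt_of_disjoint_ordConnected (ordConnected_image h.continuous ordConnected_Icc 1)
          (ordConnected_image h.continuous ordConnected_Icc 2) (hdisj (by norm_num))
          (h.iterate_value_mem 1) (h.iterate_value_mem 2) h.image_value_lt_image
          (h.iterate_value_mem 1) hx).le
      · obtain ⟨y, hy, rfl⟩ := hx
        rw [Function.iterate_succ_apply']
        exact h.unimodal.le_turning (iterate_mem_Icc h.range (h.maximal.1.subset hy) 1)
    | succ n hn ih =>
      rintro _ ⟨y, hy, rfl⟩
      rw [Function.iterate_succ_apply']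
      exact h.mapsTo_core (ih _ (mem_image_of_mem _ hy))
  obtain ⟨h1, h2⟩ := hle n hn x hx
  refine ⟨lt_of_le_of_ne h1 fun h' => ?_, lt_of_le_of_ne h2 fun h' => ?_⟩
  · exact Set.disjoint_left.1 (hdisj (show 1 ≠ n by omega)) 
      (h.iterate_value_mem 1) (show f (f c) ∈ _ by rwa [h'])
  · exact h.notMem (show n ≠ 0 by omega) (h' ▸ hx)

theorem iterate_value_mem_chain (h : BoundaryCase f c ℓm ℓp d) (n : ℕ) :
    f^[n + 2] (f c) ∈ f^[n] '' (f^[2] '' Icc (f c) d) := by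
  rw [iterate_image_image]
  exact h.iterate_value_mem (n + 2)

end BoundaryCase

theorem WanderingChain.eventually_lt_inf (hf : IsUnimodal 2 f c ℓm ℓp) (hc : Continuous f)
    (hr : ∀ x, f x ∈ Icc (0 : ℝ) 1) {J : Set ℝ} (h : WanderingChain f c J) {y : ℝ} (hy : y < f c) :
    ∀ᶠ k in atTop, y < imgInf f J (closestReturn f c J k) := by
  obtain ⟨ε, hε, hball⟩ := Metric.continuousAt_iff.1 (hc.continuousAt (x := c)) (f c - y)
    (by linarith)
  obtain ⟨j, -, x, ⟨z, hz, rfl⟩, hx⟩ := h.near 0 ε hε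
  have h1 := hball (x := f^[j] z) (by rwa [Real.dist_eq])
  rw [Real.dist_eq, abs_lt] at h1
  have hm := h.closestReturn_strictMono hc
  filter_upwards [eventually_gt_atTop (j + 1)] with k hk
  have hk' : j + 1 < closestReturn f c J k := hk.trans_le (hm.id_le k)
  have h2 := (h.isClosestReturn hc k).2 (j + 1) hk'
  rw [h.infDist_eq hf hr (by omega), h.infDist_eq hf hr (by omega)] at h2
  have h3 : f^[j + 1] z ∈ f^[j + 1] '' J := mem_image_of_mem _ hz
  have h4 := h.lt_of_lt (show j + 1 ≠ closestReturn f c J k by omega) (h.sup_mem _) (h.sup_mem _)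
    (by linarith) h3 (h.inf_mem _)
  rw [Function.iterate_succ_apply'] at h4
  linarith [h1.1]

end Unimodal

theorem not_growth {δ g : ℕ → ℝ} {L B : ℝ} (hL : 1 ≤ L) (hδ : ∀ k, 0 ≤ δ k) (hg0 : 0 < g 0)
    (hg : ∀ k, L * g k ≤ g (k + 1)) (hB : B ≤ L * g 0 / 2)
    (h : ∀ k, δ (k + 1) ≤ L * (δ k - g k) + B) : False := by
  have hgk : ∀ k, g 0 ≤ g k := by
    intro k
    induction k with
    | zero => exact le_rfl
    | succ k ih => nlinarith [hg k]
  have key : ∀ k : ℕ, δ k ≤ (δ 0 / g 0 - k / 2) * g k := by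
    intro k
    induction k with
    | zero => simp [div_mul_cancel₀ _ hg0.ne']
    | succ k ih =>
      have h1 := hgk k
      have h2 : δ (k + 1) ≤ L * ((δ 0 / g 0 - (k + 1 : ℕ) / 2) * g k) := by
        refine (h k).trans ?_
        push_cast
        have : L * g 0 ≤ L * g k := by gcongr
        have : L * (δ k) ≤ L * ((δ 0 / g 0 - k / 2) * g k) := by gcongr
        linarith
      have h3 : 0 ≤ δ 0 / g 0 - (k + 1 : ℕ) / 2 := by
        by_contra! hneg
        have h4 := (hδ (k + 1)).trans h2
        have h5 : (δ 0 / g 0 - (k + 1 : ℕ) / 2) * g k < 0 :=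
          mul_neg_of_neg_of_pos hneg (hg0.trans_le h1)
        nlinarith
      calc δ (k + 1) ≤ L * ((δ 0 / g 0 - (k + 1 : ℕ) / 2) * g k) := h2
        _ = (δ 0 / g 0 - (k + 1 : ℕ) / 2) * (L * g k) := by ring
        _ ≤ _ := by gcongr; exact hg k
  obtain ⟨k, hk⟩ := exists_nat_gt (2 * (δ 0 / g 0))
  have h1 := (hδ k).trans (key k)
  have h2 : (δ 0 / g 0 - k / 2) * g k < 0 :=
    mul_neg_of_neg_of_pos (by linarith) (hg0.trans_le (hgk k))
  linarith

/-- Ratios and distances related by the two inequalities cannot start from a small ratio. -/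
theorem exists_not_small {L C₂ C₃ m : ℝ} (hL : 1 < L) (hC₂ : 1 ≤ C₂) (hC₃ : 0 < C₃) (hm : 0 < m) :
    ∃ ε, 0 < ε ∧ ∀ η D : ℕ → ℝ, (∀ k, 0 < η k) → (∀ k, 0 < D k) → (∀ k, D k ≤ 1) →
      (∀ k, η (k + 1) ≤ C₂ * η k ^ L) →
      (∀ k, ∃ X, 0 < X ∧ D k ≤ C₃ * η k * X ∧ m * X ^ L ≤ D (k + 1)) → ε < η 0 := by
  set B := L * Real.log C₃ - Real.log m with hB
  set e := Real.log C₂ / (L - 1) with he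
  have hL1 : 0 < L - 1 := by linarith
  have he0 : 0 ≤ e := div_nonneg (Real.log_nonneg hC₂) hL1.le
  have heq : Real.log C₂ = e * (L - 1) := (div_mul_cancel₀ _ hL1.ne').symm
  refine ⟨Real.exp (-(e + 1 + 2 * |B|)), Real.exp_pos _, fun η D hη hD hD1 hηη hDD => ?_⟩
  by_contra! hsmall
  have hlog : e + 1 + 2 * |B| ≤ -Real.log (η 0) := by
    have := Real.log_le_log (hη 0) hsmall
    rw [Real.log_exp] at this
    linarith
  refine not_growth (δ := fun k => -Real.log (D k)) (g := fun k => -Real.log (η k) - e)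
    (L := L) (B := B) hL.le (fun k => ?_) ?_ (fun k => ?_) ?_ (fun k => ?_)
  · have := Real.log_nonpos (hD k).le (hD1 k)
    linarith
  · have := abs_nonneg B
    linarith
  · have h1 := Real.log_le_log (hη (k + 1)) (hηη k)
    rw [Real.log_mul (by positivity) (Real.rpow_pos_of_pos (hη k) L).ne',
      Real.log_rpow (hη k), heq] at h1
    linarith
  · have h1 := le_abs_self B
    have h2 := abs_nonneg B
    nlinarith
  · obtain ⟨X, hX, h1, h2⟩ := hDD k
    have h3 := Real.log_le_log (hD k) h1
    have hηk := hη k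
    rw [Real.log_mul (by positivity) hX.ne', Real.log_mul hC₃.ne' hηk.ne'] at h3
    have h4 := Real.log_le_log (mul_pos hm (Real.rpow_pos_of_pos hX L)) h2
    rw [Real.log_mul hm.ne' (Real.rpow_pos_of_pos hX L).ne', Real.log_rpow hX] at h4
    nlinarith

theorem exists_le_of_eventually {ρ : ℕ → ℝ} (hρ : ∀ k, 0 < ρ k) {N : ℕ} {ε : ℝ} (hε : 0 < ε)
    (h : ∀ k, N ≤ k → ε ≤ ρ k) : ∃ ε', 0 < ε' ∧ ∀ k, ε' ≤ ρ k := by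
  obtain ⟨j, -, hj⟩ := Finset.exists_min_image (Finset.range (N + 1)) ρ ⟨0, by simp⟩
  refine ⟨min ε (ρ j), lt_min hε (hρ j), fun k => ?_⟩
  rcases le_total N k with hk | hk
  · exact (min_le_left _ _).trans (h k hk)
  · exact (min_le_right _ _).trans (hj k (Finset.mem_range.2 (by omega)))

section Unimodal

variable {f : ℝ → ℝ} {c ℓm ℓp d : ℝ}

theorem BoundaryCase.exists_le_imgRatio (h : BoundaryCase f c ℓm ℓp d) :
    ∃ η₁, 0 < η₁ ∧ ∀ k, η₁ ≤ imgRatio f c (f^[2] '' Icc (f c) d)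
      (closestReturn f c (f^[2] '' Icc (f c) d) k) := by
  have hf := h.unimodal
  have hc := h.continuous
  have hr := h.range
  have hJ := h.chain
  set J := f^[2] '' Icc (f c) d with hJdef
  set t := closestReturn f c J with ht
  have htpos : ∀ k, 0 < t k := hJ.closestReturn_pos hc
  have htm : StrictMono t := hJ.closestReturn_strictMono hc
  have hρ0 : ∀ k, 0 < imgRatio f c J (t k) := fun k => hJ.imgRatio_pos hf hr (htpos k)
  obtain ⟨C, m, M, hE⟩ := hf.exists_sideEstimates hr
  have hm := hE.1.m_pos
  have hM := hE.1.M_pos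
  set L := max ℓp ℓm with hL
  set K := Real.exp (C * 8) with hK
  have hK0 : 0 < K := Real.exp_pos _
  obtain ⟨η₀, hη₀, hsmall⟩ := exists_small_ratio (L := L) hK0 hm hM
  have hstep : ∀ j, imgRatio f c J (t (j + 1)) ≤ η₀ → _ := fun j hj =>
    (hJ.closeReturn hf hc hr j).step hf hc hr hE hK (hJ.sub_sup_eq hf hr (htpos (j + 1)))
      (hsmall _ hj).1 (hsmall _ hj).2.1 (hsmall _ hj).2.2.1 (hsmall _ hj).2.2.2
  -- the first two images lie far from the critical value
  obtain ⟨N, hN⟩ := eventually_atTop.1 ((hJ.eventually_lt_inf hf hc hr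
    (h.image_value_lt.trans h.turning_lt)).and
    (hJ.eventually_lt_inf hf hc hr (h.mem_core le_rfl (h.iterate_value_mem 2)).2))
  have hkey : ∀ j, N ≤ j → imgRatio f c J (t (j + 1)) ≤ η₀ → imgRatio f c J (t (j + 2)) ≤ η₀ →
      1 < L ∧ ∃ X, 0 < X ∧ f c - imgInf f J (t (j + 2)) ≤
        M * (8 * K) * imgRatio f c J (t (j + 2)) * X ∧
        m * X ^ L ≤ f c - imgInf f J (t (j + 3)) := by
    intro j hj h1 h2
    obtain ⟨s', hs', hpos', hss', -⟩ := hstep j h1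
    obtain ⟨s, hs, -, hss, X, Y, hX, hX1, -, -, hlow, -, hAB⟩ := hstep (j + 1) h2
    have hLs := sideOrder_eq_max hs hss
    have hone := hf.one_le_sideOrder (-s)
    refine ⟨by rw [hL, ← hLs]; linarith, X, hX, ?_, by rw [hLs] at hlow; exact hlow⟩
    have heq : s' = s := by
      rcases hs with rfl | rfl <;> rcases hs' with rfl | rfl
      · rfl
      · rw [neg_neg] at hss'
        linarith
      · rw [neg_neg] at hss
        linarith
      · rfl
    subst heq
    set q := t (j + 2) - t (j + 1) with hq
    have htj : t (j + 1) < t (j + 2) := htm (by omega)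
    have htj' : t (j + 2) < t (j + 3) := htm (by omega)
    rcases hAB with hA | ⟨hB, hB'⟩
    · refine hA.trans ?_
      have hη2 := (hsmall _ h2).2.1
      have hηpos := hρ0 (j + 2)
      have hle1 : 8 * K * imgRatio f c J (t (j + 2)) * X ≤ 1 := by
        calc 8 * K * imgRatio f c J (t (j + 2)) * X ≤ 1 * 1 := by gcongr
          _ = 1 := one_mul 1
      calc M * (8 * K * imgRatio f c J (t (j + 2)) * X) ^ sideOrder ℓm ℓp (-s')
          ≤ M * (8 * K * imgRatio f c J (t (j + 2)) * X) ^ (1 : ℝ) := by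
            gcongr ?_ * ?_
            exact Real.rpow_le_rpow_of_exponent_ge (by positivity) hle1 hone
        _ = M * (8 * K) * imgRatio f c J (t (j + 2)) * X := by rw [Real.rpow_one]; ring
    · exfalso
      have hB2 : imgInf f J (t (j + 2)) <
          f^[t (j + 3) - t (j + 2)] (f c) := hB'
      have hB1 : s' * (f^[t (j + 3) - t (j + 2) - 1] (f c) - c) < 0 := hB
      have hNj := hN (j + 2) (by omega)
      obtain ⟨p, hp⟩ : ∃ p, p = t (j + 3) - t (j + 2) := ⟨_, rfl⟩
      rw [← hp] at hB1 hB2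
      obtain hp1 | hp2 | hp3 : p = 1 ∨ p = 2 ∨ 3 ≤ p := by omega
      · subst hp1
        have : f^[1] (f c) = f (f c) := rfl
        linarith [hNj.1]
      · subst hp2
        linarith [hNj.2]
      · have hmem : f^[p] (f c) ∈ f^[p - 2] '' J := by
          have := h.iterate_value_mem_chain (p - 2)
          rwa [Nat.sub_add_cancel (by omega)] at this
        by_cases hpt : p - 2 = t (j + 2)
        · have hmem' : f^[p - 1] (f c) ∈
              f^[q - 1] '' Icc (imgInf f J (t (j + 1))) (imgSup f J (t (j + 1))) := by
            rw [← hJ.image_eq, iterate_image_image, hJdef, iterate_image_image]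
            rw [show q - 1 + t (j + 1) + 2 = p - 1 by omega]
            exact h.iterate_value_mem (p - 1)
          obtain ⟨x, hx, hxe⟩ := hmem'
          have h3 := hpos' x hx
          have h4 : f^[q - 1] x = f^[p - 1] (f c) := hxe
          rw [h4] at h3
          linarith
        · have h3 := hJ.lt_inf hf hc hr (j + 2) (j := p - 2) (by omega)
            (show p - 2 < t (j + 3) by omega) hpt hmem
          have h4 : f^[p] (f c) < imgInf f J (t (j + 2)) := h3
          linarith
  obtain ⟨C₂, hC₂, hC₂le⟩ := hJ.exists_imgRatio_le hf hc hr
  by_cases hL1 : 1 < L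
  swap
  · refine exists_le_of_eventually hρ0 (N := 1) hη₀ fun k hk => ?_
    by_contra! hlt
    obtain ⟨j, rfl⟩ := Nat.exists_eq_succ_of_ne_zero (show k ≠ 0 by omega)
    obtain ⟨s, hs, -, hss, -⟩ := hstep j hlt.le
    rw [sideOrder_eq_max hs hss] at hss
    exact hL1 ((hf.one_le_sideOrder _).trans_lt hss)
  set C₂' := max C₂ 1 with hC₂'
  have hC₂'1 : 1 ≤ C₂' := le_max_right _ _
  have hrec : ∀ k, imgRatio f c J (t (k + 2)) ≤ C₂' * imgRatio f c J (t (k + 1)) ^ L := by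
    intro k
    refine (hC₂le k).trans ?_
    have := hρ0 (k + 1)
    gcongr
    exact le_max_left _ _
  obtain ⟨ε₁, hε₁, hnot⟩ := exists_not_small (C₃ := M * (8 * K)) (m := m) hL1 hC₂'1
    (by positivity) hm
  -- below this threshold the ratios decrease
  obtain ⟨ε, hε, hεη, hεε, hεL⟩ : ∃ ε, 0 < ε ∧ ε ≤ η₀ ∧ ε ≤ ε₁ ∧ C₂' * ε ^ (L - 1) ≤ 1 := by
    have h1 : Tendsto (fun ε : ℝ => C₂' * ε ^ (L - 1)) (𝓝 0) (𝓝 (C₂' * 0 ^ (L - 1))) :=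
      ((Real.continuousAt_rpow_const 0 (L - 1) (Or.inr (by linarith))).tendsto).const_mul _
    rw [Real.zero_rpow (by linarith), mul_zero] at h1
    have h2 := (h1.eventually_lt_const one_pos).filter_mono (nhdsWithin_le_nhds (s := Ioi 0))
    have h3 : ∀ᶠ ε : ℝ in 𝓝[>] 0, ε < min η₀ ε₁ :=
      (eventually_lt_nhds (lt_min hη₀ hε₁)).filter_mono nhdsWithin_le_nhds
    obtain ⟨ε, ⟨h4, h5⟩, h6⟩ := ((h2.and h3).and self_mem_nhdsWithin).exists
    exact ⟨ε, h6, (h5.le.trans (min_le_left _ _)), (h5.le.trans (min_le_right _ _)), h4.le⟩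
  refine exists_le_of_eventually hρ0 (N := N + 1) hε fun k hk => ?_
  by_contra! hlt
  obtain ⟨j, rfl⟩ : ∃ j, k = j + 1 := ⟨k - 1, by omega⟩
  have hall : ∀ i, imgRatio f c J (t (j + 1 + i)) ≤ ε := by
    intro i
    induction i with
    | zero => exact hlt.le
    | succ i ih =>
      have h1 : imgRatio f c J (t (j + 1 + (i + 1))) ≤
          C₂' * imgRatio f c J (t (j + 1 + i)) ^ L := by
        have := hrec (j + i)
        rwa [show j + i + 2 = j + 1 + (i + 1) by omega, show j + i + 1 = j + 1 + i by omega] at this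
      have h2 := hρ0 (j + 1 + i)
      refine h1.trans ?_
      calc C₂' * imgRatio f c J (t (j + 1 + i)) ^ L ≤ C₂' * ε ^ L := by gcongr
        _ = C₂' * ε ^ (L - 1) * ε := by
          rw [Real.rpow_sub_one hε.ne']
          field_simp
        _ ≤ 1 * ε := by gcongr
        _ = ε := one_mul ε
  have hfin := hnot (fun i => imgRatio f c J (t (j + 2 + i)))
    (fun i => f c - imgInf f J (t (j + 2 + i))) (fun i => hρ0 _) (fun i => ?_) (fun i => ?_)
    (fun i => ?_) (fun i => ?_)
  · have h1 := hall 1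
    simp only [add_zero] at hfin
    rw [show j + 1 + 1 = j + 2 by omega] at h1
    linarith
  · have h1 := hJ.sup_lt hf hr (htpos (j + 2 + i))
    have h2 := hJ.inf_lt_sup (t (j + 2 + i))
    linarith
  · have h1 := (hJ.image_subset hr _ (hJ.inf_mem (t (j + 2 + i)))).1
    linarith [(hr c).2]
  · have := hrec (j + 1 + i)
    rw [show j + 1 + i + 2 = j + 2 + (i + 1) by omega,
      show j + 1 + i + 1 = j + 2 + i by omega] at this
    exact this
  · have h1 := hall i
    have h2 := hall (i + 1)
    have := (hkey (j + i) (by omega) ?_ ?_).2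
    · obtain ⟨X, hX, h3, h4⟩ := this
      rw [show j + i + 2 = j + 2 + i by omega] at h3
      rw [show j + i + 3 = j + 2 + (i + 1) by omega] at h4
      exact ⟨X, hX, h3, h4⟩
    · rw [show j + i + 1 = j + 1 + i by omega]
      exact h1.trans hεη
    · rw [show j + i + 2 = j + 1 + (i + 1) by omega]
      exact h2.trans hεη

end Unimodal

/-- Three consecutive closest returns `n₀ < n₁ < n₂` of the wandering interval `Icc (f c) d`, together
with the endpoints of the corresponding images. -/
structure ConsecutiveReturns (f : ℝ → ℝ) (c d : ℝ) (n₀ n₁ n₂ : ℕ) (a₀ b₀ a₁ b₁ a₂ b₂ : ℝ) :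
    Prop where
  two_le : 2 ≤ n₀
  lt₀₁ : n₀ < n₁
  lt₁₂ : n₁ < n₂
  image₀ : f^[n₀] '' Icc (f c) d = Icc a₀ b₀
  image₁ : f^[n₁] '' Icc (f c) d = Icc a₁ b₁
  image₂ : f^[n₂] '' Icc (f c) d = Icc a₂ b₂
  ab₀ : a₀ < b₀
  ba₁ : b₀ < a₁
  ab₁ : a₁ < b₁
  ba₂ : b₁ < a₂
  ab₂ : a₂ < b₂
  below₀ : ∀ j, 2 ≤ j → j < n₁ → j ≠ n₀ → ∀ x ∈ f^[j] '' Icc (f c) d, x < a₀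
  below₁ : ∀ j, 2 ≤ j → j < n₂ → j ≠ n₁ → ∀ x ∈ f^[j] '' Icc (f c) d, x < a₁

section Unimodal

variable {f : ℝ → ℝ} {c ℓm ℓp d : ℝ} {n₀ n₁ n₂ : ℕ} {a₀ b₀ a₁ b₁ a₂ b₂ : ℝ}

/-- Suppose that the second image of the wandering interval is contained in an interval `T` on which
the iterate of order `n₁ - 2` is monotone and takes values between `a₀` and `ρ`. Then the images of
`T` contain no images of the wandering interval other than their own. -/
theorem ConsecutiveReturns.not_subset (h : BoundaryCase f c ℓm ℓp d)
    (H : ConsecutiveReturns f c d n₀ n₁ n₂ a₀ b₀ a₁ b₁ a₂ b₂) {T : Set ℝ} {ρ : ℝ}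
    (hT : T ⊆ Icc 0 1) (hTo : T.OrdConnected) (hQT : f^[2] '' Icc (f c) d ⊆ T)
    (hcT : ∀ l < n₁ - 2, c ∉ f^[l] '' T) (hTY : f^[n₁ - 2] '' T ⊆ Ioo a₀ ρ)
    (hρ : ρ ≤ b₂ ∨ n₂ - n₁ ≠ n₁ - n₀) {i j : ℕ} (hi : 2 ≤ i) (hi' : i ≤ n₁) (hj : 2 ≤ j)
    (hj' : j ≤ n₁) (hij : i ≠ j) :
    ¬ f^[j] '' Icc (f c) d ⊆ f^[i - 2] '' T := by
  have h2 := H.two_le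
  have h01 := H.lt₀₁
  have h12 := H.lt₁₂
  have hm₀ : a₀ ∈ f^[n₀] '' Icc (f c) d := by rw [H.image₀]; exact ⟨le_rfl, H.ab₀.le⟩
  have hm₁ : a₁ ∈ f^[n₁] '' Icc (f c) d := by rw [H.image₁]; exact ⟨le_rfl, H.ab₁.le⟩
  have hm₁' : b₁ ∈ f^[n₁] '' Icc (f c) d := by rw [H.image₁]; exact ⟨H.ab₁.le, le_rfl⟩
  have hmap : ∀ {i m : ℕ} {A : Set ℝ}, 2 ≤ i → A ⊆ f^[i - 2] '' T →
      f^[m] '' A ⊆ f^[i + m - 2] '' T := by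
    intro i m A hi hA
    refine (image_mono hA).trans ?_
    rw [iterate_image_image, show m + (i - 2) = i + m - 2 by omega]
  have hown : ∀ i, 2 ≤ i → f^[i] '' Icc (f c) d ⊆ f^[i - 2] '' T := by
    intro i hi
    have := image_mono (f := f^[i - 2]) hQT
    rwa [iterate_image_image, Nat.sub_add_cancel hi] at this
  have hTi : ∀ i, (f^[i - 2] '' T).OrdConnected := fun i => ordConnected_image h.continuous hTo _
  -- earlier images
  have hearly : ∀ i j, 2 ≤ j → j < i → i ≤ n₁ → ¬ f^[j] '' Icc (f c) d ⊆ f^[i - 2] '' T := by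
    intro i j hj hji hi hsub
    have h3 := (hmap (m := n₁ - i) (by omega) hsub).trans
      ((show i + (n₁ - i) - 2 = n₁ - 2 by omega) ▸ hTY)
    rw [iterate_image_image] at h3
    by_cases hm : n₁ - i + j = n₀
    · rw [hm] at h3
      exact lt_irrefl _ (h3 hm₀).1
    · have h4 := h.iterate_value_mem (n₁ - i + j)
      exact absurd (h3 h4).1 (not_lt.2 (H.below₀ _ (by omega) (by omega) hm _ h4).le)
  -- the last image
  have hlast : ∀ p, 0 < p → p + 2 ≤ n₁ → ¬ f^[n₁] '' Icc (f c) d ⊆ f^[n₁ - p - 2] '' T := by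
    intro p
    induction p using Nat.strong_induction_on with
    | _ p ih =>
      intro hp hp2 hsub
      have hQ0 : n₁ - p ≠ n₀ → f^[n₀] '' Icc (f c) d ⊆ f^[n₁ - p - 2] '' T := by
        intro hne
        have h4 := h.iterate_value_mem (n₁ - p)
        have h5 := H.below₀ (n₁ - p) (by omega) (by omega) hne _ h4
        rw [H.image₀]
        refine Subset.trans ?_ ((hTi _).out (hown (n₁ - p) (by omega) h4) (hsub hm₁))
        exact Icc_subset_Icc h5.le H.ba₁.le
      rcases lt_trichotomy (n₁ - p) n₀ with hlt | heq | hgt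
      · refine ih (p - (n₁ - n₀)) (by omega) (by omega) (by omega) ?_
        have := hmap (m := n₁ - n₀) (by omega) (hQ0 hlt.ne)
        rw [iterate_image_image, Nat.sub_add_cancel h01.le] at this
        rwa [show n₁ - p + (n₁ - n₀) - 2 = n₁ - (p - (n₁ - n₀)) - 2 by omega] at this
      · rw [heq] at hsub
        obtain ⟨q, hq⟩ : ∃ q, q = n₁ - n₀ := ⟨_, rfl⟩
        have hq0 : 0 < q := by omega
        have hHT : Icc a₀ b₁ ⊆ f^[n₀ - 2] '' T := (hTi n₀).out (hown n₀ h2 hm₀) (hsub hm₁')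
        have hab : a₀ < b₁ := by linarith [H.ab₀, H.ba₁, H.ab₁]
        have hI : f^[n₀ - 2] '' T ⊆ Icc 0 1 := image_iterate_subset_Icc h.range hT _
        have hmaps : ∀ z ∈ Icc a₀ b₁, f^[q] z ∈ Ioo a₀ ρ := by
          intro z hz
          have := hmap (m := q) h2 hHT (mem_image_of_mem _ hz)
          rw [show n₀ + q - 2 = n₁ - 2 by omega] at this
          exact hTY this
        have hQ01 : ∀ x ∈ f^[n₀] '' Icc (f c) d, f^[q] x ∈ f^[n₁] '' Icc (f c) d := by
          intro x hx
          have := mem_image_of_mem f^[q] hx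
          rwa [iterate_image_image, show q + n₀ = n₁ by omega] at this
        have hmono := h.unimodal.strictMonoOn_or_strictAntiOn_iterate h.continuous h.range
          (hHT.trans hI) ordConnected_Icc q (fun l hl hcl => by
            have := hmap (m := l) h2 hHT hcl
            exact hcT (n₀ + l - 2) (by omega) this)
        have ha : a₀ ∈ Icc a₀ b₁ := ⟨le_rfl, hab.le⟩
        have hb : b₁ ∈ Icc a₀ b₁ := ⟨hab.le, le_rfl⟩
        have hFa := hQ01 a₀ hm₀
        rw [H.image₁] at hFa
        rcases hmono with hmono | hanti
        · have hFb : f^[q] b₁ ∈ f^[q + n₁] '' Icc (f c) d := by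
            rw [← iterate_image_image]
            exact mem_image_of_mem _ hm₁'
          have hFab := hmono ha hb hab
          have hle : n₂ ≤ q + n₁ := by
            by_contra! hlt
            have := H.below₁ (q + n₁) (by omega) hlt (by omega) _ hFb
            linarith [hFa.1]
          rcases hle.eq_or_lt with heq' | hlt
          · rcases hρ with hρ | hρ
            · have h5 : f^[q] '' (f^[n₁] '' Icc (f c) d) ⊆ Ioo a₀ ρ := by
                rintro _ ⟨z, hz, rfl⟩
                rw [H.image₁] at hz
                exact hmaps z ⟨by linarith [hz.1, H.ab₀, H.ba₁], hz.2⟩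
              rw [iterate_image_image, ← heq', H.image₂] at h5
              exact absurd (h5 ⟨H.ab₂.le, le_rfl⟩).2 (not_lt.2 hρ)
            · exact hρ (by omega)
          · obtain ⟨i, hi⟩ : ∃ i, i = n₂ - n₁ := ⟨_, rfl⟩
            have h5 : f^[i] a₀ ∈ f^[i + n₀] '' Icc (f c) d := by
              rw [← iterate_image_image]; exact mem_image_of_mem _ hm₀
            have h6 : f^[i] b₁ ∈ f^[n₂] '' Icc (f c) d := by
              rw [show n₂ = i + n₁ by omega, ← iterate_image_image]; exact mem_image_of_mem _ hm₁'
            rw [H.image₂] at h6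
            have h7 := H.below₀ _ (by omega) (by omega) (by omega) _ h5
            have h8 : a₀ ∈ f^[i] '' Icc a₀ b₁ :=
              (ordConnected_image h.continuous ordConnected_Icc i).out (mem_image_of_mem _ ha)
                (mem_image_of_mem _ hb) ⟨h7.le, by linarith [h6.1, H.ba₂]⟩
            obtain ⟨z, hz, hza⟩ := h8
            have h9 := hmaps z hz
            rw [show q = (q - i) + i by omega, Function.iterate_add_apply, hza] at h9
            have h10 : f^[q - i] a₀ ∈ f^[q - i + n₀] '' Icc (f c) d := by
              rw [← iterate_image_image]; exact mem_image_of_mem _ hm₀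
            exact absurd h9.1
              (not_lt.2 (H.below₀ _ (by omega) (by omega) (by omega) _ h10).le)
        · obtain ⟨x, hx, hxa⟩ := hm₀
          refine h.maximal.1.omega x hx ?_
          rw [← omegaSet_iterate f n₀, hxa]
          refine isPeriodicOrbit_omegaSet_of_antitoneOn h.continuous h.range hq0
            (A := Icc a₀ b₁) (fun z hz => ⟨(hmaps z hz).1.le, ?_⟩) hanti.antitoneOn ha
            (hI (hHT ha))
          exact (hanti.antitoneOn ha hz hz.1).trans hFa.2
      · exact hearly (n₁ - p) n₀ h2 hgt (by omega) (hQ0 hgt.ne')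
  rcases lt_or_gt_of_ne hij with hlt | hgt
  · intro hsub
    refine hlast (j - i) (by omega) (by omega) ?_
    have := hmap (m := n₁ - j) hi hsub
    rw [iterate_image_image, Nat.sub_add_cancel hj'] at this
    rwa [show i + (n₁ - j) - 2 = n₁ - (j - i) - 2 by omega] at this
  · exact hearly i j hj hgt hi'

end Unimodal

/-- `Ioo τ₁ τ₂` is a maximal interval around the second image of `Icc (f c) d` on which the iterate of
order `n₁ - 2` is monotone and takes values between `a₀` and `ρ`. -/
structure Pullback (f : ℝ → ℝ) (c d : ℝ) (n₀ n₁ : ℕ) (a₀ ρ τ₁ τ₂ : ℝ) : Prop where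
  subset_core : Icc τ₁ τ₂ ⊆ Icc (f (f c)) (f c)
  image_subset : f^[2] '' Icc (f c) d ⊆ Ioo τ₁ τ₂
  notMem : ∀ l < n₁ - 2, c ∉ f^[l] '' Ioo τ₁ τ₂
  mapsTo : f^[n₁ - 2] '' Ioo τ₁ τ₂ ⊆ Ioo a₀ ρ
  end_left : f^[n₁ - 2] τ₁ = ρ ∨ f^[n₁ - 2] τ₁ = a₀ ∨ f^[n₁ - n₀ - 2] τ₁ = f c
  end_right : f^[n₁ - 2] τ₂ = ρ ∨ f^[n₁ - 2] τ₂ = a₀ ∨ f^[n₁ - n₀ - 2] τ₂ = f c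

section Unimodal

variable {f : ℝ → ℝ} {c ℓm ℓp d : ℝ} {n₀ n₁ n₂ : ℕ} {a₀ b₀ a₁ b₁ a₂ b₂ ρ τ₁ τ₂ : ℝ}

theorem Pullback.lt (h : BoundaryCase f c ℓm ℓp d) (P : Pullback f c d n₀ n₁ a₀ ρ τ₁ τ₂) :
    τ₁ < τ₂ := by
  have := P.image_subset (h.iterate_value_mem 2)
  exact this.1.trans this.2

theorem Pullback.subset_Icc (h : BoundaryCase f c ℓm ℓp d)
    (P : Pullback f c d n₀ n₁ a₀ ρ τ₁ τ₂) : Icc τ₁ τ₂ ⊆ Icc 0 1 :=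
  P.subset_core.trans (Icc_subset_Icc (h.range _).1 (h.range _).2)

theorem ConsecutiveReturns.end_value (h : BoundaryCase f c ℓm ℓp d)
    (H : ConsecutiveReturns f c d n₀ n₁ n₂ a₀ b₀ a₁ b₁ a₂ b₂) (hρ : ρ ≤ f c) {τ : ℝ}
    (hτ : f^[n₁ - 2] τ ∈ Icc a₀ ρ)
    (hbad : (∃ l ∈ Finset.range (n₁ - 2), f^[l] τ = c) ∨ f^[n₁ - 2] τ ≤ a₀ ∨ ρ ≤ f^[n₁ - 2] τ) :
    f^[n₁ - 2] τ = ρ ∨ f^[n₁ - 2] τ = a₀ ∨ f^[n₁ - n₀ - 2] τ = f c := by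
  rcases hbad with ⟨l, hl, hlc⟩ | h1 | h1
  · have hl' := Finset.mem_range.1 hl
    have h1 : f^[l + 1] τ = f c := by rw [Function.iterate_succ_apply', hlc]
    obtain ⟨m, hm⟩ : ∃ m, n₁ - 2 = m + (l + 1) := ⟨n₁ - 2 - (l + 1), by omega⟩
    have h2 : f^[n₁ - 2] τ = f^[m] (f c) := by rw [hm, Function.iterate_add_apply, h1]
    rw [h2] at hτ ⊢
    by_cases hmn : m = n₀
    · right; right
      rw [show n₁ - n₀ - 2 = l + 1 by omega, h1]
    obtain rfl | rfl | hm2 : m = 0 ∨ m = 1 ∨ 2 ≤ m := by omega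
    · left
      exact le_antisymm hτ.2 hρ
    · have h3 : a₀ ∈ f^[n₀] '' Icc (f c) d := by rw [H.image₀]; exact ⟨le_rfl, H.ab₀.le⟩
      have h4 := (h.mem_core H.two_le h3).1
      exact absurd hτ.1 (not_le.2 h4)
    · exact absurd hτ.1 (not_le.2 (H.below₀ m hm2 (by omega) hmn _ (h.iterate_value_mem m)))
  · exact Or.inr (Or.inl (le_antisymm h1 hτ.1))
  · exact Or.inl (le_antisymm hτ.2 h1)

theorem ConsecutiveReturns.exists_pullback (h : BoundaryCase f c ℓm ℓp d)
    (H : ConsecutiveReturns f c d n₀ n₁ n₂ a₀ b₀ a₁ b₁ a₂ b₂) (hq : n₀ + 3 ≤ n₁)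
    (hbρ : b₁ < ρ) (hρ : ρ ≤ f c) :
    ∃ τ₁ τ₂, Pullback f c d n₀ n₁ a₀ ρ τ₁ τ₂ := by
  have hn₀ := H.two_le
  set Bad : Set ℝ := {z | (∃ l ∈ Finset.range (n₁ - 2), f^[l] z = c) ∨ f^[n₁ - 2] z ≤ a₀ ∨
    ρ ≤ f^[n₁ - 2] z} with hBad
  have hclosed : IsClosed Bad := by
    have h1 : Bad = (⋃ l ∈ Finset.range (n₁ - 2), f^[l] ⁻¹' {c}) ∪
        (f^[n₁ - 2] ⁻¹' Iic a₀ ∪ f^[n₁ - 2] ⁻¹' Ici ρ) := by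
      ext z
      simp [hBad]
    rw [h1]
    refine (isClosed_biUnion_finset fun l _ => ?_).union ((isClosed_Iic.preimage ?_).union
      (isClosed_Ici.preimage ?_))
    · exact isClosed_singleton.preimage (h.continuous.iterate l)
    · exact h.continuous.iterate _
    · exact h.continuous.iterate _
  obtain ⟨y, hy, x, hx, hlt, himg⟩ := exists_Icc_iterate_of_maximal h.unimodal h.continuous
    h.range h.maximal 2
  set u := f^[2] y
  set w := f^[2] x
  have hu := (h.mem_core le_rfl (mem_image_of_mem f^[2] hy))
  have hw := (h.mem_core le_rfl (mem_image_of_mem f^[2] hx))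
  have hgood : ∀ z ∈ Icc u w, z ∉ Bad := by
    intro z hz
    rw [← himg] at hz
    rintro (⟨l, hl, hlc⟩ | hbad)
    · refine h.turning_notMem (l + 2) ?_
      rw [← iterate_image_image]
      exact ⟨z, hz, hlc⟩
    · have h1 : f^[n₁ - 2] z ∈ f^[n₁ - 2 + 2] '' Icc (f c) d := by
        rw [← iterate_image_image]
        exact mem_image_of_mem _ hz
      rw [show n₁ - 2 + 2 = n₁ by omega, H.image₁] at h1
      rcases hbad with h2 | h2
      · linarith [h1.1, H.ba₁, H.ab₀]
      · linarith [h1.2]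
  have hbad_right : f c ∈ Bad := Or.inr (Or.inl
    (H.below₀ (n₁ - 2) (by omega) (by omega) (by omega) _ (h.iterate_value_mem _)).le)
  have hbad_left : f (f c) ∈ Bad := by
    refine Or.inr (Or.inl ?_)
    have h1 : f^[n₁ - 2] (f (f c)) = f^[n₁ - 1] (f c) := by
      rw [show n₁ - 1 = n₁ - 2 + 1 by omega, Function.iterate_succ_apply]
    rw [h1]
    exact (H.below₀ (n₁ - 1) (by omega) (by omega) (by omega) _ (h.iterate_value_mem _)).le
  obtain ⟨τ₂, ⟨hτ₂, hbad₂⟩, hleast⟩ : ∃ τ, IsLeast (Icc w (f c) ∩ Bad) τ :=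
    ⟨_, (isCompact_Icc.inter_right hclosed).isLeast_sInf ⟨f c, ⟨hw.2.le, le_rfl⟩, hbad_right⟩⟩
  obtain ⟨τ₁, ⟨hτ₁, hbad₁⟩, hgreatest⟩ : ∃ τ, IsGreatest (Icc (f (f c)) u ∩ Bad) τ :=
    ⟨_, (isCompact_Icc.inter_right hclosed).isGreatest_sSup
      ⟨f (f c), ⟨le_rfl, hu.1.le⟩, hbad_left⟩⟩
  have hwτ : w < τ₂ := lt_of_le_of_ne hτ₂.1 fun h' =>
    hgood w ⟨hlt.le, le_rfl⟩ (h' ▸ hbad₂)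
  have hτu : τ₁ < u := lt_of_le_of_ne hτ₁.2 fun h' =>
    hgood u ⟨le_rfl, hlt.le⟩ (h' ▸ hbad₁)
  have hτ : τ₁ < τ₂ := hτu.trans (hlt.trans hwτ)
  have hnot : ∀ z ∈ Ioo τ₁ τ₂, z ∉ Bad := by
    intro z hz hzb
    rcases le_or_gt w z with h1 | h1
    · exact absurd (hleast ⟨⟨h1, hz.2.le.trans hτ₂.2⟩, hzb⟩) (not_le.2 hz.2)
    rcases le_or_gt z u with h2 | h2
    · exact absurd (hgreatest ⟨⟨hτ₁.1.trans hz.1.le, h2⟩, hzb⟩) (not_le.2 hz.1)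
    · exact hgood z ⟨h2.le, h1.le⟩ hzb
  have hmaps : f^[n₁ - 2] '' Ioo τ₁ τ₂ ⊆ Ioo a₀ ρ := by
    rintro _ ⟨z, hz, rfl⟩
    have h1 := hnot z hz
    simp only [hBad, mem_ofPred_eq, not_or, not_le] at h1
    exact h1.2
  have hval : ∀ τ ∈ Icc τ₁ τ₂, f^[n₁ - 2] τ ∈ Icc a₀ ρ := by
    intro τ h1
    rw [← closure_Ioo hτ.ne] at h1
    have h2 : Ioo τ₁ τ₂ ⊆ f^[n₁ - 2] ⁻¹' Icc a₀ ρ :=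
      fun z hz => Ioo_subset_Icc_self (hmaps (mem_image_of_mem _ hz))
    exact closure_minimal h2 (isClosed_Icc.preimage (h.continuous.iterate _)) h1
  refine ⟨τ₁, τ₂, Icc_subset_Icc hτ₁.1 hτ₂.2, ?_, ?_, hmaps, ?_, ?_⟩
  · rw [himg]
    exact fun z hz => ⟨hτu.trans_le hz.1, hz.2.trans_lt hwτ⟩
  · rintro l hl ⟨z, hz, hzc⟩
    exact hnot z hz (Or.inl ⟨l, Finset.mem_range.2 hl, hzc⟩)
  · exact H.end_value h hρ (hval τ₁ ⟨le_rfl, hτ.le⟩) hbad₁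
  · exact H.end_value h hρ (hval τ₂ ⟨hτ.le, le_rfl⟩) hbad₂

theorem ConsecutiveReturns.sum_le (h : BoundaryCase f c ℓm ℓp d)
    (H : ConsecutiveReturns f c d n₀ n₁ n₂ a₀ b₀ a₁ b₁ a₂ b₂)
    (P : Pullback f c d n₀ n₁ a₀ ρ τ₁ τ₂)
    (hρ : ρ ≤ b₂ ∨ n₂ - n₁ ≠ n₁ - n₀) {x y : ℝ} (hx : x ∈ Icc τ₁ τ₂) (hy : y ∈ Icc τ₁ τ₂) :
    ∑ i ∈ Finset.range (n₁ - 1), |f^[i] x - f^[i] y| ≤ 3 := by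
  have hT : Ioo τ₁ τ₂ ⊆ Icc 0 1 := Ioo_subset_Icc_self.trans (P.subset_Icc h)
  have h2 := H.two_le
  have h01 := H.lt₀₁
  have hopen : ∀ x ∈ Ioo τ₁ τ₂, ∀ y ∈ Ioo τ₁ τ₂,
      ∑ i ∈ Finset.range (n₁ - 1), |f^[i] x - f^[i] y| ≤ 3 := by
    intro x hx y hy
    have hsub : ∀ i, uIcc (f^[i] x) (f^[i] y) ⊆ f^[i] '' Ioo τ₁ τ₂ :=
      fun i => uIcc_iterate_subset h.continuous ordConnected_Ioo hx hy i
    have h1 : ∑ i ∈ Finset.range (n₁ - 1), |f^[i] x - f^[i] y| ≤ (3 : ℕ) := by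
      refine sum_abs_sub_le_of_card_le
        (fun i _ => (hsub i).trans (image_iterate_subset_Icc h.range hT i)) ?_
      intro z t ht hz
      refine card_le_three_of_not_subset (I := fun i => f^[i + 2] '' Icc (f c) d)
        (U := fun i => f^[i] '' Ioo τ₁ τ₂) (z := z)
        (fun i _ => ordConnected_image h.continuous ordConnected_Icc _)
        (fun i _ => ⟨_, h.iterate_value_mem _⟩)
        (fun i _ j _ hij => h.maximal.1.disjoint (by omega))
        (fun i _ => ordConnected_image h.continuous ordConnected_Ioo i)
        (fun i _ => ?_) (fun i hi => hsub i (hz i hi)) (fun i hi j hj hij => ?_)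
      · rw [← iterate_image_image]
        exact image_mono P.image_subset
      · have hi' := Finset.mem_range.1 (ht hi)
        have hj' := Finset.mem_range.1 (ht hj)
        have := H.not_subset h hT ordConnected_Ioo P.image_subset P.notMem P.mapsTo hρ
          (i := i + 2) (j := j + 2) (by omega) (by omega) (by omega) (by omega) (by omega)
        rwa [Nat.add_sub_cancel] at this
    exact_mod_cast h1
  have hcl : IsClosed {p : ℝ × ℝ |
      ∑ i ∈ Finset.range (n₁ - 1), |f^[i] p.1 - f^[i] p.2| ≤ 3} := by
    refine isClosed_le (continuous_finsetSum _ fun i _ => ?_) continuous_const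
    exact (((h.continuous.iterate i).comp continuous_fst).sub
      ((h.continuous.iterate i).comp continuous_snd)).abs
  have hmem : (x, y) ∈ closure (Ioo τ₁ τ₂ ×ˢ Ioo τ₁ τ₂) := by
    rw [closure_prod_eq, closure_Ioo (P.lt h).ne]
    exact ⟨hx, hy⟩
  exact closure_minimal (fun p hp => hopen p.1 hp.1 p.2 hp.2) hcl hmem

end Unimodal

section Unimodal

variable {f : ℝ → ℝ} {c ℓm ℓp d : ℝ} {n₀ n₁ n₂ : ℕ} {a₀ b₀ a₁ b₁ a₂ b₂ ρ τ₁ τ₂ : ℝ}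

theorem BoundaryCase.sup_lt (h : BoundaryCase f c ℓm ℓp d) (n : ℕ) :
    imgSup f (f^[2] '' Icc (f c) d) n < f c := by
  have h1 := h.chain.sup_mem n
  rw [iterate_image_image] at h1
  exact (h.mem_core (by omega) h1).2

theorem BoundaryCase.infDist_eq (h : BoundaryCase f c ℓm ℓp d) (n : ℕ) :
    Metric.infDist (f c) (f^[n] '' (f^[2] '' Icc (f c) d)) =
      f c - imgSup f (f^[2] '' Icc (f c) d) n := by
  rw [h.chain.image_eq, infDist_Icc (h.chain.inf_lt_sup n).le (h.sup_lt n).le]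

theorem sum_range_le_of_add_le {F : ℕ → ℝ} (hF : ∀ i, 0 ≤ F i) {N k m : ℕ} (hk : k + m ≤ N) :
    ∑ i ∈ Finset.range m, F (k + i) ≤ ∑ i ∈ Finset.range N, F i := by
  have h1 := Finset.sum_range_add F k m
  have h2 : ∑ i ∈ Finset.range (k + m), F i ≤ ∑ i ∈ Finset.range N, F i :=
    Finset.sum_le_sum_of_subset_of_nonneg (Finset.range_mono hk) fun _ _ _ => hF _
  have h3 : 0 ≤ ∑ i ∈ Finset.range k, F i := Finset.sum_nonneg fun _ _ => hF _
  linarith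

/-- The image under an iterate of the interval between a closest return and the critical value. -/
theorem ConsecutiveReturns.Ico_subset (h : BoundaryCase f c ℓm ℓp d)
    (P : Pullback f c d n₀ n₁ a₀ ρ τ₁ τ₂) {τ : ℝ} (hτ : τ ∈ Icc τ₁ τ₂) {k : ℕ}
    (hτc : f^[k] τ = f c) {x : ℝ} (hx : x ∈ f^[k] '' (f^[2] '' Icc (f c) d)) :
    Ico x (f c) ⊆ f^[k] '' Ioo τ₁ τ₂ := by
  obtain ⟨z, hz, rfl⟩ := hx
  have hz' := P.image_subset hz
  rintro y ⟨hy1, hy2⟩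
  have h1 : y ∈ uIcc (f^[k] z) (f^[k] τ) := by
    rw [hτc, uIcc_of_le (hy1.trans hy2.le)]
    exact ⟨hy1, hy2.le⟩
  obtain ⟨p, hp, hpy⟩ := intermediate_value_uIcc (h.continuous.iterate k).continuousOn h1
  have hpτ : p ≠ τ := by
    rintro rfl
    exact hy2.ne (hpy.symm.trans hτc)
  refine ⟨p, ?_, hpy⟩
  rcases le_total z τ with h2 | h2
  · rw [uIcc_of_le h2] at hp
    exact ⟨hz'.1.trans_le hp.1, (lt_of_le_of_ne hp.2 hpτ).trans_le hτ.2⟩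
  · rw [uIcc_of_ge h2] at hp
    exact ⟨hτ.1.trans_lt (lt_of_le_of_ne hp.1 hpτ.symm), hp.2.trans_lt hz'.2⟩

/-- If an end of the interval of monotonicity is mapped to the critical value at time `q`, then the
image of the wandering interval at this time is a closest return. -/
theorem ConsecutiveReturns.isClosestReturn (h : BoundaryCase f c ℓm ℓp d)
    (H : ConsecutiveReturns f c d n₀ n₁ n₂ a₀ b₀ a₁ b₁ a₂ b₂)
    (P : Pullback f c d n₀ n₁ a₀ ρ τ₁ τ₂) (hρ : ρ ≤ b₂ ∨ n₂ - n₁ ≠ n₁ - n₀)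
    (hq : n₀ + 3 ≤ n₁) {τ : ℝ} (hτ : τ ∈ Icc τ₁ τ₂) (hτc : f^[n₁ - n₀ - 2] τ = f c) :
    IsClosestReturn f c (f^[2] '' Icc (f c) d) (n₁ - n₀ - 2) := by
  have hJ := h.chain
  refine ⟨by omega, fun k hk => ?_⟩
  rw [h.infDist_eq, h.infDist_eq]
  have hne : n₁ - n₀ - 2 ≠ k := hk.ne'
  by_contra! hle
  have hlt : imgSup f (f^[2] '' Icc (f c) d) (n₁ - n₀ - 2) <
      imgSup f (f^[2] '' Icc (f c) d) k := by
    refine lt_of_le_of_ne (by linarith) fun h' => ?_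
    exact Set.disjoint_left.1 (hJ.wandering.disjoint hne) (hJ.sup_mem _) (h' ▸ hJ.sup_mem _)
  refine H.not_subset h (Ioo_subset_Icc_self.trans (P.subset_Icc h)) ordConnected_Ioo
    P.image_subset P.notMem P.mapsTo hρ (i := n₁ - n₀) (j := k + 2) (by omega) (by omega)
    (by omega) (by omega) (by omega) ?_
  refine Subset.trans ?_ (Ico_subset h P hτ hτc (hJ.sup_mem _))
  rw [← iterate_image_image]
  intro x hx
  refine ⟨(hJ.lt_of_lt hne (hJ.sup_mem _) (hJ.sup_mem _) hlt (hJ.sup_mem _) hx).le, ?_⟩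
  exact (hJ.mem_iff.1 hx).2.trans_lt (h.sup_lt k)

/-- The gap between two consecutive closest returns is not small when an end of the interval of
monotonicity is mapped to the first of them. -/
theorem ConsecutiveReturns.le_gap (h : BoundaryCase f c ℓm ℓp d)
    (H : ConsecutiveReturns f c d n₀ n₁ n₂ a₀ b₀ a₁ b₁ a₂ b₂)
    (P : Pullback f c d n₀ n₁ a₀ ρ τ₁ τ₂) (hρ : ρ ≤ b₂ ∨ n₂ - n₁ ≠ n₁ - n₀)
    (hq : n₀ + 3 ≤ n₁) {C m M η : ℝ} (hE : UnimodalEstimates f c ℓm ℓp C m M)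
    (hη0 : 0 < η) (hη1 : η ≤ 1)
    (hη : ∀ k, η ≤ imgRatio f c (f^[2] '' Icc (f c) d)
      (closestReturn f c (f^[2] '' Icc (f c) d) k)) (hlen : b₁ - a₁ ≤ b₀ - a₀)
    {τ : ℝ} (hτ : τ ∈ Icc τ₁ τ₂) (hτc : f^[n₁ - n₀ - 2] τ = f c) :
    f^[n₁ - 2] τ = b₀ ∧ η * (b₁ - a₁) ≤ 3 * Real.exp (C * 8) * (a₁ - b₀) := by
  have hJ := h.chain
  set J := f^[2] '' Icc (f c) d with hJdef
  obtain ⟨q, hqdef⟩ : ∃ q, q = n₁ - n₀ - 2 := ⟨_, rfl⟩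
  have hcr := H.isClosestReturn h P hρ hq hτ hτc
  rw [← hqdef] at hτc hcr
  obtain ⟨k, -, hk⟩ := Nat.exists_lt_card_nth_eq hcr
  have hηk := hη k
  rw [show closestReturn f c J k = q from hk] at hηk
  set a := imgInf f J q with ha
  set b := imgSup f J q with hb
  have hab : a < b := hJ.inf_lt_sup q
  have hbc : b < f c := h.sup_lt q
  have hηab : η * (f c - a) ≤ f c - b := by
    rwa [imgRatio, le_div_iff₀ (by linarith)] at hηk
  have hcd := h.lt
  have hIco : Ico a (f c) ⊆ f^[q] '' Ioo τ₁ τ₂ := Ico_subset h P hτ hτc (hJ.inf_mem q)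
  have haJ : ∀ z ∈ Icc a b, ∃ y ∈ J, f^[q] y = z := fun z hz => by
    have : z ∈ f^[q] '' J := by rw [hJ.image_eq]; exact hz
    exact this
  have hA : Icc a d ⊆ Icc 0 1 := by
    have h1 := hJ.image_subset h.range q (hJ.inf_mem q)
    have h2 := h.maximal.1.subset (right_mem_Icc.2 hcd.le)
    exact Icc_subset_Icc h1.1 h2.2
  have hcA : ∀ i < n₀, c ∉ f^[i] '' Icc a d := by
    rintro i hi ⟨z, hz, hzc⟩
    rcases lt_or_ge z (f c) with h1 | h1
    · obtain ⟨y, hy, hyz⟩ := hIco ⟨hz.1, h1⟩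
      refine P.notMem (i + q) (by omega) ⟨y, hy, ?_⟩
      rw [Function.iterate_add_apply, hyz, hzc]
    · exact h.turning_notMem i ⟨z, ⟨h1, hz.2⟩, hzc⟩
  have haA : a ∈ Icc a d := ⟨le_rfl, by linarith⟩
  have hdA : d ∈ Icc a d := ⟨by linarith, le_rfl⟩
  have hord : Ordered₄ a b (f c) d := Or.inl ⟨hab, hbc, hcd⟩
  obtain ⟨hord', hle⟩ := crossRatio_iterate_le h.unimodal hE.1 hE.2 hord n₀ fun i hi =>
    side_of_uIcc_notMem h.range h.continuous hA ordConnected_Icc (hcA i hi) haA hdA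
  -- the sum of the lengths
  obtain ⟨ya, hya, hya'⟩ := haJ a ⟨le_rfl, hab.le⟩
  have hyaT : ya ∈ Icc τ₁ τ₂ := Ioo_subset_Icc_self (P.image_subset hya)
  have hterm : ∀ i, |f^[i] d - f^[i] a| ≤
      |f^[i] d - f^[i] (f c)| + |f^[q + i] τ - f^[q + i] ya| := by
    intro i
    rw [add_comm q i, Function.iterate_add_apply, Function.iterate_add_apply, hya', hτc]
    exact abs_sub_le _ _ _
  have hsum1 : ∀ s : Finset ℕ, ∑ i ∈ s, |f^[i] d - f^[i] (f c)| ≤ 1 := fun s =>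
    sum_abs_iterate_sub_le_one h.continuous h.range h.maximal.1.subset ordConnected_Icc
      h.maximal.1.disjoint (right_mem_Icc.2 hcd.le) h.value_mem s
  have hsum2 := H.sum_le h P hρ hτ hyaT
  have hS : ∑ i ∈ Finset.range (n₀ + 1), |f^[i] d - f^[i] a| ≤ 4 := by
    refine (Finset.sum_le_sum fun i _ => hterm i).trans ?_
    rw [Finset.sum_add_distrib]
    have h1 := sum_range_le_of_add_le (F := fun i => |f^[i] τ - f^[i] ya|)
      (fun _ => abs_nonneg _) (N := n₁ - 1) (k := q) (m := n₀ + 1) (by omega)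
    linarith [hsum1 (Finset.range (n₀ + 1))]
  have hS8 : ∑ i ∈ Finset.range n₀, (|f^[i] d - f^[i] a| + |f^[i + 1] d - f^[i + 1] a|) ≤ 8 := by
    rw [Finset.sum_add_distrib]
    have h1 := sum_range_le_of_add_le (F := fun i => |f^[i] d - f^[i] a|)
      (fun _ => abs_nonneg _) (N := n₀ + 1) (k := 0) (m := n₀) (by omega)
    have h2 := sum_range_le_of_add_le (F := fun i => |f^[i] d - f^[i] a|)
      (fun _ => abs_nonneg _) (N := n₀ + 1) (k := 1) (m := n₀) (by omega)
    simp only [zero_add, add_comm 1] at h1 h2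
    linarith
  have hC := hE.1.C_nonneg
  have hle' := mul_le_of_crossRatio_le hord hord' (hle.trans (mul_le_mul_of_nonneg_right
    (Real.exp_le_exp.2 (mul_le_mul_of_nonneg_left hS8 hC)) (crossRatio_nonneg _ _ _ _)))
  -- the images of the four points
  have hlast : f^[n₁ - 2] τ = f^[n₀] (f c) := by
    rw [show n₁ - 2 = n₀ + q by omega, Function.iterate_add_apply, hτc]
  have hmapab : ∀ z ∈ Icc a b, f^[n₀] z ∈ Icc a₁ b₁ := by
    intro z hz
    rw [← H.image₁, show n₁ = n₀ + q + 2 by omega, ← iterate_image_image, ← iterate_image_image,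
      ← hJdef, hJ.image_eq]
    exact mem_image_of_mem _ hz
  have hmapcd : ∀ z ∈ Icc (f c) d, f^[n₀] z ∈ Icc a₀ b₀ := fun z hz => by
    rw [← H.image₀]; exact mem_image_of_mem _ hz
  have hfa := hmapab a ⟨le_rfl, hab.le⟩
  have hfb := hmapab b ⟨hab.le, le_rfl⟩
  have hfc := hmapcd _ h.value_mem
  have hfd := hmapcd d (right_mem_Icc.2 hcd.le)
  have hba₁ := H.ba₁
  have hmono : StrictAntiOn f^[n₀] (Icc a d) := by
    rcases h.unimodal.strictMonoOn_or_strictAntiOn_iterate h.continuous h.range hA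
      ordConnected_Icc n₀ hcA with h1 | h1
    · have := h1 haA (⟨by linarith, hcd.le⟩ : f c ∈ Icc a d) (by linarith)
      linarith [hfa.1, hfc.2]
    · exact h1
  have hcA' : f c ∈ Icc a d := ⟨by linarith, hcd.le⟩
  have hbA : b ∈ Icc a d := ⟨hab.le, by linarith⟩
  have hecb : f^[n₀] (f c) = b₀ := by
    have h1 : b₀ ∈ f^[n₀] '' Icc (f c) d := by rw [H.image₀]; exact ⟨H.ab₀.le, le_rfl⟩
    obtain ⟨z, hz, hzb⟩ := h1
    refine le_antisymm hfc.2 ?_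
    rw [← hzb]
    exact hmono.antitoneOn hcA' ⟨by linarith [hz.1], hz.2⟩ hz.1
  have heda : f^[n₀] d = a₀ := by
    have h1 : a₀ ∈ f^[n₀] '' Icc (f c) d := by rw [H.image₀]; exact ⟨le_rfl, H.ab₀.le⟩
    obtain ⟨z, hz, hzb⟩ := h1
    refine le_antisymm ?_ hfd.1
    rw [← hzb]
    exact hmono.antitoneOn ⟨by linarith [hz.1], hz.2⟩ hdA hz.2
  have heab : f^[n₀] a = b₁ ∧ f^[n₀] b = a₁ := by
    have hsurj : ∀ y ∈ Icc a₁ b₁, ∃ z ∈ Icc a b, f^[n₀] z = y := by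
      intro y hy
      rw [← H.image₁, show n₁ = n₀ + q + 2 by omega, ← iterate_image_image,
        ← iterate_image_image, ← hJdef, hJ.image_eq] at hy
      exact hy
    obtain ⟨z, hz, hzb⟩ := hsurj b₁ ⟨H.ab₁.le, le_rfl⟩
    obtain ⟨z', hz', hza⟩ := hsurj a₁ ⟨le_rfl, H.ab₁.le⟩
    constructor
    · refine le_antisymm hfa.2 ?_
      rw [← hzb]
      exact hmono.antitoneOn haA ⟨hz.1, by linarith [hz.2]⟩ hz.1
    · refine le_antisymm ?_ hfb.1
      rw [← hza]
      exact hmono.antitoneOn ⟨hz'.1, by linarith [hz'.2]⟩ hbA hz'.2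
  refine ⟨hlast.trans hecb, ?_⟩
  have hab₀ := H.ab₀
  have hab₁ := H.ab₁
  rw [hecb, heda, heab.1, heab.2, abs_of_neg (a := a₁ - b₁) (by linarith),
    abs_of_neg (a := a₀ - b₀) (by linarith), abs_of_pos (a := f c - b) (by linarith),
    abs_of_pos (a := d - a) (by linarith), abs_of_pos (a := b - a) (by linarith),
    abs_of_pos (a := d - f c) (by linarith), abs_of_neg (a := b₀ - a₁) (by linarith),
    abs_of_neg (a := a₀ - b₁) (by linarith)] at hle'
  set K := Real.exp (C * 8)
  have hK1 : 1 ≤ K := Real.one_le_exp (by positivity)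
  set l₁ := b₁ - a₁ with hl₁
  set l₀ := b₀ - a₀ with hl₀
  set G := a₁ - b₀ with hG
  have hl₁0 : 0 < l₁ := by linarith [H.ab₁]
  have hG0 : 0 < G := by linarith
  have hl₀0 : 0 < l₀ := by linarith
  have hkey : η * (l₁ * l₀) ≤ K * (G * (l₀ + G + l₁)) := by
    have h1 : 0 < b - a := by linarith
    have h2 : 0 < d - f c := by linarith
    have h3 : η * (b - a) * (d - f c) ≤ (f c - b) * (d - a) := by
      refine mul_le_mul (le_trans ?_ hηab) (by linarith) h2.le (by linarith)
      gcongr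
    have h4 : η * (l₁ * l₀) * ((b - a) * (d - f c)) ≤
        K * (G * (l₀ + G + l₁)) * ((b - a) * (d - f c)) := by
      calc η * (l₁ * l₀) * ((b - a) * (d - f c)) = (l₁ * l₀) * (η * (b - a) * (d - f c)) := by ring
        _ ≤ (l₁ * l₀) * ((f c - b) * (d - a)) := by gcongr
        _ = -(a₁ - b₁) * -(a₀ - b₀) * ((f c - b) * (d - a)) := by simp only [hl₁, hl₀]; ring
        _ ≤ _ := hle'
        _ = K * (G * (l₀ + G + l₁)) * ((b - a) * (d - f c)) := by simp only [hl₁, hl₀, hG]; ring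
    exact le_of_mul_le_mul_right h4 (mul_pos h1 h2)
  rcases le_total l₁ G with h1 | h1
  · nlinarith
  · have h2 : η * (l₁ * l₀) ≤ K * (G * (3 * l₀)) := hkey.trans (by gcongr; linarith)
    refine le_of_mul_le_mul_right ?_ hl₀0
    linarith

end Unimodal

theorem mul_le_of_space {δ K L R l L' R' l' : ℝ} (hδ : 0 < δ) (hK : 0 < K) (hL : 0 < L)
    (hR : 0 < R) (hl : 0 < l) (hl' : 0 < l') (hL' : δ * l' ≤ L') (hR' : δ * l' ≤ R')
    (h : L' * R' * (l * (L + l + R)) ≤ K * (L * R) * (l' * (L' + l' + R'))) :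
    δ ^ 2 / ((1 + 2 * δ) * K) * l ≤ L ∧ δ ^ 2 / ((1 + 2 * δ) * K) * l ≤ R := by
  have h1 : δ ^ 2 * (l' * (L' + l' + R')) ≤ (1 + 2 * δ) * (L' * R') := by
    have hp : 0 ≤ (L' - δ * l') * (R' - δ * l') :=
      mul_nonneg (by linarith) (by linarith)
    have hp1 : 0 ≤ δ * l' * (L' - δ * l') := mul_nonneg (by positivity) (by linarith)
    have hp2 : 0 ≤ δ * l' * (R' - δ * l') := mul_nonneg (by positivity) (by linarith)
    have hp3 : 0 ≤ δ * ((L' - δ * l') * (R' - δ * l')) := by positivity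
    have hp4 : 0 ≤ δ * (δ * l' * (L' - δ * l')) := by positivity
    have hp5 : 0 ≤ δ * (δ * l' * (R' - δ * l')) := by positivity
    nlinarith
  have hL'0 : 0 < L' := (mul_pos hδ hl').trans_le hL'
  have hR'0 : 0 < R' := (mul_pos hδ hl').trans_le hR'
  have hT : 0 < l' * (L' + l' + R') := by positivity
  have h2 : δ ^ 2 * (l * (L + l + R)) ≤ (1 + 2 * δ) * K * (L * R) := by
    refine le_of_mul_le_mul_right ?_ hT
    calc δ ^ 2 * (l * (L + l + R)) * (l' * (L' + l' + R'))
        = δ ^ 2 * (l' * (L' + l' + R')) * (l * (L + l + R)) := by ring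
      _ ≤ (1 + 2 * δ) * (L' * R') * (l * (L + l + R)) := by gcongr
      _ = (1 + 2 * δ) * (L' * R' * (l * (L + l + R))) := by ring
      _ ≤ (1 + 2 * δ) * (K * (L * R) * (l' * (L' + l' + R'))) := by gcongr
      _ = _ := by ring
  have hD : 0 < (1 + 2 * δ) * K := by positivity
  have h3 : ∀ {X Y : ℝ}, 0 < X → 0 < Y → δ ^ 2 * (l * (X + l + Y)) ≤ (1 + 2 * δ) * K * (X * Y) →
      δ ^ 2 / ((1 + 2 * δ) * K) * l ≤ X := by
    intro X Y hX hY hXY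
    rw [div_mul_eq_mul_div, div_le_iff₀ hD]
    refine le_of_mul_le_mul_right ?_ hY
    have : δ ^ 2 * (l * Y) ≤ δ ^ 2 * (l * (X + l + Y)) := by gcongr; linarith
    linarith
  exact ⟨h3 hL hR h2, h3 hR hL (by linarith [h2])⟩

section Unimodal

variable {f : ℝ → ℝ} {c ℓm ℓp d : ℝ} {n₀ n₁ n₂ : ℕ} {a₀ b₀ a₁ b₁ a₂ b₂ ρ τ₁ τ₂ : ℝ}

theorem Pullback.side (h : BoundaryCase f c ℓm ℓp d) (P : Pullback f c d n₀ n₁ a₀ ρ τ₁ τ₂) {i : ℕ}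
    (hi : i < n₁ - 2) : (∀ τ ∈ Icc τ₁ τ₂, f^[i] τ ∈ Icc 0 c) ∨ ∀ τ ∈ Icc τ₁ τ₂, f^[i] τ ∈ Icc c 1 := by
  have hT : Ioo τ₁ τ₂ ⊆ Icc 0 1 := Ioo_subset_Icc_self.trans (P.subset_Icc h)
  have key : ∀ {u w : ℝ}, f^[i] '' Ioo τ₁ τ₂ ⊆ Icc u w → ∀ τ ∈ Icc τ₁ τ₂, f^[i] τ ∈ Icc u w := by
    intro u w hsub τ hτ
    rw [← closure_Ioo (P.lt h).ne] at hτ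
    exact closure_minimal (image_subset_iff.1 hsub) (isClosed_Icc.preimage (h.continuous.iterate i))
      hτ
  rcases subset_side (image_iterate_subset_Icc h.range hT i)
    (ordConnected_image h.continuous ordConnected_Ioo i) (P.notMem i hi) with h1 | h1
  · exact Or.inl (key (h1.trans Ico_subset_Icc_self))
  · exact Or.inr (key (h1.trans Ioc_subset_Icc_self))

/-- The interval of monotonicity contains a neighbourhood of the second image of the wandering
interval which is not small compared with that image. -/
theorem ConsecutiveReturns.space (h : BoundaryCase f c ℓm ℓp d)
    (H : ConsecutiveReturns f c d n₀ n₁ n₂ a₀ b₀ a₁ b₁ a₂ b₂)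
    (P : Pullback f c d n₀ n₁ a₀ ρ τ₁ τ₂) (hρ : ρ ≤ b₂ ∨ n₂ - n₁ ≠ n₁ - n₀)
    (hq : n₀ + 3 ≤ n₁) {C m M η : ℝ} (hE : UnimodalEstimates f c ℓm ℓp C m M)
    (hη0 : 0 < η) (hη1 : η ≤ 1)
    (hη : ∀ k, η ≤ imgRatio f c (f^[2] '' Icc (f c) d)
      (closestReturn f c (f^[2] '' Icc (f c) d) k)) (hlen : b₁ - a₁ ≤ b₀ - a₀)
    (hright : η * (b₁ - a₁) ≤ ρ - b₁) {δ : ℝ} (hδ : δ = η / (3 * Real.exp (C * 8))) {u w : ℝ}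
    (huw : u < w) (himg : f^[2] '' Icc (f c) d = Icc u w) :
    δ ^ 2 / ((1 + 2 * δ) * Real.exp (C * 8)) * (w - u) ≤ u - τ₁ ∧
      δ ^ 2 / ((1 + 2 * δ) * Real.exp (C * 8)) * (w - u) ≤ τ₂ - w := by
  have hC := hE.1.C_nonneg
  have hn₀ := H.two_le
  have hK1 : 1 ≤ Real.exp (C * 8) := Real.one_le_exp (by positivity)
  have hδ0 : 0 < δ := by rw [hδ]; positivity
  have hδη : δ ≤ η := by
    rw [hδ, div_le_iff₀ (by positivity)]
    nlinarith
  have hab₀ := H.ab₀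
  have hab₁ := H.ab₁
  have hba₁ := H.ba₁
  have hsub := P.image_subset
  rw [himg] at hsub
  have hu : u ∈ Icc u w := ⟨le_rfl, huw.le⟩
  have hw : w ∈ Icc u w := ⟨huw.le, le_rfl⟩
  have hτu := (hsub hu).1
  have hwτ := (hsub hw).2
  have hτ₁ : τ₁ ∈ Icc τ₁ τ₂ := ⟨le_rfl, (P.lt h).le⟩
  have hτ₂ : τ₂ ∈ Icc τ₁ τ₂ := ⟨(P.lt h).le, le_rfl⟩
  have hord : Ordered₄ τ₁ u w τ₂ := Or.inl ⟨hτu, huw, hwτ⟩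
  obtain ⟨hord', hle⟩ := crossRatio_iterate_le h.unimodal hE.1 hE.2 hord (n₁ - 2) fun i hi => by
    rcases P.side h hi with h1 | h1
    · exact Or.inl ⟨h1 _ hτ₁, h1 _ hτ₂⟩
    · exact Or.inr ⟨h1 _ hτ₁, h1 _ hτ₂⟩
  have hsum := H.sum_le h P hρ hτ₂ hτ₁
  have hS8 : ∑ i ∈ Finset.range (n₁ - 2),
      (|f^[i] τ₂ - f^[i] τ₁| + |f^[i + 1] τ₂ - f^[i + 1] τ₁|) ≤ 8 := by
    rw [Finset.sum_add_distrib]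
    have h1 := sum_range_le_of_add_le (F := fun i => |f^[i] τ₂ - f^[i] τ₁|)
      (fun _ => abs_nonneg _) (N := n₁ - 1) (k := 0) (m := n₁ - 2) (by omega)
    have h2 := sum_range_le_of_add_le (F := fun i => |f^[i] τ₂ - f^[i] τ₁|)
      (fun _ => abs_nonneg _) (N := n₁ - 1) (k := 1) (m := n₁ - 2) (by omega)
    simp only [zero_add, add_comm 1] at h1 h2
    linarith
  have hle' := mul_le_of_crossRatio_le hord hord' (hle.trans (mul_le_mul_of_nonneg_right
    (Real.exp_le_exp.2 (mul_le_mul_of_nonneg_left hS8 hC)) (crossRatio_nonneg _ _ _ _)))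
  have hval : ∀ z ∈ Icc u w, f^[n₁ - 2] z ∈ Icc a₁ b₁ := by
    intro z hz
    rw [← himg] at hz
    rw [← H.image₁, show n₁ = n₁ - 2 + 2 by omega, ← iterate_image_image]
    exact mem_image_of_mem _ hz
  have hfu := hval u hu
  have hfw := hval w hw
  have hend : ∀ τ ∈ Icc τ₁ τ₂,
      (f^[n₁ - 2] τ = ρ ∨ f^[n₁ - 2] τ = a₀ ∨ f^[n₁ - n₀ - 2] τ = f c) →
      f^[n₁ - 2] τ = ρ ∨ f^[n₁ - 2] τ ≤ a₁ - δ * (b₁ - a₁) := by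
    rintro τ hτ (h1 | h1 | h1)
    · exact Or.inl h1
    · right
      have h2 : δ * (b₁ - a₁) ≤ 1 * (b₁ - a₁) := by gcongr; linarith
      linarith
    · right
      obtain ⟨h2, h3⟩ := H.le_gap h P hρ hq hE hη0 hη1 hη hlen hτ h1
      have h4 : δ * (b₁ - a₁) ≤ a₁ - b₀ := by
        rw [hδ, div_mul_eq_mul_div, div_le_iff₀ (by positivity)]
        linarith
      linarith
  have hδ₁ : δ * (b₁ - a₁) ≤ ρ - b₁ := by
    refine le_trans ?_ hright
    gcongr
  have hδ₂ : 0 < δ * (b₁ - a₁) := mul_pos hδ0 (by linarith)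
  have he₁ := hend τ₁ hτ₁ P.end_left
  have he₂ := hend τ₂ hτ₂ P.end_right
  rw [abs_of_pos (a := u - τ₁) (by linarith), abs_of_pos (a := w - u) (by linarith),
    abs_of_pos (a := τ₂ - w) (by linarith), abs_of_pos (a := τ₂ - τ₁) (by linarith)] at hle'
  set y₁ := f^[n₁ - 2] τ₁
  set y₂ := f^[n₁ - 2] u
  set y₃ := f^[n₁ - 2] w
  set y₄ := f^[n₁ - 2] τ₂
  have hK0 : 0 < Real.exp (C * 8) := Real.exp_pos _
  rw [show τ₂ - τ₁ = u - τ₁ + (w - u) + (τ₂ - w) by ring] at hle'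
  rcases hord' with ⟨h1, h2, h3⟩ | ⟨h1, h2, h3⟩
  · rw [abs_of_pos (a := y₂ - y₁) (by linarith), abs_of_pos (a := y₃ - y₂) (by linarith),
      abs_of_pos (a := y₄ - y₃) (by linarith), abs_of_pos (a := y₄ - y₁) (by linarith),
      show y₄ - y₁ = y₂ - y₁ + (y₃ - y₂) + (y₄ - y₃) by ring] at hle'
    have h5 : δ * (y₃ - y₂) ≤ δ * (b₁ - a₁) := by gcongr <;> linarith [hfu.1, hfw.2]
    refine mul_le_of_space hδ0 hK0 (by linarith) (by linarith) (by linarith)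
      (by linarith) ?_ ?_ hle'
    · rcases he₁ with h4 | h4 <;> linarith [hfu.1, hfu.2]
    · rcases he₂ with h4 | h4 <;> linarith [hfw.1, hfw.2]
  · rw [abs_of_neg (a := y₂ - y₁) (by linarith), abs_of_neg (a := y₃ - y₂) (by linarith),
      abs_of_neg (a := y₄ - y₃) (by linarith), abs_of_neg (a := y₄ - y₁) (by linarith),
      show -(y₄ - y₁) = -(y₂ - y₁) + -(y₃ - y₂) + -(y₄ - y₃) by ring] at hle'
    have h5 : δ * -(y₃ - y₂) ≤ δ * (b₁ - a₁) := by gcongr; linarith [hfu.2, hfw.1]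
    refine mul_le_of_space hδ0 hK0 (by linarith) (by linarith) (by linarith)
      (by linarith) ?_ ?_ hle'
    · rcases he₁ with h4 | h4 <;> linarith [hfu.1, hfu.2]
    · rcases he₂ with h4 | h4 <;> linarith [hfw.1, hfw.2]

end Unimodal

namespace BoundaryCase

variable {f : ℝ → ℝ} {c ℓm ℓp d : ℝ}

theorem lt_inf (h : BoundaryCase f c ℓm ℓp d) (k : ℕ) {j : ℕ}
    (hj : j < closestReturn f c (f^[2] '' Icc (f c) d) (k + 1))
    (hne : j ≠ closestReturn f c (f^[2] '' Icc (f c) d) k) {x : ℝ}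
    (hx : x ∈ f^[j] '' (f^[2] '' Icc (f c) d)) :
    x < imgInf f (f^[2] '' Icc (f c) d) (closestReturn f c (f^[2] '' Icc (f c) d) k) := by
  have hJ := h.chain
  rcases Nat.eq_zero_or_pos j with rfl | hj0
  · have hcr := hJ.isClosestReturn h.continuous k
    have h1 := hcr.2 0 hcr.1
    rw [h.infDist_eq, h.infDist_eq] at h1
    exact hJ.lt_of_lt hne (hJ.sup_mem _) (hJ.sup_mem _) (by linarith) hx (hJ.inf_mem _)
  · exact hJ.lt_inf h.unimodal h.continuous h.range k hj0 hj hne hx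

theorem consecutiveReturns (h : BoundaryCase f c ℓm ℓp d) {J : Set ℝ}
    (hJ : J = f^[2] '' Icc (f c) d) (k : ℕ) :
    ConsecutiveReturns f c d (closestReturn f c J k + 2) (closestReturn f c J (k + 1) + 2)
      (closestReturn f c J (k + 2) + 2) (imgInf f J (closestReturn f c J k))
      (imgSup f J (closestReturn f c J k)) (imgInf f J (closestReturn f c J (k + 1)))
      (imgSup f J (closestReturn f c J (k + 1))) (imgInf f J (closestReturn f c J (k + 2)))
      (imgSup f J (closestReturn f c J (k + 2))) := by
  have hch := h.chain
  rw [← hJ] at hch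
  have hm := hch.closestReturn_strictMono h.continuous
  have himg : ∀ n, f^[n + 2] '' Icc (f c) d = Icc (imgInf f J n) (imgSup f J n) := by
    intro n
    rw [← hch.image_eq, hJ, iterate_image_image]
  have hbelow : ∀ k j, 2 ≤ j → j < closestReturn f c J (k + 1) + 2 → j ≠ closestReturn f c J k + 2 →
      ∀ x ∈ f^[j] '' Icc (f c) d, x < imgInf f J (closestReturn f c J k) := by
    intro k j hj hj' hne x hx
    obtain ⟨i, rfl⟩ : ∃ i, j = i + 2 := ⟨j - 2, by omega⟩
    rw [← iterate_image_image] at hx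
    subst hJ
    exact h.lt_inf k (by omega) (by omega) hx
  exact
    { two_le := by omega
      lt₀₁ := by have := hm (show k < k + 1 by omega); omega
      lt₁₂ := by have := hm (show k + 1 < k + 2 by omega); omega
      image₀ := himg _
      image₁ := himg _
      image₂ := himg _
      ab₀ := hch.inf_lt_sup _
      ba₁ := hch.sup_lt_inf h.unimodal h.continuous h.range k
      ab₁ := hch.inf_lt_sup _
      ba₂ := hch.sup_lt_inf h.unimodal h.continuous h.range (k + 1)
      ab₂ := hch.inf_lt_sup _
      below₀ := hbelow k
      below₁ := hbelow (k + 1) }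

theorem eventually_add_three_le (h : BoundaryCase f c ℓm ℓp d) {J : Set ℝ}
    (hJ : J = f^[2] '' Icc (f c) d) :
    ∀ᶠ k in atTop, closestReturn f c J k + 3 ≤ closestReturn f c J (k + 1) := by
  have hch := h.chain
  rw [← hJ] at hch
  have h1 : f (f c) < f c := h.image_value_lt.trans h.turning_lt
  have h2 : f (f (f c)) < f c := (h.mem_core le_rfl (h.iterate_value_mem 2)).2
  obtain ⟨m, hm, hmc⟩ := exists_between (max_lt h1 h2)
  have h3 : ∀ᶠ x in 𝓝 (f c), f x < m ∧ f (f x) < m :=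
    (h.continuous.continuousAt.eventually_lt_const (lt_of_le_of_lt (le_max_left _ _) hm)).and
      ((h.continuous.comp h.continuous).continuousAt.eventually_lt_const
        (lt_of_le_of_lt (le_max_right _ _) hm))
  obtain ⟨ε, hε, hball⟩ := Metric.eventually_nhds_iff.1 h3
  filter_upwards [hch.eventually_lt_inf h.unimodal h.continuous h.range
    (max_lt (show f c - ε < f c by linarith) hmc)] with k hk
  have hlt := hch.closestReturn_strictMono h.continuous (show k < k + 1 by omega)
  have h4 := hch.sup_lt_inf h.unimodal h.continuous h.range k
  have h5 := hch.inf_lt_sup (closestReturn f c J k)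
  set x := imgInf f J (closestReturn f c J k)
  have hx : x < f c := h5.trans (hch.sup_lt h.unimodal h.range (hch.closestReturn_pos h.continuous k))
  have h6 := hball (y := x) (by
    rw [Real.dist_eq, abs_sub_comm, abs_of_pos (by linarith)]
    linarith [(max_lt_iff.1 hk).1])
  have hmem : ∀ q, closestReturn f c J (k + 1) = q + closestReturn f c J k → m < f^[q] x := by
    intro q hq
    have h7 : f^[q] x ∈ f^[closestReturn f c J (k + 1)] '' J := by
      rw [hq, ← iterate_image_image]
      exact mem_image_of_mem _ (hch.inf_mem _)
    linarith [(hch.mem_iff.1 h7).1, (max_lt_iff.1 hk).2]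
  by_contra! hcon
  obtain h7 | h7 : closestReturn f c J (k + 1) = 1 + closestReturn f c J k ∨
    closestReturn f c J (k + 1) = 2 + closestReturn f c J k := by omega
  · exact absurd (hmem 1 h7) (not_lt.2 h6.1.le)
  · exact absurd (hmem 2 h7) (not_lt.2 h6.2.le)

theorem exists_len_le (h : BoundaryCase f c ℓm ℓp d) {J : Set ℝ}
    (hJ : J = f^[2] '' Icc (f c) d) {len : ℕ → ℝ}
    (hlen : ∀ k, len k = imgSup f J (closestReturn f c J k) - imgInf f J (closestReturn f c J k))
    (N : ℕ) : ∃ k, N ≤ k ∧ len (k + 1) ≤ len k := by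
  have hch := h.chain
  rw [← hJ] at hch
  by_contra! hcon
  have hmono : ∀ n, len N ≤ len (N + n) := by
    intro n
    induction n with
    | zero => simp
    | succ n ih => exact ih.trans (hcon (N + n) (by omega)).le
  have hpos : 0 < len N := by rw [hlen]; linarith [hch.inf_lt_sup (closestReturn f c J N)]
  obtain ⟨K, hK⟩ := eventually_atTop.1 (eventually_abs_iterate_sub_lt h.unimodal h.continuous
    h.range h.maximal hpos)
  have hle := (hch.closestReturn_strictMono h.continuous).id_le (N + K)
  simp only [id] at hle
  have h1 := hK (closestReturn f c J (N + K) + 2) (by omega)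
  rw [← iterate_image_image, ← hJ] at h1
  have h2 := h1 _ (hch.sup_mem _) _ (hch.inf_mem _)
  have h3 := hmono K
  rw [hlen (N + K)] at h3
  linarith [le_abs_self (imgSup f J (closestReturn f c J (N + K)) -
    imgInf f J (closestReturn f c J (N + K)))]

theorem exists_good (h : BoundaryCase f c ℓm ℓp d) {J : Set ℝ}
    (hJ : J = f^[2] '' Icc (f c) d) {len : ℕ → ℝ}
    (hlen : ∀ k, len k = imgSup f J (closestReturn f c J k) - imgInf f J (closestReturn f c J k))
    (N : ℕ) : ∃ k, N ≤ k ∧ len (k + 1) ≤ len k ∧ (len (k + 1) ≤ len (k + 2) ∨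
      closestReturn f c J (k + 2) - closestReturn f c J (k + 1) ≠
        closestReturn f c J (k + 1) - closestReturn f c J k) := by
  have hch := h.chain
  rw [← hJ] at hch
  have hm := hch.closestReturn_strictMono h.continuous
  by_contra! hcon
  obtain ⟨k, hNk, hk⟩ := h.exists_len_le hJ hlen N
  obtain ⟨q, hq⟩ : ∃ q, q = closestReturn f c J (k + 1) - closestReturn f c J k := ⟨_, rfl⟩
  have hq0 : 0 < q := by have := hm (show k < k + 1 by omega); omega
  have hall : ∀ n, len (k + n + 1) ≤ len (k + n) ∧
      closestReturn f c J (k + n + 1) = q + closestReturn f c J (k + n) := by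
    intro n
    induction n with
    | zero => exact ⟨hk, by have := hm (show k < k + 1 by omega); simp only [add_zero]; omega⟩
    | succ n ih =>
      obtain ⟨h1, h2⟩ := hcon (k + n) (by omega) ih.1
      refine ⟨h1.le, ?_⟩
      have h3 := hm (show k + n + 1 < k + n + 2 by omega)
      rw [show k + (n + 1) + 1 = k + n + 2 by omega, show k + (n + 1) = k + n + 1 by omega]
      omega
  have ht : ∀ n, closestReturn f c J (k + n) = q * n + closestReturn f c J k := by
    intro n
    induction n with
    | zero => simp
    | succ n ih => rw [show k + (n + 1) = k + n + 1 by omega, (hall n).2, ih]; ring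
  have hmem : ∀ n, f^[q * n] (f^[closestReturn f c J k + 2] (f c)) ∈
      f^[closestReturn f c J (k + n)] '' J := by
    intro n
    rw [← Function.iterate_add_apply, ht n, ← add_assoc]
    have := h.iterate_value_mem_chain (q * n + closestReturn f c J k)
    rwa [← hJ] at this
  refine h.maximal.1.omega _ h.value_mem ?_
  rw [← omegaSet_iterate f (closestReturn f c J k + 2)]
  refine isPeriodicOrbit_omegaSet_of_monotone h.continuous h.range hq0
    (iterate_mem_Icc h.range (h.range c) _) (Or.inl (monotone_nat_of_le_succ fun n => ?_))
  have h1 := (hch.mem_iff.1 (hmem n)).2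
  have h2 := (hch.mem_iff.1 (hmem (n + 1))).1
  have h3 := hch.sup_lt_inf h.unimodal h.continuous h.range (k + n)
  exact h1.trans (h3.le.trans h2)

/-- The critical value is not the left endpoint of a maximal wandering interval. -/
theorem elim (h : BoundaryCase f c ℓm ℓp d) : False := by
  obtain ⟨J, hJ⟩ : ∃ J, J = f^[2] '' Icc (f c) d := ⟨_, rfl⟩
  have hch := h.chain
  rw [← hJ] at hch
  obtain ⟨C, m, M, hE⟩ := h.unimodal.exists_sideEstimates h.range
  obtain ⟨η, hη0, hη⟩ := h.exists_le_imgRatio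
  have hη1 : η ≤ 1 := (hη 0).trans (h.chain.imgRatio_lt_one h.unimodal h.range
    (h.chain.closestReturn_pos h.continuous 0)).le
  obtain ⟨δ, hδ⟩ : ∃ δ, δ = η / (3 * Real.exp (C * 8)) := ⟨_, rfl⟩
  obtain ⟨κ, hκ⟩ : ∃ κ, κ = δ ^ 2 / ((1 + 2 * δ) * Real.exp (C * 8)) := ⟨_, rfl⟩
  have hδ0 : 0 < δ := by rw [hδ]; positivity
  have hκ0 : 0 < κ := by rw [hκ]; positivity
  obtain ⟨x, -, y, -, huw, himg⟩ := exists_Icc_iterate_of_maximal h.unimodal h.continuous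
    h.range h.maximal 2
  set u := f^[2] x
  set w := f^[2] y
  set E := Ioo (u - κ * (w - u)) (w + κ * (w - u)) with hEdef
  have hκl : 0 < κ * (w - u) := mul_pos hκ0 (by linarith)
  have key : ∀ N, ∃ n, N ≤ n ∧ E ⊆ Icc 0 1 ∧ ∀ l < n, c ∉ f^[l] '' E := by
    intro N
    obtain ⟨N', hN'⟩ := eventually_atTop.1 (h.eventually_add_three_le hJ)
    obtain ⟨k, hk, hlen, hgood⟩ := h.exists_good hJ (fun _ => rfl) (max N N')
    have hm := hch.closestReturn_strictMono h.continuous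
    have hq : closestReturn f c J k + 2 + 3 ≤ closestReturn f c J (k + 1) + 2 := by
      have := hN' k ((le_max_right _ _).trans hk)
      omega
    have H := h.consecutiveReturns hJ k
    have hn : N ≤ closestReturn f c J (k + 1) := by
      have h1 := hm.id_le (k + 1)
      have h2 := (le_max_left _ _).trans hk
      simp only [id] at h1
      omega
    have hab₂ := H.ab₂
    have hba₂ := H.ba₂
    have hab₁ := H.ab₁
    have hb₂ := hch.sup_lt h.unimodal h.range (hch.closestReturn_pos h.continuous (k + 2))
    have hfin : ∀ ρ, imgSup f J (closestReturn f c J (k + 1)) < ρ → ρ ≤ f c →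
        (ρ ≤ imgSup f J (closestReturn f c J (k + 2)) ∨
          closestReturn f c J (k + 2) + 2 - (closestReturn f c J (k + 1) + 2) ≠
            closestReturn f c J (k + 1) + 2 - (closestReturn f c J k + 2)) →
        η * (imgSup f J (closestReturn f c J (k + 1)) - imgInf f J (closestReturn f c J (k + 1))) ≤
          ρ - imgSup f J (closestReturn f c J (k + 1)) →
        ∃ n, N ≤ n ∧ E ⊆ Icc 0 1 ∧ ∀ l < n, c ∉ f^[l] '' E := by
      intro ρ hρ1 hρ2 hρ hright
      obtain ⟨τ₁, τ₂, P⟩ := H.exists_pullback h hq hρ1 hρ2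
      obtain ⟨h1, h2⟩ := H.space h P hρ hq hE hη0 hη1 hη hlen hright hδ huw himg
      rw [← hκ] at h1 h2
      have hET : E ⊆ Ioo τ₁ τ₂ := Ioo_subset_Ioo (by linarith) (by linarith)
      refine ⟨_, hn, hET.trans (Ioo_subset_Icc_self.trans (P.subset_Icc h)), fun l hl hcl => ?_⟩
      exact P.notMem l (by omega) (image_mono hET hcl)
    rcases hgood with h1 | h1
    · refine hfin _ (by linarith) hb₂.le (Or.inl le_rfl) ?_
      nlinarith
    · refine hfin (f c) (by linarith) le_rfl (Or.inr (by omega)) ?_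
      have h2 := hη (k + 1)
      rw [← hJ, imgRatio, le_div_iff₀ (by linarith)] at h2
      refine le_trans ?_ h2
      gcongr
      linarith
  obtain ⟨-, -, hE01, -⟩ := key 0
  obtain ⟨n, hn⟩ := h.unimodal.not_notMem_of_maximal h.continuous h.range h.maximal (N := 2)
    hE01 ordConnected_Ioo fun x hx => mem_nhdsWithin_of_mem_nhds (by
      have h1 : f^[2] x ∈ Icc u w := himg ▸ mem_image_of_mem _ hx
      exact Ioo_mem_nhds (by linarith [h1.1]) (by linarith [h1.2]))
  obtain ⟨n', hn', -, hc⟩ := key (n + 1)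
  exact hc n (by omega) hn

end BoundaryCase

section Extension

variable {f g : ℝ → ℝ} {c ℓm ℓp : ℝ}

/-- Non-flatness on one side of `c` implies one-sided continuity at `c`. -/
theorem continuousWithinAt_of_abs_eq_rpow {s : Set ℝ} {ℓ : ℝ} (hℓ : 0 < ℓ)
    (φ ψ : Diffeomorph 𝓘(ℝ, ℝ) 𝓘(ℝ, ℝ) ℝ ℝ (2 : ℕ)) (hφ : φ c = 0) (hψ : ψ (f c) = 0)
    (h : ∀ᶠ x in 𝓝 c, x ∈ s → |ψ (f x)| = |φ x| ^ ℓ) : ContinuousWithinAt f s c := by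
  have h1 : Tendsto (fun x => |φ x| ^ ℓ) (𝓝[s] c) (𝓝 0) := by
    have h2 : Continuous fun x => |φ x| ^ ℓ :=
      φ.continuous.abs.rpow_const fun _ => Or.inr hℓ.le
    have h3 := h2.tendsto c
    rw [hφ, abs_zero, Real.zero_rpow hℓ.ne'] at h3
    exact h3.mono_left nhdsWithin_le_nhds
  have h2 : Tendsto (fun x => |ψ (f x)|) (𝓝[s] c) (𝓝 0) := by
    refine h1.congr' ?_
    filter_upwards [nhdsWithin_le_nhds h, self_mem_nhdsWithin] with x hx hxs
    exact (hx hxs).symm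
  have h3 : Tendsto (fun x => ψ (f x)) (𝓝[s] c) (𝓝 0) := tendsto_zero_iff_abs_tendsto_zero _ |>.2 h2
  have h4 := (ψ.symm.continuous.tendsto 0).comp h3
  have h5 : ψ.symm 0 = f c := by rw [← hψ, ψ.symm_apply_apply]
  rw [h5] at h4
  refine h4.congr fun x => ?_
  exact ψ.symm_apply_apply (f x)

theorem IsUnimodal.continuousOn (hf : IsUnimodal 2 f c ℓm ℓp) : ContinuousOn f (Icc 0 1) := by
  intro x hx
  by_cases hxc : x = c
  · subst hxc
    refine ContinuousAt.continuousWithinAt ?_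
    rw [continuousAt_iff_continuous_left_right]
    obtain ⟨φ, ψ, hφ, hψ, h⟩ := hf.left
    obtain ⟨φ', ψ', hφ', hψ', h'⟩ := hf.right
    exact ⟨continuousWithinAt_of_abs_eq_rpow (by linarith [hf.one_le_left]) φ ψ hφ hψ h,
      continuousWithinAt_of_abs_eq_rpow (by linarith [hf.one_le_right]) φ' ψ' hφ' hψ' h'⟩
  · have h1 := hf.contDiffOn.continuousOn x ⟨hx, hxc⟩
    rw [sdiff_eq, continuousWithinAt_inter (isOpen_compl_singleton.mem_nhds hxc)] at h1
    exact h1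

theorem IsUnimodal.congr (hf : IsUnimodal 2 f c ℓm ℓp) (h : EqOn g f (Icc 0 1)) :
    IsUnimodal 2 g c ℓm ℓp := by
  have hc : c ∈ Icc (0 : ℝ) 1 := Ioo_subset_Icc_self hf.mem
  have hnear : ∀ᶠ x in 𝓝 c, g x = f x :=
    Filter.mem_of_superset (Icc_mem_nhds hf.mem.1 hf.mem.2) h
  refine
    { mapsTo := fun x hx => by rw [h hx]; exact hf.mapsTo hx
      mem := hf.mem
      strictMonoOn := hf.strictMonoOn.congr (h.mono (Icc_subset_Icc_right hc.2)).symm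
      strictAntiOn := hf.strictAntiOn.congr (h.mono (Icc_subset_Icc_left hc.1)).symm
      contDiffOn := hf.contDiffOn.congr (h.mono sdiff_subset)
      deriv_ne_zero := fun x hx => by
        rw [derivWithin_congr h (h hx.1)]; exact hf.deriv_ne_zero x hx
      one_le_left := hf.one_le_left
      one_le_right := hf.one_le_right
      left := ?_
      right := ?_ }
  · obtain ⟨φ, ψ, hφ, hψ, h'⟩ := hf.left
    refine ⟨φ, ψ, hφ, by rw [h hc, hψ], ?_⟩
    filter_upwards [h', hnear] with x hx hgx
    rwa [hgx]
  · obtain ⟨φ, ψ, hφ, hψ, h'⟩ := hf.right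
    refine ⟨φ, ψ, hφ, by rw [h hc, hψ], ?_⟩
    filter_upwards [h', hnear] with x hx hgx
    rwa [hgx]

theorem iterate_eq_of_eqOn (hf : MapsTo f (Icc 0 1) (Icc 0 1)) (h : EqOn g f (Icc 0 1)) (n : ℕ) :
    EqOn g^[n] f^[n] (Icc 0 1) := by
  intro x hx
  induction n with
  | zero => rfl
  | succ n ih => rw [Function.iterate_succ_apply', Function.iterate_succ_apply', ih,
      h (hf.iterate n hx)]

theorem image_iterate_eq_of_eqOn (hf : MapsTo f (Icc 0 1) (Icc 0 1)) (h : EqOn g f (Icc 0 1))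
    {A : Set ℝ} (hA : A ⊆ Icc 0 1) (n : ℕ) : g^[n] '' A = f^[n] '' A :=
  ((iterate_eq_of_eqOn hf h n).mono hA).image_eq

theorem omegaSet_eq_of_eqOn (hf : MapsTo f (Icc 0 1) (Icc 0 1)) (h : EqOn g f (Icc 0 1)) {x : ℝ}
    (hx : x ∈ Icc (0 : ℝ) 1) : omegaSet g x = omegaSet f x := by
  ext z
  rw [mem_omegaSet_iff, mem_omegaSet_iff]
  simp only [iterate_eq_of_eqOn hf h _ hx]

theorem omegaSet_subset_Icc (hf : MapsTo f (Icc 0 1) (Icc 0 1)) {x : ℝ} (hx : x ∈ Icc (0 : ℝ) 1) :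
    omegaSet f x ⊆ Icc 0 1 := by
  intro z hz
  rw [mem_omegaSet_iff] at hz
  rw [← isClosed_Icc.closure_eq, Metric.mem_closure_iff]
  intro ε hε
  obtain ⟨n, hn⟩ := (hz ε hε).exists
  exact ⟨f^[n] x, hf.iterate n hx, by rw [dist_comm]; exact hn⟩

theorem IsPeriodicOrbit.congr (hf : MapsTo f (Icc 0 1) (Icc 0 1)) (h : EqOn g f (Icc 0 1))
    {S : Set ℝ} (hS : S ⊆ Icc 0 1) (hp : IsPeriodicOrbit f S) : IsPeriodicOrbit g S := by
  obtain ⟨p, ⟨n, hn, hpn⟩, rfl⟩ := hp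
  have hp : p ∈ Icc (0 : ℝ) 1 := hS ⟨0, rfl⟩
  refine ⟨p, ⟨n, hn, (iterate_eq_of_eqOn hf h n hp).trans hpn⟩, ?_⟩
  congr 1
  funext i
  exact (iterate_eq_of_eqOn hf h i hp).symm

theorem IsWanderingInterval.congr {J : Set ℝ} (hf : MapsTo f (Icc 0 1) (Icc 0 1))
    (h : EqOn g f (Icc 0 1)) (hJ : IsWanderingInterval f J) : IsWanderingInterval g J where
  subset := hJ.subset
  ordConnected := hJ.ordConnected
  nontrivial := hJ.nontrivial
  disjoint := fun m n hmn => by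
    beta_reduce
    rw [image_iterate_eq_of_eqOn hf h hJ.subset, image_iterate_eq_of_eqOn hf h hJ.subset]
    exact hJ.disjoint hmn
  omega := fun x hx hp => by
    have hg : MapsTo g (Icc 0 1) (Icc 0 1) := fun y hy => h hy ▸ hf hy
    rw [omegaSet_eq_of_eqOn hf h (hJ.subset hx)] at hp
    exact hJ.omega x hx (hp.congr hg h.symm (omegaSet_subset_Icc hf (hJ.subset hx)))

theorem isClosestReturn_congr (hf : MapsTo f (Icc 0 1) (Icc 0 1)) (h : EqOn g f (Icc 0 1))
    (hc : c ∈ Icc (0 : ℝ) 1) {Q : Set ℝ} (hQ : Q ⊆ Icc 0 1) :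
    IsClosestReturn g c Q = IsClosestReturn f c Q := by
  funext n
  simp only [IsClosestReturn, image_iterate_eq_of_eqOn hf h hQ, h hc]

theorem eta_congr (hf : MapsTo f (Icc 0 1) (Icc 0 1)) (h : EqOn g f (Icc 0 1))
    (hc : c ∈ Icc (0 : ℝ) 1) {Q : Set ℝ} (hQ : Q ⊆ Icc 0 1) (k : ℕ) :
    eta g c Q k = eta f c Q k := by
  have h1 : returnTime g c Q k = returnTime f c Q k := by
    cases k with
    | zero => rfl
    | succ k => simp only [returnTime, isClosestReturn_congr hf h hc hQ]
  simp only [eta, leftEnd, rightEnd, h1, image_iterate_eq_of_eqOn hf h hQ, h hc]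

end Extension

section Conclusion

variable {f : ℝ → ℝ} {c ℓm ℓp : ℝ} {Q : Set ℝ}

theorem eta_succ (hf : IsUnimodal 2 f c ℓm ℓp) (hc : Continuous f)
    (hr : ∀ x, f x ∈ Icc (0 : ℝ) 1) (h : WanderingChain f c Q) (k : ℕ) :
    eta f c Q (k + 1) = imgRatio f c Q (closestReturn f c Q k) := by
  have h1 := h.sup_lt hf hr (h.closestReturn_pos hc k)
  have h2 := h.inf_lt_sup (closestReturn f c Q k)
  change |imgSup f Q (closestReturn f c Q k) - f c| / |imgInf f Q (closestReturn f c Q k) - f c| = _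
  rw [abs_of_neg (by linarith), abs_of_neg (by linarith), neg_sub, neg_sub, imgRatio]

theorem infinite_and_eta_le_of_continuous (hf : IsUnimodal 2 f c ℓm ℓp) (hc : Continuous f)
    (hr : ∀ x, f x ∈ Icc (0 : ℝ) 1) (hQ : Maximal (IsWanderingInterval f) Q) :
    {n : ℕ | IsClosestReturn f c Q n}.Infinite ∧
      ∃ C : ℝ, 0 < C ∧ ∀ᶠ k : ℕ in atTop, eta f c Q (k + 1) ≤ C * eta f c Q k ^ max ℓp ℓm := by
  have hN : ∀ n, f c ∉ f^[n + 0] '' Q := by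
    intro n hn
    obtain ⟨-, d, hd, rfl⟩ := hf.eq_Icc_of_mem_image hc hr hQ hn
    exact BoundaryCase.elim ⟨hf, hc, hr, hd, hQ⟩
  have h := hf.wanderingChain hc hr hQ 0 hN
  rw [Function.iterate_zero, image_id] at h
  refine ⟨h.infinite hc, ?_⟩
  obtain ⟨C, hC, hle⟩ := h.exists_imgRatio_le hf hc hr
  refine ⟨C, hC, ?_⟩
  filter_upwards [eventually_ge_atTop 2] with k hk
  obtain ⟨j, rfl⟩ : ∃ j, k = j + 2 := ⟨k - 2, by omega⟩
  rw [eta_succ hf hc hr h, show j + 2 = j + 1 + 1 by omega, eta_succ hf hc hr h]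
  exact hle j

end Conclusion

theorem lemmaC (f : ℝ → ℝ) (c ℓm ℓp : ℝ) (hf : IsUnimodal 2 f c ℓm ℓp)
    (Q : Set ℝ) (hQ : Maximal (IsWanderingInterval f) Q) :
    {n : ℕ | IsClosestReturn f c Q n}.Infinite ∧
      ∃ C : ℝ, 0 < C ∧ ∀ᶠ k : ℕ in atTop, eta f c Q (k + 1) ≤ C * eta f c Q k ^ max ℓp ℓm := by
  have hc : c ∈ Icc (0 : ℝ) 1 := Ioo_subset_Icc_self hf.mem
  obtain ⟨g, hg⟩ : ∃ g : ℝ → ℝ, g = IccExtend zero_le_one ((Icc 0 1).domRestrict f) := ⟨_, rfl⟩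
  have hgf : EqOn g f (Icc 0 1) := fun x hx => by
    rw [hg, IccExtend_of_mem _ _ hx, domRestrict_apply]
  have hgc : Continuous g := by
    rw [hg]
    exact hf.continuousOn.domRestrict.Icc_extend'
  have hgr : ∀ x, g x ∈ Icc (0 : ℝ) 1 := fun x => by
    rw [hg]
    exact hf.mapsTo (projIcc 0 1 zero_le_one x).2
  have hgm : MapsTo g (Icc 0 1) (Icc 0 1) := fun x _ => hgr x
  have hQg : Maximal (IsWanderingInterval g) Q :=
    ⟨hQ.1.congr hf.mapsTo hgf, fun J hJ hQJ => hQ.2 (hJ.congr hgm hgf.symm) hQJ⟩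
  have key := infinite_and_eta_le_of_continuous (hf.congr hgf) hgc hgr hQg
  rw [isClosestReturn_congr hf.mapsTo hgf hc hQ.1.subset] at key
  simpa only [eta_congr hf.mapsTo hgf hc hQ.1.subset] using key
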